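/- Let $\alpha$ be an indeterminate, $b:=\alpha-1$, and work over the field $\mathbb{Q}(\alpha)$. Symmetric functions are identified with polynomials in the power sums $\mathbf p=(p_1,p_2,\dots)$. Let $\langle\cdot,\cdot\rangle_\alpha$ be the bilinear form with $\langle p_\lambda,p_\mu\rangle_\alpha=z_\lambda\alpha^{\ell(\lambda)}\delta_{\lambda,\mu}$, where $z_\lambda=\prod_{i\ge1}m_i(\lambda)!\,i^{m_i(\lambda)}$, $m_i(\lambda)$ is the number of parts of $\lambda$ equal to $i$, and $\ell(\lambda)$ is the number of parts of $\lambda$. The Jack symmetric functions $J_\lambda^{(\alpha)}=J_\lambda^{(\alpha)}(\mathbf p)$ are the unique family indexed by all partitions such that $\langle J_\lambda^{(\alpha)},J_\mu^{(\alpha)}\rangle_\alpha=0$ for $\lambda\neq\mu$; the coefficient of the monomial symmetric function $m_\mu$ in $J_\lambda^{(\alpha)}$ is $0$ unless $\mu\le\lambda$ in the dominance order (which requires $|\mu|=|\lambda|$); and the coefficient of $m_{1^n}$ in $J_\lambda^{(\alpha)}$ is $n!$ for $\lambda\vdash n$. Put $j_\lambda^{(\alpha)}=\langle J_\lambda^{(\alpha)},J_\lambda^{(\alpha)}\rangle_\alpha$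 and, for sequences of variables $\mathbf p,\mathbf q^{(0)},\mathbf q^{(1)}$, $$\tau_b^{(1)}(t,\mathbf p,\mathbf q^{(0)},\mathbf q^{(1)})=\sum_{n\ge0}t^n\sum_{\theta\vdash n}\frac{1}{j_\theta^{(\alpha)}}J_\theta^{(\alpha)}(\mathbf p)J_\theta^{(\alpha)}(\mathbf q^{(0)})J_\theta^{(\alpha)}(\mathbf q^{(1)}).$$ For a scalar $u$ write $\underline u=(u,u,\dots)$, that is, all power-sum variables of the alphabet are set equal to $u$. Let $q,r\ge1$ be integers and let $\lambda=(q\times r)\vdash n$ be the rectangular partition with $q$ parts, all equal to $r$ (so $n=qr$). Then $$J_\lambda^{(\alpha)}(\mathbf p)=[t^n]\,\tau_b^{(1)}\bigl(-t,\mathbf p,\underline{q},\underline{-r\alpha}\bigr),$$ where $[t^n]$ denotes extraction of the coefficient of $t^n$. -/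

import Mathlib

namespace JackPoly

/-- A partition of arbitrary size: a natural number together with a partition of it. -/
abbrev Ptn : Type := Σ n : ℕ, n.Partition

/-- `part mu i` is the `(i+1)`-st largest part of `mu`, and `0` beyond the length of `mu`. -/
def part {n : ℕ} (mu : n.Partition) (i : ℕ) : ℕ :=
  (mu.parts.sort (· ≥ ·)).getD i 0

/-- The dominance order: `mu ≤ lam` iff the sizes agree and every partial sum of the parts of `mu`
(in decreasing order) is at most the corresponding partial sum for `lam`. -/
def Dominated (mu lam : Ptn) : Prop :=
  mu.1 = lam.1 ∧
    ∀ i : ℕ, ∑ j ∈ Finset.range i, part mu.2 j ≤ ∑ j ∈ Finset.range i, part lam.2 j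

/-- The partition `1^n` with `n` parts equal to `1`. -/
def ones (n : ℕ) : n.Partition where
  parts := Multiset.replicate n 1
  parts_pos := fun hi => by rw [Multiset.eq_of_mem_replicate hi]; exact one_pos
  parts_sum := by simp

/-- The algebra of symmetric functions over `K`, written in the power sums:
the polynomial ring `K[p₁, p₂, …]`, in which `MvPolynomial.X i` is the power sum `p_i`.
The monomial `∏ p_i ^ (d i)` is `p_lam` for the partition `lam` with `m_i(lam) = d i`.
(In characteristic zero the power sums are algebraically independent generators.) -/
abbrev Sym (K : Type*) [Field K] : Type _ := MvPolynomial ℕ+ K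

/-- The expansion of a symmetric function in an alphabet of `N` variables `x₀, …, x_{N-1}`:
`p_i` becomes `x₀ ^ i + ⋯ + x_{N-1} ^ i`. -/
noncomputable def expand {K : Type*} [Field K] (N : ℕ) :
    Sym K →ₐ[K] MvPolynomial (Fin N) K :=
  MvPolynomial.aeval fun i : ℕ+ => MvPolynomial.psum (Fin N) K (i : ℕ)

/-- `[m_mu] f`, the coefficient of the monomial symmetric function `m_mu` in `f`.  As `m_mu` is the
sum of all distinct monomials whose exponents are a rearrangement of `mu`, this is the coefficient
of `x₀ ^ mu₁ x₁ ^ mu₂ ⋯` in the expansion of `f`; an alphabet of `|mu|` variables, which is at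
least the length of `mu`, suffices to read it off. -/
noncomputable def monomialCoeff {K : Type*} [Field K] (mu : Ptn) (f : Sym K) : K :=
  MvPolynomial.coeff (Finsupp.equivFunOnFinite.symm fun i : Fin mu.1 => part mu.2 (i : ℕ))
    (expand mu.1 f)

/-- `z_lam = ∏ m_i! i ^ m_i`, for the partition `lam` with multiplicities `m_i(lam) = d i`. -/
def zee (d : ℕ+ →₀ ℕ) : ℕ :=
  d.prod fun i m => m.factorial * (i : ℕ) ^ m

/-- The `α`-deformed Hall scalar product: the bilinear form with
`⟨p_lam, p_mu⟩ = z_lam α ^ ℓ(lam) δ_{lam, mu}`.  For `lam` with multiplicities `d`, the length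
`ℓ(lam)` is `d.degree = ∑ d i`. -/
noncomputable def hall {K : Type*} [Field K] (α : K) (f g : Sym K) : K :=
  ∑ d ∈ f.support, (zee d : K) * α ^ d.degree * (f.coeff d * g.coeff d)

/-- The characterization of the family of Jack symmetric functions of parameter `α`. -/
structure IsJackFamily {K : Type*} [Field K] (α : K) (J : Ptn → Sym K) : Prop where
  orthogonality : ∀ lam mu : Ptn, lam ≠ mu → hall α (J lam) (J mu) = 0
  triangularity : ∀ lam mu : Ptn, ¬ Dominated mu lam → monomialCoeff mu (J lam) = 0
  normalization : ∀ lam : Ptn,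
    monomialCoeff ⟨lam.1, ones lam.1⟩ (J lam) = (lam.1.factorial : K)

/-- The Jack symmetric functions `J_lam^{(α)}(p)` in the power sums: the family characterized by
`IsJackFamily` (it is chosen among the families with these properties, so that nothing is known
about it until such a family is shown to exist). -/
noncomputable def jack {K : Type*} [Field K] (α : K) : Ptn → Sym K :=
  Classical.epsilon fun J => IsJackFamily α J

/-- The squared norm `j_lam^{(α)} = ⟨J_lam, J_lam⟩_α`. -/
noncomputable def jackNorm {K : Type*} [Field K] (α : K) (lam : Ptn) : K :=
  hall α (jack α lam) (jack α lam)

/-- The function `τ_b^{(k)}(t, p, q⁰, …, q^k)` with `b = α - 1`, a power series in `t` over the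
polynomials in `k + 2` families of power-sum variables: `(0, m)` is `p_m` and `(i + 1, m)` is
`q^i_m`.  Its coefficient of `t ^ n` is
`∑_{θ ⊢ n} (1 / j_θ) J_θ(p) J_θ(q⁰) ⋯ J_θ(q^k)`. -/
noncomputable def tau {K : Type*} [Field K] (α : K) (k : ℕ) :
    PowerSeries (MvPolynomial (Fin (k + 2) × ℕ+) K) :=
  PowerSeries.mk fun n => ∑ θ : n.Partition,
    MvPolynomial.C (jackNorm α ⟨n, θ⟩)⁻¹ *
      ∏ i : Fin (k + 2), MvPolynomial.rename (fun m : ℕ+ => (i, m)) (jack α ⟨n, θ⟩)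

/-- The specialization of the variables of `τ^{(1)}` that keeps `p` and sets
`q⁰ = (u, u, …)` and `q¹ = (v, v, …)`. -/
noncomputable def specialize {K : Type*} [Field K] (u v : K) :
    MvPolynomial (Fin (1 + 2) × ℕ+) K →ₐ[K] Sym K :=
  MvPolynomial.aeval fun x : Fin 3 × ℕ+ =>
    (![MvPolynomial.X x.2, MvPolynomial.C u, MvPolynomial.C v] : Fin 3 → Sym K) x.1

/-- `τ_b^{(1)}(-t, p, u, v)` for constant alphabets `u = (u, u, …)` and `v = (v, v, …)`, as a power
series in `t` over the polynomials in the power sums `p`. -/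
noncomputable def tauNegSpecialized {K : Type*} [Field K] (α u v : K) : PowerSeries (Sym K) :=
  PowerSeries.evalNegHom (PowerSeries.map (specialize u v).toRingHom (tau α 1))

end JackPoly

/-!
Write `⟨·,·⟩` for the deformed Hall form (`hallForm`). The proof has two parts: the identity for any
family with the orthogonality and triangularity of the Jack functions, and the existence of a family
with the properties that characterize them.

*The identity.* Let `g_m` (`completeFun`) be the deformed complete functions, with generating
series `exp (∑ p_k z^k / (k α))`. By the reproducing property (`hallForm_prod_completeFun`),
`⟨g_μ, f⟩` is the coefficient of `m_μ` in `f`. For a family `J_θ` that is orthogonal and triangular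
for the dominance order (`IsOrthogonalTriangular`), each `g_θ` is therefore a combination of the
`J_ν` with `ν ≥ θ`. At the constant alphabet `q` the function `J_θ` takes its value at
`x₁ = ⋯ = x_q = 1`, which vanishes if `θ` has more than `q` parts. At the constant alphabet `-r α`
the generating series of the `g_m` becomes `(1 - z)^r`, so `g_θ`, and by descending induction
`J_θ`, vanishes if `θ` has a part larger than `r`. Among the partitions of `q r` only the rectangle
survives both conditions. Its coefficient `J_λ(q) J_λ(-r α) / j_λ` is the value at the two alphabets
of the reproducing kernel, which is the coefficient `(-1)^(q r)` of `(x₁ ⋯ x_q)^r` in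
`((1 - x₁) ⋯ (1 - x_q))^r` (`IsOrthogonalTriangular.rectangle`).

*Existence.* The field `ℚ(α)` is ordered by an embedding into `ℝ` that sends `α` to a positive
transcendental number (`exists_ratFunc_embedding`); for this order the Hall form is positive
definite. In degree `n`, work in `n` variables with `δ = (n - 1, …, 0)`. The product of a symmetric
polynomial `∑ f_γ x^γ` with the Vandermonde alternant `a_δ` is the sum of alternants
`∑ f_γ a_{γ+δ}`, and the Sekiguchi operator with parameter `u` multiplies the summand of `γ` by
`∏ (u + δ_i + α γ_i)` (`coeff_mul_alternant_sekiguchi`).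

* It is selfadjoint (`sekiguchi_selfAdjoint`), because its action on the reproducing kernel
  `∏ (1 - x_i y_j)^(-1/α)` is symmetric in `x` and `y`: up to factors that are
  symmetric themselves, it is generated by a determinant whose `(l, j)` entry is a function of the
  product `x_l y_j` alone (`det_cofactorMatrix_mul_det_kernelMatrix`, `sekiguchi_kernel_symmetric`).
* It is triangular, and for some `u` its eigenvalues are distinct, as `1` and `α` are independent
  over `ℚ`. This gives orthogonal triangular eigenvectors with leading coefficient `1`, which are
  eigenvectors for all `u` (`exists_isOrthogonalTriangular`).
* The normalization requires the coefficient at `1^n` to be nonzero. The coefficient of `u^(n-2)` in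
  the eigenvalue equations gives the Laplace–Beltrami equation (`laplaceBeltrami_equation`). Its
  eigenvalue is strictly monotone for the dominance order, so the equation determines the
  coefficients recursively as nonnegative combinations of coefficients at more spread-out exponents
  (`coeff_expand_nonneg`), and a nonzero coefficient whose exponent has least sum of squares can
  only be at `1^n` (`coeffAt_ones_ne_zero`).
-/

namespace JackPoly

open Finset.HasAntidiagonal (antidiagonal)

variable {K : Type*} [Field K]

/-! ### The deformed Hall form -/

theorem hall_eq_sum_of_subset (α : K) (f h : Sym K) (S : Finset (ℕ+ →₀ ℕ)) (hS : f.support ⊆ S) :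
    hall α f h = ∑ d ∈ S, (zee d : K) * α ^ d.degree * (f.coeff d * h.coeff d) := by
  refine Finset.sum_subset hS fun d _ hd => ?_
  rw [MvPolynomial.notMem_support_iff.mp hd]; ring

theorem hall_comm (α : K) (f h : Sym K) : hall α f h = hall α h f := by
  classical
  rw [hall_eq_sum_of_subset α f h _ (Finset.subset_union_left (s₂ := h.support)),
    hall_eq_sum_of_subset α h f _ (Finset.subset_union_right (s₁ := f.support))]
  exact Finset.sum_congr rfl fun d _ => by ring

theorem hall_add_right (α : K) (f h₁ h₂ : Sym K) :
    hall α f (h₁ + h₂) = hall α f h₁ + hall α f h₂ := by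
  simp only [hall, MvPolynomial.coeff_add, ← Finset.sum_add_distrib]
  exact Finset.sum_congr rfl fun d _ => by ring

theorem hall_smul_right (α c : K) (f h : Sym K) : hall α f (c • h) = c * hall α f h := by
  simp only [hall, MvPolynomial.coeff_smul, Finset.mul_sum, smul_eq_mul]
  exact Finset.sum_congr rfl fun d _ => by ring

/-- The deformed Hall scalar product as a bilinear map. -/
noncomputable def hallForm (α : K) : Sym K →ₗ[K] Sym K →ₗ[K] K :=
  LinearMap.mk₂ K (hall α)
    (fun f₁ f₂ h => by rw [hall_comm, hall_add_right, hall_comm, hall_comm α h f₂])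
    (fun c f h => by rw [hall_comm, hall_smul_right, hall_comm, smul_eq_mul])
    (hall_add_right α) (fun c f h => hall_smul_right α c f h)

theorem hallForm_apply (α : K) (f h : Sym K) : hallForm α f h = hall α f h := rfl

theorem hallForm_comm (α : K) (f h : Sym K) : hallForm α f h = hallForm α h f := hall_comm α f h

theorem hallForm_monomial (α : K) (d : ℕ+ →₀ ℕ) (a : K) (h : Sym K) :
    hallForm α (MvPolynomial.monomial d a) h = (zee d : K) * α ^ d.degree * (a * h.coeff d) := by
  classical
  rw [hallForm_apply, hall_eq_sum_of_subset α _ h {d} MvPolynomial.support_monomial_subset]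
  simp

theorem zee_ne_zero (d : ℕ+ →₀ ℕ) : zee d ≠ 0 := by
  refine Finset.prod_ne_zero_iff.mpr fun i _ => ?_
  positivity

theorem zee_add_single (d : ℕ+ →₀ ℕ) (k : ℕ+) :
    zee (d + Finsupp.single k 1) = zee d * ((d k + 1) * (k : ℕ)) := by
  classical
  have key : ∀ e : ℕ+ →₀ ℕ, zee e = ((e k).factorial * (k : ℕ) ^ e k) *
      (e.erase k).prod fun i m => m.factorial * (i : ℕ) ^ m := fun e =>
    (Finsupp.mul_prod_erase' e k _ fun _ => by simp).symm
  have he : (d + Finsupp.single k 1).erase k = d.erase k := by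
    ext i
    by_cases hi : i = k
    · subst hi; simp
    · simp [Finsupp.erase_ne hi]
  rw [key d, key (d + Finsupp.single k 1), he]
  simp only [Finsupp.add_apply, Finsupp.single_eq_same, Nat.factorial_succ, pow_succ]
  ring

theorem eq_zero_of_hallForm_eq_zero [CharZero K] {α : K} (hα : α ≠ 0) {f : Sym K}
    (h : ∀ g, hallForm α g f = 0) : f = 0 := by
  ext d
  have := h (MvPolynomial.monomial d 1)
  rw [hallForm_monomial] at this
  have hz : (zee d : K) ≠ 0 := by exact_mod_cast zee_ne_zero d
  simpa [hz, hα] using this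

/-- Multiplication by `p_k` is adjoint to the derivation `k α ∂/∂p_k`. -/
theorem hallForm_X_mul (α : K) (k : ℕ+) (f h : Sym K) :
    hallForm α (MvPolynomial.X k * f) h =
      (k : ℕ) * α * hallForm α f (MvPolynomial.pderiv k h) := by
  classical
  induction f using MvPolynomial.induction_on' with
  | monomial d a =>
    rw [mul_comm, MvPolynomial.X, MvPolynomial.monomial_mul, hallForm_monomial, hallForm_monomial,
      MvPolynomial.coeff_pderiv, zee_add_single, map_add]
    simp [pow_succ]
    ring
  | add f₁ f₂ h₁ h₂ =>
    rw [mul_add, map_add, map_add, LinearMap.add_apply, LinearMap.add_apply, h₁, h₂, mul_add]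

/-- Leibniz rule for a derivation of a commutative algebra and a finite product. -/
theorem derivation_prod {R A ι : Type*} [CommSemiring R] [CommSemiring A] [Algebra R A]
    [DecidableEq ι] (D : Derivation R A A) (s : Finset ι) (f : ι → A) :
    D (∏ i ∈ s, f i) = ∑ i ∈ s, (∏ j ∈ s.erase i, f j) * D (f i) := by
  induction s using Finset.induction_on with
  | empty => simp
  | insert a s ha ih =>
    rw [Finset.prod_insert ha, D.leibniz, ih, Finset.sum_insert ha, Finset.erase_insert ha,
      add_comm, smul_eq_mul, smul_eq_mul, Finset.mul_sum]
    congr 1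
    refine Finset.sum_congr rfl fun i hi => ?_
    have hne : a ≠ i := fun h => ha (h ▸ hi)
    rw [Finset.erase_insert_of_ne hne, Finset.prod_insert (by simp [ha]), mul_assoc]

/-! ### Complete functions and the reproducing property -/

/-- The power sum `p_m` as an element of `Sym K`, with the convention `p_0 = 0`. -/
noncomputable def powerSum (K : Type*) [Field K] (m : ℕ) : Sym K :=
  if h : 0 < m then MvPolynomial.X (m.toPNat h) else 0

@[simp] theorem powerSum_zero : powerSum K 0 = 0 := by simp [powerSum]

theorem powerSum_coe (k : ℕ+) : powerSum K (k : ℕ) = MvPolynomial.X k := by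
  rw [powerSum, dif_pos k.pos]; rfl

/-- The deformed complete symmetric functions `g_m`, defined by `g_0 = 1` and Newton's recursion
`α m g_m = p_1 g_{m-1} + ⋯ + p_m g_0`. Equivalently, `∑ g_m t^m = exp (∑ p_k t^k / (k α))`.
For `α = 1` they are the complete homogeneous symmetric functions. -/
noncomputable def completeFun (α : K) : ℕ → Sym K
  | 0 => 1
  | m + 1 => MvPolynomial.C (α * (m + 1))⁻¹ *
      ∑ i : Fin (m + 1), powerSum K (i + 1) * completeFun α (m - i)
  termination_by m => m
  decreasing_by omega

@[simp] theorem completeFun_zero (α : K) : completeFun α 0 = 1 := by simp [completeFun]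

theorem newton_completeFun [CharZero K] {α : K} (hα : α ≠ 0) (m : ℕ) :
    MvPolynomial.C (α * m) * completeFun α m =
      ∑ ij ∈ antidiagonal m, powerSum K ij.1 * completeFun α ij.2 := by
  cases m with
  | zero => simp
  | succ m =>
    have hm : α * ((m : K) + 1) ≠ 0 := mul_ne_zero hα (by exact_mod_cast m.succ_ne_zero)
    rw [completeFun, Finset.Nat.sum_antidiagonal_eq_sum_range_succ_mk, Finset.sum_range_succ',
      ← mul_assoc, ← MvPolynomial.C_mul, Nat.cast_succ, mul_inv_cancel₀ hm,
      Finset.sum_range fun i => powerSum K (i + 1) * completeFun α (m + 1 - (i + 1))]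
    simp

theorem pderiv_powerSum (k : ℕ+) (m : ℕ) :
    MvPolynomial.pderiv k (powerSum K m) = if m = k then 1 else 0 := by
  unfold powerSum
  split_ifs with h h' h'
  · have : m.toPNat h = k := PNat.eq h'
    rw [this, MvPolynomial.pderiv_X_self]
  · have : m.toPNat h ≠ k := fun e => h' (congrArg PNat.val e)
    rw [MvPolynomial.pderiv_X_of_ne this]
  · exact absurd k.pos (h' ▸ h)
  · simp

theorem pderiv_completeFun [CharZero K] {α : K} (hα : α ≠ 0) (k : ℕ+) (m : ℕ) :
    MvPolynomial.pderiv k (completeFun α m) =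
      MvPolynomial.C ((k : ℕ) * α)⁻¹ * if (k : ℕ) ≤ m then completeFun α (m - k) else 0 := by
  have hk : ((k : ℕ) : K) ≠ 0 := by exact_mod_cast k.ne_zero
  induction m using Nat.strong_induction_on with
  | _ m ih =>
  rcases Nat.eq_zero_or_pos m with rfl | hm
  · simp [k.pos.ne']
  have hm' : (m : K) ≠ 0 := by exact_mod_cast hm.ne'
  set G : PowerSeries (Sym K) := PowerSeries.mk (completeFun α) with hG
  set P : PowerSeries (Sym K) := PowerSeries.mk (powerSum K) with hP
  have hPG : ∀ j, PowerSeries.coeff j (P * G) = MvPolynomial.C (α * j) * completeFun α j :=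
    fun j => by
      rw [newton_completeFun hα, PowerSeries.coeff_mul]
      simp [hG, hP]
  have h1 : ∑ ij ∈ antidiagonal m,
      MvPolynomial.pderiv k (powerSum K ij.1) * completeFun α ij.2 =
      if (k : ℕ) ≤ m then completeFun α (m - k) else 0 := by
    have := PowerSeries.coeff_X_pow_mul' G (k : ℕ) m
    rw [PowerSeries.coeff_mul] at this
    simpa [PowerSeries.coeff_X_pow, pderiv_powerSum, hG] using this
  have h2 : ∑ ij ∈ antidiagonal m,
      powerSum K ij.1 * MvPolynomial.pderiv k (completeFun α ij.2) =
      MvPolynomial.C ((k : ℕ) * α)⁻¹ *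
        if (k : ℕ) ≤ m then MvPolynomial.C (α * (m - k : ℕ)) * completeFun α (m - k) else 0 := by
    have h3 : ∑ ij ∈ antidiagonal m,
      powerSum K ij.1 * MvPolynomial.pderiv k (completeFun α ij.2) =
      MvPolynomial.C ((k : ℕ) * α)⁻¹ * PowerSeries.coeff m (P * (PowerSeries.X ^ (k : ℕ) * G)) := by
      rw [PowerSeries.coeff_mul, Finset.mul_sum]
      refine Finset.sum_congr rfl fun ij hij => ?_
      rw [Finset.HasAntidiagonal.mem_antidiagonal] at hij
      rcases Nat.eq_zero_or_pos ij.1 with h0 | h0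
      · simp [h0, hP]
      · rw [ih ij.2 (by omega), PowerSeries.coeff_X_pow_mul']
        simp only [hP, hG, PowerSeries.coeff_mk]
        ring
    rw [h3, mul_left_comm, PowerSeries.coeff_X_pow_mul']
    simp only [hPG]
  have h := congrArg (MvPolynomial.pderiv k) (newton_completeFun hα m)
  rw [Derivation.leibniz, MvPolynomial.pderiv_C, smul_zero, add_zero, map_sum] at h
  simp only [Derivation.leibniz, smul_eq_mul, Finset.sum_add_distrib] at h
  rw [h2, Finset.sum_congr rfl fun ij _ => mul_comm _ _, h1] at h
  refine mul_left_cancel₀ (MvPolynomial.C_ne_zero.mpr (mul_ne_zero hα hm')) (h.trans ?_)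
  split_ifs with hkm
  · rw [← mul_assoc, ← mul_assoc, ← MvPolynomial.C_mul, ← MvPolynomial.C_mul, ← add_one_mul,
      ← MvPolynomial.C_1, ← MvPolynomial.C_add]
    congr 2
    push_cast [Nat.cast_sub hkm]
    field_simp
    ring
  · simp

theorem constantCoeff_completeFun (α : K) (m : ℕ) :
    MvPolynomial.constantCoeff (completeFun α m) = if m = 0 then 1 else 0 := by
  cases m with
  | zero => simp
  | succ m => simp [completeFun, powerSum]

/-- The reproducing property: pairing with `g_{γ₁} g_{γ₂} ⋯` extracts the coefficient of
`x₁ ^ γ₁ x₂ ^ γ₂ ⋯` from the expansion of a symmetric function in variables indexed by `ι`. -/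
theorem hallForm_prod_completeFun [CharZero K] {α : K} (hα : α ≠ 0) {ι : Type*} [Fintype ι]
    (f : Sym K) (γ : ι →₀ ℕ) :
    hallForm α (∏ i, completeFun α (γ i)) f =
      MvPolynomial.coeff γ
        (MvPolynomial.aeval (fun k : ℕ+ => MvPolynomial.psum ι K (k : ℕ)) f) := by
  classical
  induction f using MvPolynomial.induction_on generalizing γ with
  | C a =>
    rw [hallForm_comm, ← MvPolynomial.monomial_zero', hallForm_monomial,
      MvPolynomial.monomial_zero',
      MvPolynomial.algHom_C, MvPolynomial.algebraMap_eq, MvPolynomial.coeff_C,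
      ← MvPolynomial.constantCoeff_eq, map_prod]
    simp only [constantCoeff_completeFun]
    by_cases h : γ = 0
    · simp [h, zee]
    · obtain ⟨i, hi⟩ := Finsupp.ne_iff.mp h
      rw [Finset.prod_eq_zero (Finset.mem_univ i) (if_neg hi), if_neg (Ne.symm h)]
      simp
  | add f₁ f₂ h₁ h₂ => simp [h₁, h₂]
  | mul_X f k ih =>
    have hk : ((k : ℕ) : K) * α ≠ 0 := mul_ne_zero (by exact_mod_cast k.ne_zero) hα
    rw [mul_comm, hallForm_comm, hallForm_X_mul, hallForm_comm, derivation_prod, map_mul,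
      MvPolynomial.aeval_X, MvPolynomial.psum, Finset.sum_mul, MvPolynomial.coeff_sum, map_sum,
      LinearMap.sum_apply, Finset.mul_sum]
    refine Finset.sum_congr rfl fun i _ => ?_
    rw [pderiv_completeFun hα, MvPolynomial.X_pow_eq_monomial, MvPolynomial.coeff_monomial_mul']
    have hle : Finsupp.single i (k : ℕ) ≤ γ ↔ (k : ℕ) ≤ γ i := by simp
    rw [← MvPolynomial.smul_eq_C_mul, mul_smul_comm, map_smul, LinearMap.smul_apply, smul_eq_mul,
      mul_inv_cancel_left₀ hk]
    simp only [hle]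
    split_ifs with h
    · rw [one_mul, ← ih, ← Finset.mul_prod_erase Finset.univ _ (Finset.mem_univ i), mul_comm]
      congr 3
      · simp
      · refine Finset.prod_congr rfl fun j hj => ?_
        have : i ≠ j := (Finset.ne_of_mem_erase hj).symm
        simp [this]
    · simp

/-! ### Parts of partitions -/

theorem card_parts_le {n : ℕ} (mu : n.Partition) : mu.parts.card ≤ n := by
  have := Multiset.card_nsmul_le_sum (s := mu.parts) (a := 1) fun x hx => mu.parts_pos hx
  simpa [mu.parts_sum] using this

theorem part_antitone {n : ℕ} (mu : n.Partition) : Antitone (part mu) := by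
  intro i j hij
  unfold part
  have hs := Multiset.pairwise_sort (r := (· ≥ ·)) mu.parts
  rcases lt_or_ge j (mu.parts.sort (· ≥ ·)).length with hj | hj
  · rw [List.getD_eq_getElem _ _ hj, List.getD_eq_getElem _ _ (hij.trans_lt hj)]
    rcases hij.eq_or_lt with rfl | h
    · exact le_rfl
    · exact List.pairwise_iff_getElem.mp hs _ _ _ _ h
  · rw [List.getD_eq_default _ _ hj]; exact Nat.zero_le _

theorem part_eq_zero {n : ℕ} (mu : n.Partition) {i : ℕ} (hi : mu.parts.card ≤ i) :
    part mu i = 0 :=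
  List.getD_eq_default _ _ (by rwa [Multiset.length_sort])

theorem part_pos {n : ℕ} (mu : n.Partition) {i : ℕ} (hi : i < mu.parts.card) :
    0 < part mu i := by
  have hi' : i < (mu.parts.sort (· ≥ ·)).length := by rwa [Multiset.length_sort]
  unfold part
  rw [List.getD_eq_getElem _ _ hi']
  exact mu.parts_pos ((Multiset.mem_sort (r := (· ≥ ·))).mp (List.getElem_mem hi'))

theorem map_part {n N : ℕ} (mu : n.Partition) (hN : mu.parts.card ≤ N) :
    (Finset.univ : Finset (Fin N)).val.map (fun i : Fin N => part mu i) =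
      mu.parts + Multiset.replicate (N - mu.parts.card) 0 := by
  have h : List.ofFn (fun i : Fin N => part mu i) =
      mu.parts.sort (· ≥ ·) ++ List.replicate (N - mu.parts.card) 0 := by
    refine List.ext_getElem (by simp; omega) fun i h₁ h₂ => ?_
    rw [List.getElem_ofFn, List.getElem_append]
    split_ifs with h
    · exact List.getD_eq_getElem _ _ h
    · rw [List.getElem_replicate]
      exact List.getD_eq_default _ _ (not_lt.mp h)
  rw [Fin.univ_val_map, h, ← Multiset.coe_add, Multiset.sort_eq, Multiset.coe_replicate]

theorem sum_part {n N : ℕ} (mu : n.Partition) (hN : mu.parts.card ≤ N) :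
    ∑ i ∈ Finset.range N, part mu i = n := by
  rw [Finset.sum_range, Finset.sum, map_part mu hN]
  simp [mu.parts_sum]

theorem partition_ext_part {n : ℕ} {mu nu : n.Partition} (h : ∀ i, part mu i = part nu i) :
    mu = nu := by
  have h' : ∀ ka : n.Partition, ka.parts =
      ((Finset.univ : Finset (Fin n)).val.map fun i : Fin n => part ka i).filter (· ≠ 0) :=
      fun ka => by
    rw [map_part ka (card_parts_le ka), Multiset.filter_add,
      Multiset.filter_eq_self.mpr fun a ha => (ka.parts_pos ha).ne',
      Multiset.filter_eq_nil.mpr fun a ha => by simp [Multiset.eq_of_mem_replicate ha], add_zero]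
  ext1
  rw [h' mu, h' nu]
  simp only [h]

/-- Two families of natural numbers with the same multiset of values differ by a permutation. -/
theorem exists_perm_of_map_eq {N : ℕ} {f g : Fin N → ℕ}
    (h : (Finset.univ : Finset (Fin N)).val.map f = (Finset.univ : Finset (Fin N)).val.map g) :
    ∃ σ : Equiv.Perm (Fin N), ∀ i, f (σ i) = g i := by
  have hsort : f ∘ Tuple.sort f = g ∘ Tuple.sort g := by
    apply List.ofFn_injective
    have hp : (List.ofFn (f ∘ Tuple.sort f)).Perm (List.ofFn (g ∘ Tuple.sort g)) := by
      refine (Equiv.Perm.ofFn_comp_perm _ f).trans (.trans ?_ (Equiv.Perm.ofFn_comp_perm _ g).symm)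
      rwa [← Multiset.coe_eq_coe, ← Fin.univ_val_map, ← Fin.univ_val_map]
    refine hp.eq_of_pairwise (le := (· ≤ ·)) (fun a b _ _ => le_antisymm) ?_ ?_
    · exact List.pairwise_ofFn.mpr fun i j hij => Tuple.monotone_sort f hij.le
    · exact List.pairwise_ofFn.mpr fun i j hij => Tuple.monotone_sort g hij.le
  refine ⟨(Tuple.sort g).symm.trans (Tuple.sort f), fun i => ?_⟩
  simpa using congrFun hsort ((Tuple.sort g).symm i)

/-- The partition obtained from a family of natural numbers by discarding zeros and sorting. -/
def ofFamily {n N : ℕ} (γ : Fin N → ℕ) (h : ∑ i, γ i = n) : n.Partition :=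
  Nat.Partition.ofSums n (Finset.univ.val.map γ) h

theorem map_eq_ofFamily_parts {n N : ℕ} (γ : Fin N → ℕ) (h : ∑ i, γ i = n) :
    ∃ k, (Finset.univ : Finset (Fin N)).val.map γ =
      (ofFamily γ h).parts + Multiset.replicate k 0 := by
  refine ⟨((Finset.univ : Finset (Fin N)).val.map γ).count 0, ?_⟩
  rw [← Multiset.filter_eq', add_comm]
  exact (Multiset.filter_add_not (· = 0) _).symm

theorem card_ofFamily_le {n N : ℕ} (γ : Fin N → ℕ) (h : ∑ i, γ i = n) :
    (ofFamily γ h).parts.card ≤ N := by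
  obtain ⟨k, hk⟩ := map_eq_ofFamily_parts γ h
  have := congrArg Multiset.card hk
  simp at this
  omega

theorem exists_perm_part {n N : ℕ} (γ : Fin N → ℕ) (h : ∑ i, γ i = n) :
    ∃ σ : Equiv.Perm (Fin N), ∀ i, γ (σ i) = part (ofFamily γ h) i := by
  apply exists_perm_of_map_eq
  obtain ⟨k, hk⟩ := map_eq_ofFamily_parts γ h
  rw [map_part _ (card_ofFamily_le γ h), hk]
  congr 2
  have := congrArg Multiset.card hk
  simp at this
  omega

/-! ### Dominance -/

/-- The sum of the `k` largest parts. -/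
def topSum {n : ℕ} (mu : n.Partition) (k : ℕ) : ℕ := ∑ j ∈ Finset.range k, part mu j

theorem dominated_iff {n : ℕ} (mu nu : n.Partition) :
    Dominated ⟨n, mu⟩ ⟨n, nu⟩ ↔ ∀ k, topSum mu k ≤ topSum nu k := by
  simp [Dominated, topSum]

theorem sum_le_sum_range_of_antitone {f : ℕ → ℕ} (hf : Antitone f) (I : Finset ℕ) :
    ∑ i ∈ I, f i ≤ ∑ j ∈ Finset.range I.card, f j := by
  induction I using Finset.induction_on_max with
  | empty => simp
  | insert m I hm ih =>
    have hmI : m ∉ I := fun h => lt_irrefl _ (hm m h)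
    rw [Finset.sum_insert hmI, Finset.card_insert_of_notMem hmI, Finset.sum_range_succ, add_comm]
    refine add_le_add ih (hf ?_)
    simpa using Finset.card_le_card fun x hx => Finset.mem_range.mpr (hm x hx)

theorem sum_part_le_topSum {n N : ℕ} (mu : n.Partition) (I : Finset (Fin N)) :
    ∑ i ∈ I, part mu i ≤ topSum mu I.card := by
  have := sum_le_sum_range_of_antitone (part_antitone mu) (I.map Fin.valEmbedding)
  simpa [topSum] using this

theorem sum_le_topSum_ofFamily {n N : ℕ} (γ : Fin N → ℕ) (h : ∑ i, γ i = n) (I : Finset (Fin N)) :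
    ∑ i ∈ I, γ i ≤ topSum (ofFamily γ h) I.card := by
  obtain ⟨σ, hσ⟩ := exists_perm_part γ h
  have := sum_part_le_topSum (N := N) (ofFamily γ h) (I.map σ.symm.toEmbedding)
  rw [Finset.card_map, Finset.sum_map] at this
  simpa [← hσ] using this

theorem topSum_of_card_le {n k : ℕ} (mu : n.Partition) (hk : mu.parts.card ≤ k) :
    topSum mu k = n := sum_part mu hk

theorem topSum_le {n k : ℕ} (mu : n.Partition) : topSum mu k ≤ n := by
  refine le_of_le_of_eq ?_
    (topSum_of_card_le mu (k := k + n) ((card_parts_le mu).trans (Nat.le_add_left _ _)))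
  exact Finset.sum_le_sum_of_subset (Finset.range_mono (Nat.le_add_right _ _))

theorem topSum_succ {n : ℕ} (mu : n.Partition) (k : ℕ) :
    topSum mu (k + 1) = topSum mu k + part mu k := Finset.sum_range_succ _ _

theorem eq_of_topSum_eq {n : ℕ} {mu nu : n.Partition} (h : ∀ k ≤ n, topSum mu k = topSum nu k) :
    mu = nu := by
  have h' : ∀ k, topSum mu k = topSum nu k := fun k => by
    rcases le_total k n with hk | hk
    · exact h k hk
    · rw [topSum_of_card_le mu ((card_parts_le mu).trans hk),
        topSum_of_card_le nu ((card_parts_le nu).trans hk)]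
  refine partition_ext_part fun i => ?_
  have h₁ := h' i
  have h₂ := h' (i + 1)
  rw [topSum_succ, topSum_succ] at h₂
  omega

/-- A strictly monotone statistic for the dominance order: the sum of all `topSum`s. -/
def height {n : ℕ} (mu : n.Partition) : ℕ := ∑ k ∈ Finset.range (n + 1), topSum mu k

theorem eq_of_dominated_of_height_le {n : ℕ} {mu nu : n.Partition}
    (h : ∀ k, topSum mu k ≤ topSum nu k) (hh : height nu ≤ height mu) : mu = nu := by
  refine eq_of_topSum_eq fun k hk => ?_
  have := (Finset.sum_eq_sum_iff_of_le fun k _ => h k).mp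
    (le_antisymm (Finset.sum_le_sum fun k _ => h k) hh) k (by simp; omega)
  exact this

theorem height_le_of_dominated {n : ℕ} {mu nu : n.Partition}
    (h : ∀ k, topSum mu k ≤ topSum nu k) : height mu ≤ height nu :=
  Finset.sum_le_sum fun k _ => h k

/-! ### Degrees and coefficients of monomial symmetric functions -/

/-- The homogeneous symmetric functions of degree `n`. -/
noncomputable abbrev symDeg (K : Type*) [Field K] (n : ℕ) : Submodule K (Sym K) :=
  MvPolynomial.weightedHomogeneousSubmodule K (fun i : ℕ+ => (i : ℕ)) n

theorem powerSum_mem (m : ℕ) : powerSum K m ∈ symDeg K m := by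
  rcases Nat.eq_zero_or_pos m with rfl | h
  · simp
  · exact powerSum_coe (K := K) ⟨m, h⟩ ▸ MvPolynomial.isWeightedHomogeneous_X K _ _

theorem symDeg_mul {a b : ℕ} {f h : Sym K} (hf : f ∈ symDeg K a) (hh : h ∈ symDeg K b) :
    f * h ∈ symDeg K (a + b) :=
  MvPolynomial.IsWeightedHomogeneous.mul hf hh

theorem completeFun_mem (α : K) (m : ℕ) : completeFun α m ∈ symDeg K m := by
  induction m using Nat.strong_induction_on with
  | _ m ih =>
  cases m with
  | zero => simpa using MvPolynomial.isWeightedHomogeneous_one K _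
  | succ m =>
    rw [completeFun, ← MvPolynomial.smul_eq_C_mul]
    refine Submodule.smul_mem _ _ (Submodule.sum_mem _ fun i _ => ?_)
    have := symDeg_mul (powerSum_mem (K := K) (i + 1)) (ih (m - i) (by omega))
    rwa [show (i : ℕ) + 1 + (m - i) = m + 1 by omega] at this

theorem prod_completeFun_mem (α : K) {n : ℕ} {ι : Type*} [Fintype ι] (γ : ι → ℕ)
    (h : ∑ i, γ i = n) : ∏ i, completeFun α (γ i) ∈ symDeg K n := by
  subst h
  exact MvPolynomial.IsWeightedHomogeneous.prod _ _ _ fun i _ => completeFun_mem α (γ i)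

theorem hallForm_eq_zero_of_degree_ne (α : K) {a b : ℕ} (hab : a ≠ b) {f h : Sym K}
    (hf : f ∈ symDeg K a) (hh : h ∈ symDeg K b) : hallForm α f h = 0 := by
  refine Finset.sum_eq_zero fun d hd => ?_
  have h1 : Finsupp.weight (fun i : ℕ+ => (i : ℕ)) d = a := hf (MvPolynomial.mem_support_iff.mp hd)
  rw [MvPolynomial.IsWeightedHomogeneous.coeff_eq_zero hh d (h1 ▸ hab)]
  simp

/-- The deformed complete function `g_μ = ∏ g_{μ_i}` of a partition. -/
noncomputable def completePtn (α : K) {n : ℕ} (mu : n.Partition) : Sym K :=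
  (mu.parts.map (completeFun α)).prod

theorem prod_completeFun_eq (α : K) {n N : ℕ} (γ : Fin N → ℕ) (mu : n.Partition) (k : ℕ)
    (h : (Finset.univ : Finset (Fin N)).val.map γ = mu.parts + Multiset.replicate k 0) :
    ∏ i, completeFun α (γ i) = completePtn α mu := by
  change (Multiset.map (completeFun α ∘ γ) _).prod = _
  rw [← Multiset.map_map (completeFun α) γ, h]
  simp [completePtn]

theorem prod_completeFun_part (α : K) {n N : ℕ} (mu : n.Partition) (hN : mu.parts.card ≤ N) :
    ∏ i : Fin N, completeFun α (part mu i) = completePtn α mu :=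
  prod_completeFun_eq α _ mu _ (map_part mu hN)

theorem prod_completeFun_ofFamily (α : K) {n N : ℕ} (γ : Fin N → ℕ) (h : ∑ i, γ i = n) :
    ∏ i, completeFun α (γ i) = completePtn α (ofFamily γ h) :=
  let ⟨k, hk⟩ := map_eq_ofFamily_parts γ h
  prod_completeFun_eq α γ _ k hk

theorem sum_part_fin {n N : ℕ} (mu : n.Partition) (hN : mu.parts.card ≤ N) :
    ∑ i : Fin N, part mu i = n := by
  rw [← Finset.sum_range (part mu), sum_part mu hN]

theorem completePtn_mem (α : K) {n : ℕ} (mu : n.Partition) : completePtn α mu ∈ symDeg K n := by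
  rw [← prod_completeFun_part α mu le_rfl]
  exact prod_completeFun_mem α _ (sum_part_fin mu le_rfl)

/-- The span of the `g_μ`, `μ ⊢ n`. -/
noncomputable def completeSpan (α : K) (n : ℕ) : Submodule K (Sym K) :=
  Submodule.span K (Set.range fun mu : n.Partition => completePtn α mu)

theorem completePtn_mul_mem (α : K) {a b : ℕ} (mu : a.Partition) (nu : b.Partition) :
    completePtn α mu * completePtn α nu ∈ completeSpan α (a + b) := by
  refine Submodule.subset_span ⟨⟨mu.parts + nu.parts, ?_, ?_⟩, ?_⟩
  · intro i hi
    rcases Multiset.mem_add.mp hi with h | h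
    exacts [mu.parts_pos h, nu.parts_pos h]
  · simp [mu.parts_sum, nu.parts_sum]
  · simp [completePtn]

theorem completeSpan_mul (α : K) {a b : ℕ} {f h : Sym K} (hf : f ∈ completeSpan α a)
    (hh : h ∈ completeSpan α b) : f * h ∈ completeSpan α (a + b) := by
  have : completeSpan α a * completeSpan α b ≤ completeSpan α (a + b) := by
    rw [completeSpan, completeSpan, Submodule.span_mul_span, Submodule.span_le]
    rintro _ ⟨_, ⟨mu, rfl⟩, _, ⟨nu, rfl⟩, rfl⟩
    exact completePtn_mul_mem α mu nu
  exact this (Submodule.mul_mem_mul hf hh)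

theorem completeFun_mem_completeSpan (α : K) (m : ℕ) : completeFun α m ∈ completeSpan α m := by
  have h : ∑ i : Fin 1, (fun _ => m) i = m := by simp
  exact Submodule.subset_span ⟨ofFamily _ h, (prod_completeFun_ofFamily α _ h).symm.trans (by simp)⟩

theorem powerSum_mem_completeSpan [CharZero K] {α : K} (hα : α ≠ 0) (m : ℕ) :
    powerSum K m ∈ completeSpan α m := by
  induction m using Nat.strong_induction_on with
  | _ m ih =>
  have h := newton_completeFun hα m
  rw [Finset.Nat.sum_antidiagonal_eq_sum_range_succ_mk, Finset.sum_range_succ] at h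
  simp only [Nat.sub_self, completeFun_zero, mul_one] at h
  rw [eq_sub_iff_add_eq'.mpr h.symm, ← MvPolynomial.smul_eq_C_mul]
  refine Submodule.sub_mem _ (Submodule.smul_mem _ _ (completeFun_mem_completeSpan α m))
    (Submodule.sum_mem _ fun i hi => ?_)
  have hi := Finset.mem_range.mp hi
  have := completeSpan_mul α (ih i hi) (completeFun_mem_completeSpan α (m - i))
  rwa [show i + (m - i) = m by omega] at this

/-- The functions `g_μ` with `μ ⊢ n` span the symmetric functions of degree `n`. -/
theorem symDeg_le_completeSpan [CharZero K] {α : K} (hα : α ≠ 0) (n : ℕ) :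
    symDeg K n ≤ completeSpan α n := by
  have hmon : ∀ d : ℕ+ →₀ ℕ, MvPolynomial.monomial d (1 : K) ∈
      completeSpan α (Finsupp.weight (fun i : ℕ+ => (i : ℕ)) d) := by
    intro d
    induction d using Finsupp.induction_linear with
    | zero =>
      simpa using completeFun_mem_completeSpan α 0
    | add d e hd he =>
      rw [map_add, ← one_mul (1 : K), ← MvPolynomial.monomial_mul]
      exact completeSpan_mul α hd he
    | single k m =>
      induction m with
      | zero => simpa using completeFun_mem_completeSpan α 0
      | succ m ih =>
        rw [Finsupp.single_add, map_add, ← one_mul (1 : K), ← MvPolynomial.monomial_mul]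
        refine completeSpan_mul α ih ?_
        simpa [powerSum_coe, MvPolynomial.X, Finsupp.weight_single] using
          powerSum_mem_completeSpan hα (k : ℕ)
  intro f hf
  rw [f.as_sum]
  refine Submodule.sum_mem _ fun d hd => ?_
  have h1 : Finsupp.weight (fun i : ℕ+ => (i : ℕ)) d = n := hf (MvPolynomial.mem_support_iff.mp hd)
  have := Submodule.smul_mem _ (f.coeff d) (h1 ▸ hmon d)
  rwa [MvPolynomial.smul_monomial, smul_eq_mul, mul_one] at this

/-- A homogeneous symmetric function is determined by its pairings with the `g_μ`, that is, by its
coefficients in the monomial symmetric functions. -/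
theorem eq_zero_of_coeffs_eq_zero [CharZero K] {α : K} (hα : α ≠ 0) {n : ℕ} {f : Sym K}
    (hf : f ∈ symDeg K n) (h : ∀ mu : n.Partition, hallForm α (completePtn α mu) f = 0) :
    f = 0 := by
  have hspan : ∀ h ∈ completeSpan α n, hallForm α h f = 0 := fun g hg => by
    induction hg using Submodule.span_induction with
    | mem x hx => obtain ⟨mu, rfl⟩ := hx; exact h mu
    | zero => simp
    | add x y _ _ hx hy => simp [hx, hy]
    | smul c x _ hx => simp [hx]
  refine eq_zero_of_hallForm_eq_zero hα fun g => ?_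
  induction g using MvPolynomial.induction_on' with
  | add p q hp hq => simp [hp, hq]
  | monomial d a =>
    by_cases hd : Finsupp.weight (fun i : ℕ+ => (i : ℕ)) d = n
    · exact hspan _ (symDeg_le_completeSpan hα n
        (MvPolynomial.isWeightedHomogeneous_monomial _ _ _ hd))
    · rw [hallForm_monomial, MvPolynomial.IsWeightedHomogeneous.coeff_eq_zero hf d hd]
      simp

theorem monomialCoeff_eq_hallForm [CharZero K] {α : K} (hα : α ≠ 0) {n : ℕ} (mu : n.Partition)
    (f : Sym K) : monomialCoeff ⟨n, mu⟩ f = hallForm α (completePtn α mu) f := by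
  rw [← prod_completeFun_part α mu (card_parts_le mu)]
  exact (hallForm_prod_completeFun hα f
    (Finsupp.equivFunOnFinite.symm fun i : Fin n => part mu (i : ℕ))).symm

/-! ### Orthogonal triangular families -/

/-- The dominance order on the partitions of `n`, in terms of sums of largest parts. -/
def DomLE {n : ℕ} (mu nu : n.Partition) : Prop := ∀ k, topSum mu k ≤ topSum nu k

theorem DomLE.trans {n : ℕ} {mu nu ka : n.Partition} (h : DomLE mu nu) (h' : DomLE nu ka) :
    DomLE mu ka := fun k => (h k).trans (h' k)

theorem DomLE.height_lt {n : ℕ} {mu nu : n.Partition} (h : DomLE mu nu) (hne : mu ≠ nu) :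
    height mu < height nu :=
  lt_of_not_ge fun hh => hne (eq_of_dominated_of_height_le h hh)

/-- The coefficient of the monomial symmetric function `m_μ`, as the linear functional
`⟨g_μ, ·⟩`. -/
noncomputable def coeffAt (α : K) {n : ℕ} (mu : n.Partition) : Sym K →ₗ[K] K :=
  hallForm α (completePtn α mu)

theorem hallForm_self_pos [LinearOrder K] [IsStrictOrderedRing K] {α : K} (hα : 0 < α) {f : Sym K}
    (hf : f ≠ 0) : 0 < hallForm α f f := by
  refine Finset.sum_pos (fun d hd => ?_) (MvPolynomial.support_nonempty.mpr hf)
  have h1 : (0 : K) < zee d := by exact_mod_cast (zee_ne_zero d).bot_lt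
  have h2 := mul_self_pos.mpr (MvPolynomial.mem_support_iff.mp hd)
  positivity

/-- Unitriangularity argument: if the `J_ν` are triangular for the dominance order with nonzero
diagonal coefficients for `ν` in a lower set `D`, then every homogeneous symmetric function
supported on `D` is a combination of the `J_ν`, `ν ∈ D`. -/
theorem mem_span_of_triangular [CharZero K] {α : K} (hα : α ≠ 0) {n : ℕ}
    {J : n.Partition → Sym K} (hdeg : ∀ nu, J nu ∈ symDeg K n)
    (htri : ∀ nu mu, ¬ DomLE mu nu → coeffAt α mu (J nu) = 0) (D : Finset n.Partition)
    (hD : ∀ nu ∈ D, ∀ mu, DomLE mu nu → mu ∈ D) (hlead : ∀ nu ∈ D, coeffAt α nu (J nu) ≠ 0)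
    {f : Sym K} (hf : f ∈ symDeg K n) (hfD : ∀ mu, mu ∉ D → coeffAt α mu f = 0) :
    f ∈ Submodule.span K (J '' D) := by
  classical
  induction D using Finset.strongInduction generalizing f with
  | _ D ih =>
  rcases D.eq_empty_or_nonempty with rfl | hne
  · rw [eq_zero_of_coeffs_eq_zero hα hf fun mu => hfD mu (Finset.notMem_empty mu)]
    exact Submodule.zero_mem _
  obtain ⟨mu, hmu, hmax⟩ := D.exists_max_image height hne
  set c := coeffAt α mu f / coeffAt α mu (J mu)
  have hsub : (J '' (D.erase mu : Finset _)) ⊆ J '' D :=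
    Set.image_mono (Finset.coe_subset.mpr (D.erase_subset mu))
  have h1 : f - c • J mu ∈ Submodule.span K (J '' (D.erase mu : Finset _)) := by
    refine ih _ (Finset.erase_ssubset hmu) ?_ ?_ (Submodule.sub_mem _ hf
      (Submodule.smul_mem _ _ (hdeg mu))) ?_
    · intro nu hnu ka hka
      obtain ⟨hnu', hnuD⟩ := Finset.mem_erase.mp hnu
      refine Finset.mem_erase.mpr ⟨?_, hD nu hnuD ka hka⟩
      rintro rfl
      exact hnu' (eq_of_dominated_of_height_le hka (hmax nu hnuD)).symm
    · exact fun nu hnu => hlead nu (Finset.mem_of_mem_erase hnu)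
    · intro nu hnu
      rw [map_sub, map_smul, smul_eq_mul]
      by_cases h : nu = mu
      · subst h; rw [div_mul_cancel₀ _ (hlead _ hmu), sub_self]
      · have hnuD : nu ∉ D := fun h' => hnu (Finset.mem_erase.mpr ⟨h, h'⟩)
        rw [hfD nu hnuD, htri mu nu fun h' => hnuD (hD mu hmu nu h'), mul_zero, sub_zero]
  have h2 : c • J mu ∈ Submodule.span K (J '' D) :=
    Submodule.smul_mem _ _ (Submodule.subset_span ⟨mu, hmu, rfl⟩)
  simpa using Submodule.add_mem _ (Submodule.span_mono hsub h1) h2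

/-- A family of nonzero symmetric functions of degree `n`, orthogonal for the deformed Hall form
and triangular for the dominance order. -/
structure IsOrthogonalTriangular (α : K) {n : ℕ} (J : n.Partition → Sym K) : Prop where
  mem : ∀ nu, J nu ∈ symDeg K n
  ne_zero : ∀ nu, J nu ≠ 0
  orth : ∀ nu mu, nu ≠ mu → hallForm α (J nu) (J mu) = 0
  tri : ∀ nu mu, ¬ DomLE mu nu → coeffAt α mu (J nu) = 0

namespace IsOrthogonalTriangular

variable [LinearOrder K] [IsStrictOrderedRing K] {α : K} {n : ℕ} {J : n.Partition → Sym K}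

theorem lead_ne_zero (hJ : IsOrthogonalTriangular α J) (hα : 0 < α) (nu : n.Partition) :
    coeffAt α nu (J nu) ≠ 0 := by
  classical
  induction h : height nu using Nat.strong_induction_on generalizing nu with
  | _ m ih =>
  subst h
  intro h0
  have hmem := mem_span_of_triangular hα.ne' hJ.mem hJ.tri
    (Finset.univ.filter fun mu => DomLE mu nu ∧ mu ≠ nu) (f := J nu) ?_ ?_ (hJ.mem nu) ?_
  · refine (hallForm_self_pos hα (hJ.ne_zero nu)).ne' ?_
    have hle : Submodule.span K (J '' (Finset.univ.filter fun mu => DomLE mu nu ∧ mu ≠ nu :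
        Finset n.Partition)) ≤ LinearMap.ker (hallForm α (J nu)) := by
      rw [Submodule.span_le]
      rintro _ ⟨mu, hmu, rfl⟩
      simp only [Finset.coe_filter, Finset.mem_univ, true_and, Set.mem_ofPred_eq] at hmu
      exact hJ.orth nu mu hmu.2.symm
    exact hle hmem
  · simp only [Finset.mem_filter, Finset.mem_univ, true_and]
    rintro mu ⟨h1, h2⟩ ka h3
    refine ⟨h3.trans h1, ?_⟩
    rintro rfl
    exact h2 (eq_of_dominated_of_height_le h1 (height_le_of_dominated h3))
  · simp only [Finset.mem_filter, Finset.mem_univ, true_and]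
    rintro mu ⟨h1, h2⟩
    exact ih _ (h1.height_lt h2) mu rfl
  · simp only [Finset.mem_filter, Finset.mem_univ, true_and, not_and, not_not]
    intro mu hmu
    by_cases h : DomLE mu nu
    · rw [hmu h, h0]
    · exact hJ.tri nu mu h

theorem mem_span (hJ : IsOrthogonalTriangular α J) (hα : 0 < α) (D : Finset n.Partition)
    (hD : ∀ nu ∈ D, ∀ mu, DomLE mu nu → mu ∈ D)
    {f : Sym K} (hf : f ∈ symDeg K n) (hfD : ∀ mu, mu ∉ D → coeffAt α mu f = 0) :
    f ∈ Submodule.span K (J '' D) :=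
  mem_span_of_triangular hα.ne' hJ.mem hJ.tri D hD (fun nu _ => hJ.lead_ne_zero hα nu) hf hfD

theorem norm_ne_zero (hJ : IsOrthogonalTriangular α J) (hα : 0 < α) (nu : n.Partition) :
    hallForm α (J nu) (J nu) ≠ 0 :=
  (hallForm_self_pos hα (hJ.ne_zero nu)).ne'

/-- The orthogonal expansion of a homogeneous symmetric function. -/
theorem expansion (hJ : IsOrthogonalTriangular α J) (hα : 0 < α) {f : Sym K}
    (hf : f ∈ symDeg K n) :
    f = ∑ nu, (hallForm α f (J nu) / hallForm α (J nu) (J nu)) • J nu := by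
  classical
  have h := hJ.mem_span hα Finset.univ (fun _ _ _ _ => Finset.mem_univ _) hf
    fun mu h => absurd (Finset.mem_univ mu) h
  rw [Finset.coe_univ, Set.image_univ] at h
  obtain ⟨c, rfl⟩ := (Submodule.mem_span_range_iff_exists_fun K).mp h
  refine Finset.sum_congr rfl fun nu _ => ?_
  congr 1
  rw [eq_div_iff (hJ.norm_ne_zero hα nu), map_sum, LinearMap.sum_apply,
    Finset.sum_eq_single nu]
  · simp
  · intro mu _ hmu
    simp [hJ.orth mu nu hmu]
  · simp

end IsOrthogonalTriangular

/-! ### Constant alphabets -/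

/-- Evaluation of a symmetric function at the constant alphabet `(u, u, …)`. -/
noncomputable def evalConst (u : K) : Sym K →ₐ[K] K := MvPolynomial.aeval fun _ : ℕ+ => u

theorem evalConst_powerSum (u : K) (m : ℕ) : evalConst u (powerSum K (m + 1)) = u := by
  rw [show powerSum K (m + 1) = MvPolynomial.X ⟨m + 1, m.succ_pos⟩ from
    powerSum_coe (K := K) ⟨m + 1, m.succ_pos⟩]
  exact MvPolynomial.aeval_X _ _

/-- At the constant alphabet `-r α`, the generating series of the `g_m` is `(1 - t) ^ r`. -/
theorem evalConst_completeFun [CharZero K] {α : K} (hα : α ≠ 0) (r m : ℕ) :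
    evalConst (-(r : K) * α) (completeFun α m) = (-1) ^ m * (r.choose m : K) := by
  have hsum : ∀ m : ℕ, α * m * evalConst (-(r : K) * α) (completeFun α m) =
      -(r : K) * α * ∑ i ∈ Finset.range m, evalConst (-(r : K) * α) (completeFun α i) := by
    intro m
    have h := congrArg (evalConst (-(r : K) * α)) (newton_completeFun hα m)
    rw [map_mul, MvPolynomial.algHom_C, map_sum, ← Finset.Nat.sum_antidiagonal_swap,
      Finset.Nat.sum_antidiagonal_eq_sum_range_succ_mk, Finset.sum_range_succ] at h
    simp only [Prod.fst_swap, Prod.snd_swap, Nat.sub_self, powerSum_zero, zero_mul, map_zero,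
      add_zero, map_mul, Algebra.algebraMap_self, RingHom.id_apply] at h
    rw [h, Finset.mul_sum]
    refine Finset.sum_congr rfl fun i hi => ?_
    obtain ⟨j, hj⟩ := Nat.exists_eq_add_of_lt (Finset.mem_range.mp hi)
    rw [show m - i = j + 1 by omega, evalConst_powerSum]
  induction m with
  | zero => simp
  | succ m ih =>
    have h := hsum (m + 1)
    rw [Finset.sum_range_succ, mul_add, ← hsum m, ih] at h
    have hm : (m : K) + 1 ≠ 0 := by exact_mod_cast m.succ_ne_zero
    refine mul_left_cancel₀ (mul_ne_zero hα hm) ?_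
    push_cast at h
    rw [h]
    have hc : ((r.choose (m + 1) : ℕ) : K) * (m + 1) = r.choose m * (r - m) := by
      rcases le_or_gt m r with hmr | hmr
      · rw [← Nat.cast_sub hmr]
        exact_mod_cast Nat.choose_succ_right_eq r m
      · simp [Nat.choose_eq_zero_of_lt hmr, Nat.choose_eq_zero_of_lt (hmr.trans m.lt_succ_self)]
    rw [pow_succ]
    linear_combination (α * (-1) ^ m) * hc

/-- Evaluation at the constant alphabet `q`, that is, at `q` variables equal to `1`, is the
pairing with the sum of the products `g_{γ₁} ⋯ g_{γ_q}`. -/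
theorem evalConst_natCast [CharZero K] {α : K} (hα : α ≠ 0) (q : ℕ) {n : ℕ} {f : Sym K}
    (hf : f ∈ symDeg K n) :
    evalConst (q : K) f = hallForm α (∑ γ ∈ Finset.finsuppAntidiag (Finset.univ : Finset (Fin q)) n,
      ∏ i, completeFun α (γ i)) f := by
  classical
  set F := MvPolynomial.aeval (fun k : ℕ+ => MvPolynomial.psum (Fin q) K (k : ℕ)) f with hF
  have h1 : evalConst (q : K) f = MvPolynomial.aeval (fun _ : Fin q => (1 : K)) F := by
    rw [hF, ← AlgHom.comp_apply, MvPolynomial.comp_aeval]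
    simp [evalConst, MvPolynomial.psum]
  have h2 : F.support ⊆ Finset.finsuppAntidiag (Finset.univ : Finset (Fin q)) n := by
    intro γ hγ
    rw [MvPolynomial.mem_support_iff, hF, ← hallForm_prod_completeFun hα] at hγ
    simp only [Finset.mem_finsuppAntidiag, Finset.subset_univ, and_true]
    by_contra h
    exact hγ (hallForm_eq_zero_of_degree_ne α h (prod_completeFun_mem α _ rfl) hf)
  rw [h1, map_sum, LinearMap.sum_apply, MvPolynomial.aeval_def, MvPolynomial.eval₂_eq]
  simp only [one_pow, Finset.prod_const_one, mul_one, Algebra.algebraMap_self, RingHom.id_apply,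
    hallForm_prod_completeFun hα, ← hF]
  exact Finset.sum_subset h2 fun γ _ h => MvPolynomial.notMem_support_iff.mp h

theorem evalConst_completePtn [CharZero K] {α : K} (hα : α ≠ 0) {n r : ℕ} (nu : n.Partition)
    (h : r < part nu 0) : evalConst (-(r : K) * α) (completePtn α nu) = 0 := by
  rw [← prod_completeFun_part α nu (N := n + 1) ((card_parts_le nu).trans n.le_succ), map_prod]
  refine Finset.prod_eq_zero (Finset.mem_univ 0) ?_
  rw [evalConst_completeFun hα, Nat.choose_eq_zero_of_lt (by simpa using h)]
  simp

namespace IsOrthogonalTriangular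

variable [LinearOrder K] [IsStrictOrderedRing K] {α : K} {n : ℕ} {J : n.Partition → Sym K}

/-- `J_θ` vanishes in fewer than `ℓ(θ)` variables, by triangularity. -/
theorem evalConst_natCast_eq_zero (hJ : IsOrthogonalTriangular α J) (hα : 0 < α) {q : ℕ}
    {th : n.Partition} (h : q < th.parts.card) : evalConst (q : K) (J th) = 0 := by
  rw [evalConst_natCast hα.ne' q (hJ.mem th), map_sum, LinearMap.sum_apply]
  refine Finset.sum_eq_zero fun γ hγ => ?_
  simp only [Finset.mem_finsuppAntidiag, Finset.subset_univ, and_true] at hγ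
  rw [prod_completeFun_ofFamily α γ hγ]
  refine hJ.tri th _ fun hdom => ?_
  have h1 := hdom q
  rw [topSum_of_card_le _ (card_ofFamily_le _ hγ)] at h1
  have h2 := topSum_succ th q
  have h3 := part_pos th h
  have h4 := topSum_le (k := q + 1) th
  omega

/-- `J_θ` vanishes at the constant alphabet `-r α` when `θ` has a part larger than `r`: it is a
combination of functions `g_ν` with `ν ≥ θ`, and these vanish there. -/
theorem evalConst_neg_eq_zero (hJ : IsOrthogonalTriangular α J) (hα : 0 < α) {r : ℕ}
    (th : n.Partition) (h : r < part th 0) : evalConst (-(r : K) * α) (J th) = 0 := by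
  induction hm : n * n + n - height th using Nat.strong_induction_on generalizing th with
  | _ m ih =>
  subst hm
  have hbound : ∀ nu : n.Partition, height nu ≤ n * n + n := fun nu => by
    refine (Finset.sum_le_card_nsmul _ _ n fun k _ => topSum_le nu).trans ?_
    simp [add_mul]
  have hexp := congrArg (evalConst (-(r : K) * α))
    (hJ.expansion hα (completePtn_mem α th))
  rw [evalConst_completePtn hα.ne' th h, map_sum, Finset.sum_eq_single th] at hexp
  · rw [map_smul, smul_eq_mul] at hexp
    exact (mul_eq_zero.mp hexp.symm).resolve_left
      (div_ne_zero (hJ.lead_ne_zero hα th) (hJ.norm_ne_zero hα th))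
  · intro nu _ hnu
    rw [map_smul, smul_eq_mul]
    by_cases hd : DomLE th nu
    · rw [ih _ ?_ nu ?_ rfl, mul_zero]
      · have := hd.height_lt hnu.symm
        have := hbound nu
        omega
      · have := hd 1
        simp only [topSum, Finset.sum_range_one] at this
        omega
    · rw [show hallForm α (completePtn α th) (J nu) = 0 from hJ.tri nu th hd]
      simp
  · simp

end IsOrthogonalTriangular

theorem eq_rectangle {n q r : ℕ} (hr : 1 ≤ r) (hn : n = q * r) (th : n.Partition)
    (h1 : th.parts.card ≤ q) (h2 : part th 0 ≤ r) : th.parts = Multiset.replicate q r := by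
  have hle : ∀ i : Fin q, part th i ≤ r := fun i => (part_antitone th (Nat.zero_le _)).trans h2
  have hsum := sum_part_fin th h1
  have hall : ∀ i : Fin q, part th i = r := by
    have := (Finset.sum_eq_sum_iff_of_le (s := Finset.univ) fun i _ => hle i).mp (by
      rw [hsum, hn]; simp)
    exact fun i => this i (Finset.mem_univ i)
  have hm := map_part th h1
  rw [show (fun i : Fin q => part th i) = Function.const _ r from funext hall,
    Multiset.map_const] at hm
  simp only [Finset.card_val, Finset.card_univ, Fintype.card_fin] at hm
  rcases h1.eq_or_lt with h | h
  · simpa [h] using hm.symm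
  · have h0 := hall ⟨th.parts.card, h⟩
    rw [part_eq_zero th le_rfl] at h0
    omega

/-- The value at `-r α` of the generating sum of the products `g_{γ₁} ⋯ g_{γ_q}`: all the
coefficients of `((1 - x₁) ⋯ (1 - x_q)) ^ r` of degree `q r` vanish except that of
`(x₁ ⋯ x_q) ^ r`. -/
theorem sum_evalConst_completeFun [CharZero K] {α : K} (hα : α ≠ 0) (q r : ℕ) :
    evalConst (-(r : K) * α)
      (∑ γ ∈ Finset.finsuppAntidiag (Finset.univ : Finset (Fin q)) (q * r),
        ∏ i, completeFun α (γ i)) = (-1) ^ (q * r) := by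
  classical
  rw [map_sum, Finset.sum_eq_single (Finsupp.equivFunOnFinite.symm fun _ => r)]
  · rw [map_prod, Finset.prod_congr rfl fun i _ => evalConst_completeFun hα r _]
    simp [← pow_mul, mul_comm]
  · intro γ hγ hne
    simp only [Finset.mem_finsuppAntidiag, Finset.subset_univ, and_true] at hγ
    obtain ⟨i, hi⟩ : ∃ i, r < γ i := by
      by_contra! hle
      refine hne (Finsupp.ext fun i => ?_)
      have := (Finset.sum_eq_sum_iff_of_le (s := Finset.univ) fun i _ => hle i).mp
        (by rw [hγ]; simp)
      simpa using this i (Finset.mem_univ i)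
    rw [map_prod]
    refine Finset.prod_eq_zero (Finset.mem_univ i) ?_
    rw [evalConst_completeFun hα, Nat.choose_eq_zero_of_lt hi]
    simp
  · intro h
    simp [Finset.mem_finsuppAntidiag] at h

/-- Only the rectangle contributes to the expansion of the kernel at the alphabets `q` and
`-r α`, and its coefficient is a sign. -/
theorem IsOrthogonalTriangular.rectangle [LinearOrder K] [IsStrictOrderedRing K] {α : K} {n : ℕ}
    {J : n.Partition → Sym K} (hJ : IsOrthogonalTriangular α J) (hα : 0 < α) {q r : ℕ}
    (hr : 1 ≤ r) (lam : n.Partition) (hlam : lam.parts = Multiset.replicate q r) :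
    J lam = (-1) ^ n * ∑ th, MvPolynomial.C (hallForm α (J th) (J th))⁻¹ *
      (J th * MvPolynomial.C (evalConst (q : K) (J th)) *
        MvPolynomial.C (evalConst (-(r : K) * α) (J th))) := by
  have hn : n = q * r := by rw [← lam.parts_sum, hlam]; simp
  have hzero : ∀ th : n.Partition, th ≠ lam →
      evalConst (q : K) (J th) = 0 ∨ evalConst (-(r : K) * α) (J th) = 0 := by
    intro th hth
    by_contra! h
    refine hth (Nat.Partition.ext (hlam ▸ eq_rectangle hr hn th ?_ ?_))
    · exact not_lt.mp fun h' => h.1 (hJ.evalConst_natCast_eq_zero hα h')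
    · exact not_lt.mp fun h' => h.2 (hJ.evalConst_neg_eq_zero hα th h')
  obtain ⟨G, hG⟩ : ∃ G, G = ∑ γ ∈ Finset.finsuppAntidiag (Finset.univ : Finset (Fin q)) n,
    ∏ i, completeFun α (γ i) := ⟨_, rfl⟩
  have hGmem : G ∈ symDeg K n := hG ▸ Submodule.sum_mem _ fun γ hγ =>
    prod_completeFun_mem α _ (by simpa using hγ)
  -- The coefficient of the rectangle is found by evaluating the kernel at both alphabets.
  have hval : (-1) ^ n = (evalConst (q : K) (J lam) / hallForm α (J lam) (J lam)) *
      evalConst (-(r : K) * α) (J lam) := by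
    have h1 := congrArg (evalConst (-(r : K) * α)) (hJ.expansion hα hGmem)
    rw [map_sum, Finset.sum_eq_single lam] at h1
    · have h2 := sum_evalConst_completeFun (K := K) hα.ne' q r
      rw [← hn, ← hG] at h2
      rw [← h2, h1, map_smul, smul_eq_mul, evalConst_natCast hα.ne' q (hJ.mem lam), hG]
    · intro th _ hth
      rw [map_smul, smul_eq_mul, hG, ← evalConst_natCast hα.ne' q (hJ.mem th)]
      rcases hzero th hth with h | h <;> rw [h] <;> simp
    · simp
  rw [Finset.sum_eq_single lam]
  · have h3 : (MvPolynomial.C ((-1) ^ n) : Sym K) = (-1) ^ n := by simp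
    have h4 : ((-1) ^ n * (-1) ^ n : K) = 1 := by rw [← mul_pow]; simp
    rw [mul_assoc (J lam), ← MvPolynomial.C_mul, mul_left_comm _ (J lam), ← MvPolynomial.C_mul,
      mul_left_comm, ← h3, ← MvPolynomial.C_mul]
    rw [div_mul_eq_mul_div, div_eq_inv_mul] at hval
    rw [← hval, h4, MvPolynomial.C_1, mul_one]
  · intro th _ hth
    rcases hzero th hth with h | h <;> rw [h] <;> simp
  · simp

/-- A family with the defining properties of the Jack functions is orthogonal and triangular in
each degree; in particular its members are homogeneous. -/
theorem IsJackFamily.isOrthogonalTriangular [LinearOrder K] [IsStrictOrderedRing K] {α : K}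
    (hα : 0 < α) {J : Ptn → Sym K} (hJ : IsJackFamily α J) (n : ℕ) :
    IsOrthogonalTriangular α fun nu : n.Partition => J ⟨n, nu⟩ where
  mem nu := by
    classical
    set w := fun i : ℕ+ => (i : ℕ)
    have hcomp : ∀ m, m ≠ n →
        MvPolynomial.weightedHomogeneousComponent w m (J ⟨n, nu⟩) = 0 := by
      intro m hm
      refine eq_zero_of_coeffs_eq_zero hα.ne'
        (MvPolynomial.weightedHomogeneousComponent_mem w (J ⟨n, nu⟩) m) fun mu => ?_
      have h1 := hJ.triangularity ⟨n, nu⟩ ⟨m, mu⟩ fun h => hm h.1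
      rw [monomialCoeff_eq_hallForm hα.ne'] at h1
      rw [← h1, hallForm_apply, hallForm_apply]
      refine Finset.sum_congr rfl fun d hd => ?_
      rw [MvPolynomial.coeff_weightedHomogeneousComponent, if_pos]
      exact completePtn_mem α mu (MvPolynomial.mem_support_iff.mp hd)
    intro d hd
    by_contra h
    have := congrArg (MvPolynomial.coeff d) (hcomp _ h)
    rw [MvPolynomial.coeff_weightedHomogeneousComponent, if_pos rfl] at this
    exact hd this
  ne_zero nu h := by
    have h1 := hJ.normalization ⟨n, nu⟩
    rw [h, monomialCoeff_eq_hallForm hα.ne', map_zero] at h1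
    exact n.factorial_ne_zero (by exact_mod_cast h1.symm)
  orth nu mu h := hJ.orthogonality _ _ fun h' => h (by simpa using h')
  tri nu mu h := by
    rw [coeffAt, ← monomialCoeff_eq_hallForm hα.ne']
    exact hJ.triangularity _ _ fun h' => h ((dominated_iff mu nu).mp h')

/-- The coefficient of `t ^ n` in the specialized `τ`-function. -/
theorem coeff_tauNegSpecialized (α u v : K) (n : ℕ) :
    PowerSeries.coeff n (tauNegSpecialized α u v) =
      (-1) ^ n * ∑ th : n.Partition, MvPolynomial.C (jackNorm α ⟨n, th⟩)⁻¹ *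
        (jack α ⟨n, th⟩ * MvPolynomial.C (evalConst u (jack α ⟨n, th⟩)) *
          MvPolynomial.C (evalConst v (jack α ⟨n, th⟩))) := by
  have hC : ∀ (a : K) (f : Sym K), MvPolynomial.aeval (fun _ : ℕ+ => (MvPolynomial.C a : Sym K)) f =
      MvPolynomial.C (evalConst a f) := fun a f => by
    have : (MvPolynomial.aeval fun _ : ℕ+ => (MvPolynomial.C a : Sym K)) =
        (Algebra.ofId K (Sym K)).comp (evalConst a) :=
      MvPolynomial.algHom_ext fun i => by simp [evalConst, Algebra.ofId_apply]
    rw [this]; rfl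
  rw [tauNegSpecialized, PowerSeries.evalNegHom, PowerSeries.coeff_rescale, PowerSeries.coeff_map,
    tau, PowerSeries.coeff_mk, map_sum]
  congr 1
  refine Finset.sum_congr rfl fun th _ => ?_
  rw [map_mul, map_prod, Fin.prod_univ_three]
  simp only [AlgHom.toRingHom_eq_coe, RingHom.coe_coe, specialize, MvPolynomial.algHom_C,
    MvPolynomial.aeval_rename, MvPolynomial.algebraMap_eq]
  exact congrArg (MvPolynomial.C (jackNorm α ⟨n, th⟩)⁻¹ * ·) (congrArg₂ (· * ·)
    (congrArg₂ (· * ·) (MvPolynomial.aeval_X_left_apply (jack α ⟨n, th⟩)) (hC u _)) (hC v _))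

/-! ### Generating series -/

section Series

variable {A : Type*} [CommRing A] [Algebra K A] {N : ℕ}

/-- Evaluation of a symmetric function at finitely many elements `x_l` of an algebra. -/
noncomputable def evalAt (x : Fin N → A) : Sym K →ₐ[K] A :=
  MvPolynomial.aeval fun k : ℕ+ => ∑ l, x l ^ (k : ℕ)

theorem evalAt_powerSum (x : Fin N → A) (m : ℕ) :
    evalAt x (powerSum K m) = if m = 0 then 0 else ∑ l, x l ^ m := by
  rcases Nat.eq_zero_or_pos m with rfl | h
  · simp
  · rw [if_neg h.ne', show powerSum K m = MvPolynomial.X ⟨m, h⟩ from powerSum_coe (K := K) ⟨m, h⟩]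
    exact MvPolynomial.aeval_X _ _

/-- The Euler derivation `z d/dz` of formal power series. -/
noncomputable def euler (A : Type*) [CommRing A] : Derivation A (PowerSeries A) (PowerSeries A) :=
  (PowerSeries.X : PowerSeries A) • PowerSeries.derivative A

@[simp] theorem coeff_euler (f : PowerSeries A) (m : ℕ) :
    PowerSeries.coeff m (euler A f) = m * PowerSeries.coeff m f := by
  rw [euler, Derivation.smul_apply, smul_eq_mul]
  cases m with
  | zero => simp
  | succ m => rw [PowerSeries.coeff_succ_X_mul, PowerSeries.coeff_derivative]; push_cast; ring

theorem euler_rescale (a : A) (f : PowerSeries A) :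
    euler A (PowerSeries.rescale a f) = PowerSeries.rescale a (euler A f) := by
  ext m
  simp only [coeff_euler, PowerSeries.coeff_rescale]
  ring

theorem rescale_C (a c : A) : PowerSeries.rescale a (PowerSeries.C c) = PowerSeries.C c := by
  ext m
  rw [PowerSeries.coeff_rescale, PowerSeries.coeff_C]
  split_ifs with h <;> simp [h]

/-- The geometric series `1 / (1 - a z)`. -/
noncomputable def geomSeries (a : A) : PowerSeries A := PowerSeries.mk fun m => a ^ m

theorem one_sub_mul_geomSeries (a : A) :
    (1 - PowerSeries.C a * PowerSeries.X) * geomSeries a = 1 := by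
  ext m
  rw [sub_mul, one_mul, mul_assoc, map_sub, PowerSeries.coeff_C_mul]
  cases m with
  | zero => simp [geomSeries]
  | succ m =>
    rw [PowerSeries.coeff_succ_X_mul]
    simp [geomSeries, pow_succ', PowerSeries.coeff_one]

/-- The polynomial `∏ (1 - x_l z)` over a set of indices, as a power series. -/
noncomputable def prodSeries (x : Fin N → A) (s : Finset (Fin N)) : PowerSeries A :=
  ∏ l ∈ s, (1 - PowerSeries.C (x l) * PowerSeries.X)

/-- The series `∑ p_m(x) z^m` of power sums. -/
noncomputable def powerSeriesSum (x : Fin N → A) : PowerSeries A :=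
  PowerSeries.mk fun m => if m = 0 then 0 else ∑ l, x l ^ m

/-- The generating series `∑ g_m(x) z^m` of the deformed complete functions. -/
noncomputable def completeSeries (α : K) (x : Fin N → A) : PowerSeries A :=
  PowerSeries.mk fun m => evalAt x (completeFun α m)

theorem powerSeriesSum_eq (x : Fin N → A) :
    powerSeriesSum x = ∑ l, PowerSeries.C (x l) * PowerSeries.X * geomSeries (x l) := by
  ext m
  simp only [map_sum, mul_assoc, PowerSeries.coeff_C_mul, powerSeriesSum, PowerSeries.coeff_mk]
  cases m with
  | zero => simp
  | succ m => simp [geomSeries, PowerSeries.coeff_succ_X_mul, pow_succ']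

theorem euler_completeSeries [CharZero K] {α : K} (hα : α ≠ 0) (x : Fin N → A) :
    PowerSeries.C (algebraMap K A α) * euler A (completeSeries α x) =
      powerSeriesSum x * completeSeries α x := by
  ext m
  have h := congrArg (evalAt x) (newton_completeFun hα m)
  rw [map_mul, MvPolynomial.algHom_C, map_sum] at h
  rw [PowerSeries.coeff_C_mul, coeff_euler, PowerSeries.coeff_mul]
  simp only [completeSeries, powerSeriesSum, PowerSeries.coeff_mk, ← evalAt_powerSum (K := K),
    ← map_mul (evalAt x)]
  rw [← h, map_mul (algebraMap K A)]
  simp [mul_assoc]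

theorem prodSeries_univ (x : Fin N → A) (l : Fin N) :
    (1 - PowerSeries.C (x l) * PowerSeries.X) * prodSeries x (Finset.univ.erase l) =
      prodSeries x Finset.univ :=
  Finset.mul_prod_erase _ (fun l => 1 - PowerSeries.C (x l) * PowerSeries.X) (Finset.mem_univ l)

theorem prodSeries_erase (x : Fin N → A) (l : Fin N) :
    prodSeries x (Finset.univ.erase l) = prodSeries x Finset.univ * geomSeries (x l) := by
  rw [← prodSeries_univ x l, mul_right_comm, one_sub_mul_geomSeries, one_mul]

theorem euler_prodSeries (x : Fin N → A) :
    euler A (prodSeries x Finset.univ) = -(powerSeriesSum x * prodSeries x Finset.univ) := by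
  have h : ∀ l, euler A (1 - PowerSeries.C (x l) * PowerSeries.X) =
      -(PowerSeries.C (x l) * PowerSeries.X) := fun l => by
    ext m
    rw [coeff_euler, map_sub, map_neg, PowerSeries.coeff_C_mul, PowerSeries.coeff_one,
      PowerSeries.coeff_X]
    split_ifs with h0 h1 <;> simp_all
  conv_lhs => rw [prodSeries, derivation_prod]
  rw [powerSeriesSum_eq, Finset.sum_mul, ← Finset.sum_neg_distrib]
  refine Finset.sum_congr rfl fun l _ => ?_
  rw [h, ← prodSeries, prodSeries_erase]
  ring

theorem natCast_mul_cancel [CharZero K] {m : ℕ} (hm : m ≠ 0) {a b : A}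
    (h : (m : A) * a = m * b) : a = b := by
  have hm' : (m : K) ≠ 0 := by exact_mod_cast hm
  have h' : ∀ c : A, (m : A) * c = (m : K) • c := fun c => by
    rw [Algebra.smul_def, map_natCast]
  rw [h', h'] at h
  exact (isUnit_iff_ne_zero.mpr hm').smul_left_cancel.mp h

theorem coeff_zero_completeSeries (α : K) (x : Fin N → A) :
    PowerSeries.coeff 0 (completeSeries α x) = 1 := by
  simp [completeSeries]

/-- For `α = 1` the generating series of complete functions is `∏ 1 / (1 - x_l z)`. -/
theorem completeSeries_one_mul_prodSeries [CharZero K] (x : Fin N → A) :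
    completeSeries (1 : K) x * prodSeries x Finset.univ = 1 := by
  have h : euler A (completeSeries (1 : K) x * prodSeries x Finset.univ) = 0 := by
    have h1 := euler_completeSeries (one_ne_zero (α := K)) x
    rw [map_one, map_one, one_mul] at h1
    rw [Derivation.leibniz, h1, euler_prodSeries, smul_eq_mul, smul_eq_mul]
    ring
  ext m
  rcases eq_or_ne m 0 with rfl | hm
  · rw [PowerSeries.coeff_mul]
    simp [coeff_zero_completeSeries, prodSeries, -PowerSeries.coeff_zero_eq_constantCoeff]
    simp
  · have := congrArg (PowerSeries.coeff m) h
    rw [coeff_euler] at this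
    rw [natCast_mul_cancel (K := K) hm (this.trans (by simp : _ = (m : A) * 0)),
      PowerSeries.coeff_one, if_neg hm]

/-- The power series solutions of `α z Z' = R Z` are determined by their constant term. -/
theorem eq_of_euler_eq [CharZero K] {α : K} (hα : α ≠ 0) {R Z₁ Z₂ : PowerSeries A}
    (hR : PowerSeries.coeff 0 R = 0) (h0 : PowerSeries.coeff 0 Z₁ = PowerSeries.coeff 0 Z₂)
    (h₁ : PowerSeries.C (algebraMap K A α) * euler A Z₁ = R * Z₁)
    (h₂ : PowerSeries.C (algebraMap K A α) * euler A Z₂ = R * Z₂) : Z₁ = Z₂ := by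
  ext m
  induction m using Nat.strong_induction_on with
  | _ m ih =>
  rcases eq_or_ne m 0 with rfl | hm
  · exact h0
  refine natCast_mul_cancel (K := K) hm ?_
  have e₁ := congrArg (PowerSeries.coeff m) h₁
  have e₂ := congrArg (PowerSeries.coeff m) h₂
  rw [PowerSeries.coeff_C_mul, coeff_euler, PowerSeries.coeff_mul] at e₁ e₂
  have e : (algebraMap K A α) * (m * PowerSeries.coeff m Z₁) =
      (algebraMap K A α) * (m * PowerSeries.coeff m Z₂) := by
    rw [e₁, e₂]
    refine Finset.sum_congr rfl fun ij hij => ?_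
    rw [Finset.HasAntidiagonal.mem_antidiagonal] at hij
    rcases Nat.eq_zero_or_pos ij.1 with h | h
    · rw [h, hR, zero_mul, zero_mul]
    · rw [ih ij.2 (by omega)]
  rw [← Algebra.smul_def, ← Algebra.smul_def] at e
  exact (isUnit_iff_ne_zero.mpr hα).smul_left_cancel.mp e

/-- The Cauchy-type kernel `∏_j G_x(y_j)` is symmetric in the two alphabets. -/
theorem prod_rescale_completeSeries [CharZero K] {α : K} (hα : α ≠ 0) (x y : Fin N → A) :
    ∏ j, PowerSeries.rescale (y j) (completeSeries α x) =
      ∏ l, PowerSeries.rescale (x l) (completeSeries α y) := by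
  have hode : ∀ x y : Fin N → A, PowerSeries.C (algebraMap K A α) *
      euler A (∏ j, PowerSeries.rescale (y j) (completeSeries α x)) =
      (PowerSeries.mk fun m => if m = 0 then 0 else ∑ j, ∑ l, (x l * y j) ^ m) *
        ∏ j, PowerSeries.rescale (y j) (completeSeries α x) := by
    intro x y
    have hR : (PowerSeries.mk fun m => if m = 0 then 0 else ∑ j, ∑ l, (x l * y j) ^ m) =
        ∑ j, PowerSeries.rescale (y j) (powerSeriesSum x) := by
      ext m
      simp only [PowerSeries.coeff_mk, map_sum, PowerSeries.coeff_rescale, powerSeriesSum]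
      split_ifs
      · simp
      · simp [Finset.mul_sum, mul_pow, mul_comm]
    rw [derivation_prod, hR, Finset.sum_mul, Finset.mul_sum]
    refine Finset.sum_congr rfl fun j _ => ?_
    have h1 := congrArg (PowerSeries.rescale (y j)) (euler_completeSeries hα x)
    rw [map_mul, map_mul, rescale_C, ← euler_rescale] at h1
    rw [mul_left_comm, h1,
      ← Finset.mul_prod_erase _ (fun j => PowerSeries.rescale (y j) (completeSeries α x))
      (Finset.mem_univ j)]
    ring
  refine eq_of_euler_eq hα ?_ ?_ (hode x y) ?_
  · simp
  · have h0 : ∀ x y : Fin N → A,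
        PowerSeries.coeff 0 (∏ j, PowerSeries.rescale (y j) (completeSeries α x)) = 1 := by
      intro x y
      rw [PowerSeries.coeff_zero_eq_constantCoeff_apply, map_prod]
      refine Finset.prod_eq_one fun j _ => ?_
      rw [← PowerSeries.coeff_zero_eq_constantCoeff_apply, PowerSeries.coeff_rescale,
        coeff_zero_completeSeries]
      simp
    rw [h0, h0]
  · rw [hode y x]
    congr 2
    ext m
    rw [Finset.sum_comm]
    simp only [mul_comm]

end Series

/-! ### Alternants and Schur functions -/

section Alternants

variable {A : Type*} [CommRing A] [Algebra K A] {N : ℕ}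

/-- The staircase exponents `δ = (N - 1, …, 1, 0)`. -/
def staircase (N : ℕ) (i : Fin N) : ℕ := (Fin.rev i : ℕ)

/-- The alternant `a_κ(x) = det (x_l ^ κ_i)`. -/
noncomputable def alternant (x : Fin N → A) (κ : Fin N → ℕ) : A :=
  (Matrix.of fun i l => x l ^ κ i).det

/-- The matrix of coefficients of the polynomials `∏_{l' ≠ l} (1 - x_{l'} z)`; the row indexed by
`i` holds the coefficients of `z ^ δ_i`. -/
noncomputable def cofactorMatrix (x : Fin N → A) : Matrix (Fin N) (Fin N) A :=
  Matrix.of fun i l => PowerSeries.coeff (staircase N i) (prodSeries x (Finset.univ.erase l))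

theorem coeff_prodSeries_eq_zero (x : Fin N → A) (s : Finset (Fin N)) {m : ℕ} (hm : s.card < m) :
    PowerSeries.coeff m (prodSeries x s) = 0 := by
  have h : prodSeries x s =
      ((∏ l ∈ s, (1 - Polynomial.C (x l) * Polynomial.X) : Polynomial A) : PowerSeries A) := by
    rw [← Polynomial.coeToPowerSeries.ringHom_apply, map_prod]
    simp [prodSeries]
  rw [h, Polynomial.coeff_coe]
  refine Polynomial.coeff_eq_zero_of_natDegree_lt (lt_of_le_of_lt ?_ hm)
  refine (Polynomial.natDegree_prod_le _ _).trans ?_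
  refine (Finset.sum_le_card_nsmul _ _ 1 fun l _ => ?_).trans (by simp)
  refine (Polynomial.natDegree_sub_le _ _).trans ?_
  simpa using Polynomial.natDegree_C_mul_X_pow_le (x l) 1

theorem sum_staircase (f : ℕ → A) : ∑ i, f (staircase N i) = ∑ m ∈ Finset.range N, f m := by
  rw [Finset.sum_range]
  exact Equiv.sum_comp Fin.revPerm fun i : Fin N => f i

theorem prodSeries_erase_eq_sum (x : Fin N → A) (l : Fin N) :
    prodSeries x (Finset.univ.erase l) =
      ∑ i, PowerSeries.C (cofactorMatrix x i l) * PowerSeries.X ^ staircase N i := by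
  ext m
  simp only [map_sum, PowerSeries.coeff_C_mul, PowerSeries.coeff_X_pow, cofactorMatrix,
    Matrix.of_apply]
  rw [sum_staircase fun k => PowerSeries.coeff k (prodSeries x (Finset.univ.erase l)) *
    if m = k then 1 else 0]
  simp only [mul_ite, mul_one, mul_zero, Finset.sum_ite_eq, Finset.mem_range]
  split_ifs with h
  · rfl
  · refine coeff_prodSeries_eq_zero x _ ?_
    have := l.pos
    simp
    omega

/-- The Schur function, through its Jacobi–Trudi determinant `det (h_{γ_i - i + j})`. It is defined
for arbitrary exponents `γ`, not only for partitions. -/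
noncomputable def schurFun (K : Type*) [Field K] (γ : Fin N → ℕ) : Sym K :=
  (Matrix.of fun i j => if staircase N j ≤ γ i + staircase N i then
    completeFun (1 : K) (γ i + staircase N i - staircase N j) else 0).det

theorem schurFun_mem (γ : Fin N → ℕ) {n : ℕ} (h : ∑ i, γ i = n) : schurFun K γ ∈ symDeg K n := by
  rw [schurFun, Matrix.det_apply]
  refine Submodule.sum_mem _ fun σ _ => ?_
  rw [Units.smul_def, ← Int.cast_smul_eq_zsmul K]
  refine Submodule.smul_mem _ _ ?_
  by_cases hσ : ∀ i, staircase N i ≤ γ (σ i) + staircase N (σ i)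
  · simp only [Matrix.of_apply, hσ, if_true]
    refine prod_completeFun_mem 1 (fun i => γ (σ i) + staircase N (σ i) - staircase N i) ?_
    have h1 : ∑ i, (γ (σ i) + staircase N (σ i) - staircase N i) + ∑ i, staircase N i =
        ∑ i, γ i + ∑ i, staircase N i := by
      rw [← Finset.sum_add_distrib, ← Equiv.sum_comp σ γ, ← Equiv.sum_comp σ (staircase N)]
      conv_lhs => rw [Finset.sum_congr rfl fun i _ => Nat.sub_add_cancel (hσ i)]
      rw [Finset.sum_add_distrib]
    omega
  · obtain ⟨i, hi⟩ := not_forall.mp hσ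
    rw [Finset.prod_eq_zero (Finset.mem_univ i)]
    · exact Submodule.zero_mem _
    · simp [hi]

theorem evalAt_schurFun_mul_det [CharZero K] (x : Fin N → A) (γ : Fin N → ℕ) :
    evalAt x (schurFun K γ) * (cofactorMatrix x).det =
      alternant x fun i => γ i + staircase N i := by
  rw [schurFun, AlgHom.map_det, ← Matrix.det_mul, alternant]
  congr 1
  ext i l
  rw [Matrix.mul_apply]
  have h1 : completeSeries (1 : K) x * prodSeries x (Finset.univ.erase l) = geomSeries (x l) := by
    rw [prodSeries_erase, ← mul_assoc, completeSeries_one_mul_prodSeries, one_mul]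
  have h2 := congrArg (PowerSeries.coeff (γ i + staircase N i)) h1
  rw [prodSeries_erase_eq_sum, Finset.mul_sum, map_sum] at h2
  simp only [geomSeries, PowerSeries.coeff_mk] at h2
  rw [Matrix.of_apply, ← h2]
  refine Finset.sum_congr rfl fun j _ => ?_
  rw [mul_left_comm, PowerSeries.coeff_C_mul, mul_comm (completeSeries _ _),
    PowerSeries.coeff_X_pow_mul', mul_comm]
  congr 1
  simp only [AlgHom.mapMatrix_apply, Matrix.map_apply, Matrix.of_apply, completeSeries,
    PowerSeries.coeff_mk]
  split_ifs <;> simp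

theorem schurFun_zero : schurFun K (fun _ : Fin N => 0) = 1 := by
  rw [schurFun, Matrix.det_of_isUpperTriangular]
  · simp
  · intro i j hij
    have : ¬ staircase N j ≤ staircase N i := by
      have : (j : ℕ) < i := hij
      simp only [staircase, Fin.val_rev]
      omega
    simp [this]

theorem det_cofactorMatrix (K : Type*) [Field K] [CharZero K] [Algebra K A] (x : Fin N → A) :
    (cofactorMatrix x).det = alternant x (staircase N) := by
  have h := evalAt_schurFun_mul_det (K := K) x fun _ => 0
  simpa [schurFun_zero] using h

/-- The bialternant formula. -/
theorem evalAt_schurFun_mul_alternant [CharZero K] (x : Fin N → A) (γ : Fin N → ℕ) :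
    evalAt x (schurFun K γ) * alternant x (staircase N) =
      alternant x fun i => γ i + staircase N i := by
  rw [← evalAt_schurFun_mul_det (K := K) x γ, det_cofactorMatrix K]

theorem alternant_staircase_ne_zero [IsDomain A] {x : Fin N → A} (hx : Function.Injective x) :
    alternant x (staircase N) ≠ 0 := by
  have h : (Matrix.of fun i l => x l ^ staircase N i) =
      (Matrix.vandermonde x).transpose.submatrix Fin.revPerm id := by
    ext i l
    simp [staircase, Matrix.vandermonde_apply]
  rw [alternant, h, Matrix.det_permute, Matrix.det_transpose]
  refine mul_ne_zero ?_ (Matrix.det_vandermonde_ne_zero_iff.mpr hx)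
  rcases Int.units_eq_one_or (Equiv.Perm.sign (Fin.revPerm (n := N))) with h | h <;> simp [h]

/-! ### Symmetry of the Sekiguchi kernel -/

/-- The eigenvalue `∏ (u + δ_i + α γ_i)` of the Sekiguchi operator with parameter `u`. -/
noncomputable def sekiguchiEigenvalue (α u : K) (γ : Fin N → ℕ) : K :=
  ∏ i, (u + staircase N i + α * γ i)

/-- The matrix whose determinant generates the action of the Sekiguchi operator on the kernel. -/
noncomputable def kernelMatrix (α u : K) (x y : Fin N → A) :
    Matrix (Fin N) (Fin N) (PowerSeries A) :=
  Matrix.of fun i j => PowerSeries.rescale (y j) (PowerSeries.X ^ staircase N i *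
    PowerSeries.mk fun m => algebraMap K A (u + staircase N i + α * m) *
      evalAt x (completeFun α m))

theorem coeff_det_kernelMatrix (α u : K) (x y : Fin N → A) (n : ℕ) :
    PowerSeries.coeff (n + ∑ i, staircase N i) (kernelMatrix α u x y).det =
      ∑ γ ∈ Finset.finsuppAntidiag (Finset.univ : Finset (Fin N)) n,
        algebraMap K A (sekiguchiEigenvalue α u γ) *
          evalAt x (∏ i, completeFun α (γ i)) * alternant y fun i => γ i + staircase N i := by
  classical
  have h1 : kernelMatrix α u x y = Matrix.of fun i j => PowerSeries.X ^ staircase N i *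
      (Matrix.of fun i j => PowerSeries.mk fun m => algebraMap K A (u + staircase N i + α * m) *
        evalAt x (completeFun α m) * y j ^ (m + staircase N i)) i j := by
    ext i j m
    simp only [kernelMatrix, Matrix.of_apply, PowerSeries.coeff_rescale,
      PowerSeries.coeff_X_pow_mul', PowerSeries.coeff_mk]
    split_ifs with h
    · rw [Nat.sub_add_cancel h]; ring
    · simp
  rw [h1, Matrix.det_mul_column, Finset.prod_pow_eq_pow_sum, PowerSeries.coeff_X_pow_mul,
    Matrix.det_apply, map_sum]
  simp only [alternant, Matrix.det_apply, Finset.mul_sum]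
  rw [Finset.sum_comm]
  refine Finset.sum_congr rfl fun σ _ => ?_
  have h2 : ∏ i, (Matrix.of fun i j => PowerSeries.mk fun m =>
      algebraMap K A (u + staircase N i + α * m) *
        evalAt x (completeFun α m) * y j ^ (m + staircase N i)) (σ i) i =
      ∏ i, PowerSeries.mk fun m =>
      algebraMap K A (u + staircase N i + α * m) *
        evalAt x (completeFun α m) * y (σ.symm i) ^ (m + staircase N i) := by
    rw [← Equiv.prod_comp σ fun i => PowerSeries.mk fun m =>
      algebraMap K A (u + staircase N i + α * m) *
        evalAt x (completeFun α m) * y (σ.symm i) ^ (m + staircase N i)]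
    simp
  rw [h2, Units.smul_def, map_zsmul, PowerSeries.coeff_prod, Finset.smul_sum]
  refine Finset.sum_congr rfl fun γ _ => ?_
  rw [Units.smul_def, mul_smul_comm]
  congr 1
  simp only [PowerSeries.coeff_mk, Finset.prod_mul_distrib, sekiguchiEigenvalue, map_prod,
    Matrix.of_apply]
  congr 1
  rw [← Equiv.prod_comp σ]
  simp

/-- The determinant evaluation behind the symmetry: after a change of basis by `cofactorMatrix`,
the columns become values of one function of the products `x_l y_j`. -/
theorem det_cofactorMatrix_mul_det_kernelMatrix [CharZero K] {α : K} (hα : α ≠ 0) (u : K)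
    (x y : Fin N → A) :
    PowerSeries.C (cofactorMatrix x).det * (kernelMatrix α u x y).det =
      (∏ j, PowerSeries.rescale (y j) (completeSeries α x)) *
        (∏ j, ∏ l, (1 - PowerSeries.C (x l * y j) * PowerSeries.X)) *
        (Matrix.of fun l j => PowerSeries.mk fun m =>
          algebraMap K A (u + m) * (x l * y j) ^ m).det := by
  have hG : ∀ i, (PowerSeries.mk fun m => algebraMap K A (u + staircase N i + α * m) *
      evalAt x (completeFun α m)) =
      PowerSeries.C (algebraMap K A u) * completeSeries α x +
        staircase N i * completeSeries α x + powerSeriesSum x * completeSeries α x := by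
    intro i
    rw [← euler_completeSeries hα]
    ext m
    rw [map_add, map_add, PowerSeries.coeff_C_mul, ← map_natCast (PowerSeries.C (R := A)),
      PowerSeries.coeff_C_mul, PowerSeries.coeff_C_mul, coeff_euler]
    simp [completeSeries]
    ring
  have hX : ∀ k : ℕ, euler A (PowerSeries.X ^ k : PowerSeries A) =
      k * (PowerSeries.X : PowerSeries A) ^ k := by
    intro k
    ext m
    rw [coeff_euler, ← map_natCast (PowerSeries.C (R := A)), PowerSeries.coeff_C_mul,
      PowerSeries.coeff_X_pow]
    split_ifs with h <;> simp [h]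
  have hentry : ∀ l j, ∑ i, PowerSeries.C (cofactorMatrix x i l) * kernelMatrix α u x y i j =
      PowerSeries.rescale (y j) (completeSeries α x * prodSeries x Finset.univ) *
        PowerSeries.mk fun m => algebraMap K A (u + m) * (x l * y j) ^ m := by
    intro l j
    have h1 : ∀ i, PowerSeries.C (cofactorMatrix x i l) * kernelMatrix α u x y i j =
        PowerSeries.rescale (y j) (completeSeries α x *
          ((PowerSeries.C (algebraMap K A u) + powerSeriesSum x) *
            (PowerSeries.C (cofactorMatrix x i l) * PowerSeries.X ^ staircase N i) +
            euler A (PowerSeries.C (cofactorMatrix x i l) * PowerSeries.X ^ staircase N i))) := by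
      intro i
      rw [← PowerSeries.smul_eq_C_mul (PowerSeries.X ^ staircase N i), Derivation.map_smul, hX,
        kernelMatrix, Matrix.of_apply, hG, ← rescale_C (y j) (cofactorMatrix x i l), ← map_mul]
      congr 1
      rw [PowerSeries.smul_eq_C_mul, PowerSeries.smul_eq_C_mul]
      ring
    have h2 : euler A (geomSeries (x l)) + PowerSeries.C (algebraMap K A u) * geomSeries (x l) =
        PowerSeries.mk fun m => algebraMap K A (u + m) * x l ^ m := by
      ext m
      simp [geomSeries]
      ring
    have h3 : PowerSeries.rescale (y j)
        (PowerSeries.mk fun m => algebraMap K A (u + m) * x l ^ m) =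
        PowerSeries.mk fun m => algebraMap K A (u + m) * (x l * y j) ^ m := by
      ext m
      simp only [PowerSeries.coeff_rescale, PowerSeries.coeff_mk]
      ring
    rw [Finset.sum_congr rfl fun i _ => h1 i, ← map_sum, ← Finset.mul_sum, Finset.sum_add_distrib,
      ← Finset.mul_sum, ← map_sum, ← prodSeries_erase_eq_sum, prodSeries_erase, Derivation.leibniz,
      euler_prodSeries, ← h3, ← map_mul, ← h2]
    congr 1
    rw [smul_eq_mul, smul_eq_mul]
    ring
  have hmat : (cofactorMatrix x).transpose.map (PowerSeries.C (R := A)) * kernelMatrix α u x y =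
      Matrix.of fun l j => PowerSeries.rescale (y j)
        (completeSeries α x * prodSeries x Finset.univ) *
        (Matrix.of fun l j => PowerSeries.mk fun m =>
          algebraMap K A (u + m) * (x l * y j) ^ m) l j := by
    ext1 l j
    rw [Matrix.mul_apply]
    exact hentry l j
  have hdet := congrArg Matrix.det hmat
  rw [Matrix.det_mul, Matrix.det_mul_row, ← RingHom.mapMatrix_apply, ← RingHom.map_det,
    Matrix.det_transpose] at hdet
  rw [hdet, ← Finset.prod_mul_distrib]
  congr 1
  refine Finset.prod_congr rfl fun j _ => ?_
  rw [map_mul, prodSeries, map_prod]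
  congr 1
  refine Finset.prod_congr rfl fun l _ => ?_
  rw [map_sub, map_one, map_mul, rescale_C, PowerSeries.rescale_X, map_mul]
  ring

theorem sekiguchi_kernel_symmetric_aux [CharZero K] {α : K} (hα : α ≠ 0) (u : K)
    (x y : Fin N → A) (n : ℕ) :
    alternant x (staircase N) * ∑ γ ∈ Finset.finsuppAntidiag (Finset.univ : Finset (Fin N)) n,
        algebraMap K A (sekiguchiEigenvalue α u γ) *
          evalAt x (∏ i, completeFun α (γ i)) * (alternant y fun i => γ i + staircase N i) =
    alternant y (staircase N) * ∑ γ ∈ Finset.finsuppAntidiag (Finset.univ : Finset (Fin N)) n,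
        algebraMap K A (sekiguchiEigenvalue α u γ) *
          evalAt y (∏ i, completeFun α (γ i)) * (alternant x fun i => γ i + staircase N i) := by
  rw [← coeff_det_kernelMatrix, ← coeff_det_kernelMatrix, ← PowerSeries.coeff_C_mul,
    ← PowerSeries.coeff_C_mul, ← det_cofactorMatrix K, ← det_cofactorMatrix K,
    det_cofactorMatrix_mul_det_kernelMatrix hα, det_cofactorMatrix_mul_det_kernelMatrix hα,
    prod_rescale_completeSeries hα x y, Finset.prod_comm, ← Matrix.det_transpose]
  simp only [mul_comm (x _) (y _)]
  rfl

/-- The kernel `∑ c_γ g_γ(x) s_γ(y)` of the Sekiguchi operator is symmetric. -/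
theorem sekiguchi_kernel_symmetric [CharZero K] [IsDomain A] {α : K} (hα : α ≠ 0) (u : K)
    {x y : Fin N → A} (hx : Function.Injective x) (hy : Function.Injective y) (n : ℕ) :
    ∑ γ ∈ Finset.finsuppAntidiag (Finset.univ : Finset (Fin N)) n,
        algebraMap K A (sekiguchiEigenvalue α u γ) *
          evalAt x (∏ i, completeFun α (γ i)) * evalAt y (schurFun K γ) =
    ∑ γ ∈ Finset.finsuppAntidiag (Finset.univ : Finset (Fin N)) n,
        algebraMap K A (sekiguchiEigenvalue α u γ) *
          evalAt y (∏ i, completeFun α (γ i)) * evalAt x (schurFun K γ) := by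
  have h := sekiguchi_kernel_symmetric_aux hα u x y n
  simp only [← evalAt_schurFun_mul_alternant (K := K), ← mul_assoc, ← Finset.sum_mul] at h
  refine mul_left_cancel₀ (mul_ne_zero (alternant_staircase_ne_zero hx)
    (alternant_staircase_ne_zero hy)) ?_
  linear_combination h

end Alternants

/-! ### The Sekiguchi operator -/

/-- A family of natural numbers as an exponent vector. -/
noncomputable abbrev expVec {N : ℕ} (γ : Fin N → ℕ) : Fin N →₀ ℕ := Finsupp.equivFunOnFinite.symm γ

theorem coeff_expand [CharZero K] {α : K} (hα : α ≠ 0) {N : ℕ} (γ : Fin N →₀ ℕ) (f : Sym K) :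
    MvPolynomial.coeff γ (expand N f) = hallForm α (∏ i, completeFun α (γ i)) f :=
  (hallForm_prod_completeFun hα f γ).symm

theorem coeff_expand_perm [CharZero K] {N : ℕ} (γ : Fin N → ℕ) (σ : Equiv.Perm (Fin N))
    (f : Sym K) :
    MvPolynomial.coeff (expVec fun i => γ (σ i)) (expand N f) =
      MvPolynomial.coeff (expVec γ) (expand N f) := by
  rw [coeff_expand one_ne_zero, coeff_expand one_ne_zero]
  congr 2
  exact Equiv.prod_comp σ fun i => completeFun (1 : K) (γ i)

theorem coeff_expand_part [CharZero K] {α : K} (hα : α ≠ 0) {n N : ℕ} (mu : n.Partition)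
    (hN : mu.parts.card ≤ N) (f : Sym K) :
    MvPolynomial.coeff (expVec fun i : Fin N => part mu i) (expand N f) = coeffAt α mu f := by
  rw [coeff_expand hα, coeffAt, ← prod_completeFun_part α mu hN]
  rfl

theorem coeff_expand_ofFamily [CharZero K] {α : K} (hα : α ≠ 0) {n N : ℕ} (γ : Fin N →₀ ℕ)
    (h : ∑ i, γ i = n) (f : Sym K) :
    MvPolynomial.coeff γ (expand N f) = coeffAt α (ofFamily γ h) f := by
  rw [coeff_expand hα, coeffAt, ← prod_completeFun_ofFamily]

theorem coeff_expand_eq_zero [CharZero K] {n N : ℕ} (γ : Fin N →₀ ℕ)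
    (h : ∑ i, γ i ≠ n) {f : Sym K} (hf : f ∈ symDeg K n) :
    MvPolynomial.coeff γ (expand N f) = 0 := by
  rw [coeff_expand one_ne_zero]
  exact hallForm_eq_zero_of_degree_ne 1 h (prod_completeFun_mem 1 _ rfl) hf

/-- The Sekiguchi operator with parameter `u` in degree `n`. It sends the monomial symmetric
function `m_μ` to `∑ ∏ (u + δ_i + α γ_i) s_γ`, the sum over the rearrangements `γ` of `μ`. -/
noncomputable def sekiguchi (α u : K) (n : ℕ) : Sym K →ₗ[K] Sym K :=
  ∑ γ ∈ Finset.finsuppAntidiag (Finset.univ : Finset (Fin n)) n,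
    sekiguchiEigenvalue α u γ •
      (hallForm α (∏ i, completeFun α (γ i))).smulRight (schurFun K γ)

theorem sekiguchi_apply (α u : K) (n : ℕ) (f : Sym K) :
    sekiguchi α u n f = ∑ γ ∈ Finset.finsuppAntidiag (Finset.univ : Finset (Fin n)) n,
      (sekiguchiEigenvalue α u γ * hallForm α (∏ i, completeFun α (γ i)) f) • schurFun K γ := by
  simp [sekiguchi, LinearMap.sum_apply, mul_smul]

theorem sekiguchi_mem (α u : K) {n : ℕ} (f : Sym K) : sekiguchi α u n f ∈ symDeg K n := by
  rw [sekiguchi_apply]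
  exact Submodule.sum_mem _ fun γ hγ =>
    Submodule.smul_mem _ _ (schurFun_mem _ (by simpa using hγ))

theorem evalAt_C_X {N : ℕ} (f : Sym K) :
    evalAt (fun l : Fin N => (MvPolynomial.C (MvPolynomial.X l) :
      MvPolynomial (Fin N) (MvPolynomial (Fin N) K))) f = MvPolynomial.C (expand N f) := by
  have : (evalAt fun l : Fin N => (MvPolynomial.C (MvPolynomial.X l) :
      MvPolynomial (Fin N) (MvPolynomial (Fin N) K))) =
      ((Algebra.ofId (MvPolynomial (Fin N) K) _).restrictScalars K).comp (expand N) :=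
    MvPolynomial.algHom_ext fun k => by
      simp [evalAt, expand, MvPolynomial.psum, Algebra.ofId_apply]
  rw [this]
  rfl

theorem evalAt_outer_X {N : ℕ} (f : Sym K) :
    evalAt (fun l : Fin N => (MvPolynomial.X l :
      MvPolynomial (Fin N) (MvPolynomial (Fin N) K))) f =
      MvPolynomial.map MvPolynomial.C (expand N f) := by
  have : (evalAt fun l : Fin N => (MvPolynomial.X l :
      MvPolynomial (Fin N) (MvPolynomial (Fin N) K))) =
      (MvPolynomial.mapAlgHom (Algebra.ofId K (MvPolynomial (Fin N) K))).comp (expand N) :=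
    MvPolynomial.algHom_ext fun k => by
      simp [evalAt, expand, MvPolynomial.psum]
  rw [this]
  rfl

/-- Selfadjointness on products of complete functions, by comparing the coefficients of
`x ^ β y ^ β'` in the symmetric kernel. The two alphabets are the inner and the outer variables of
an iterated polynomial ring. -/
theorem sekiguchi_selfAdjoint_aux [CharZero K] {α : K} (hα : α ≠ 0) (u : K) {n : ℕ}
    (β β' : Fin n →₀ ℕ) :
    hallForm α (∏ i, completeFun α (β' i)) (sekiguchi α u n (∏ i, completeFun α (β i))) =
    hallForm α (∏ i, completeFun α (β i)) (sekiguchi α u n (∏ i, completeFun α (β' i))) := by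
  have key := sekiguchi_kernel_symmetric hα u
    (A := MvPolynomial (Fin n) (MvPolynomial (Fin n) K))
    (x := fun l => MvPolynomial.C (MvPolynomial.X l)) (y := fun l => MvPolynomial.X l)
    ((MvPolynomial.C_injective _ _).comp (MvPolynomial.X_injective))
    MvPolynomial.X_injective n
  simp only [evalAt_C_X, evalAt_outer_X] at key
  have h2 := congrArg (fun p => MvPolynomial.coeff β (MvPolynomial.coeff β' p)) key
  have hC : ∀ c : K, algebraMap K (MvPolynomial (Fin n) (MvPolynomial (Fin n) K)) c =
      MvPolynomial.C (MvPolynomial.C c) := fun c => rfl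
  simp only [hC, MvPolynomial.coeff_sum, mul_assoc, MvPolynomial.coeff_C_mul,
    MvPolynomial.coeff_map] at h2
  have e : ∀ γ : Fin n →₀ ℕ, MvPolynomial.map MvPolynomial.C
      (expand n (∏ i, completeFun α (γ i))) * MvPolynomial.C (expand n (schurFun K γ)) =
      MvPolynomial.C (expand n (schurFun K γ)) * MvPolynomial.map MvPolynomial.C
      (expand n (∏ i, completeFun α (γ i))) := fun γ => mul_comm _ _
  simp only [e, MvPolynomial.coeff_C_mul, MvPolynomial.coeff_map, coeff_expand hα] at h2
  rw [sekiguchi_apply, sekiguchi_apply, map_sum, map_sum]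
  simp only [map_smul, smul_eq_mul]
  simp only [mul_comm _ (MvPolynomial.C _), MvPolynomial.coeff_C_mul, coeff_expand hα] at h2
  refine (Finset.sum_congr rfl fun γ _ => ?_).trans
    (h2.trans (Finset.sum_congr rfl fun γ _ => ?_))
  · rw [hallForm_comm α (∏ i, completeFun α (γ i))]
    ring
  · rw [hallForm_comm α _ (∏ i, completeFun α (γ i))]
    ring

theorem sekiguchi_selfAdjoint [CharZero K] {α : K} (hα : α ≠ 0) (u : K) {n : ℕ} {f h : Sym K}
    (hf : f ∈ symDeg K n) (hh : h ∈ symDeg K n) :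
    hallForm α (sekiguchi α u n f) h = hallForm α f (sekiguchi α u n h) := by
  have hbase : ∀ mu nu : n.Partition,
      hallForm α (sekiguchi α u n (completePtn α mu)) (completePtn α nu) =
        hallForm α (completePtn α mu) (sekiguchi α u n (completePtn α nu)) := by
    intro mu nu
    rw [hallForm_comm, ← prod_completeFun_part α mu (card_parts_le mu),
      ← prod_completeFun_part α nu (card_parts_le nu)]
    exact sekiguchi_selfAdjoint_aux hα u (expVec fun i => part mu i) (expVec fun i => part nu i)
  have h1 := symDeg_le_completeSpan hα n hf
  have h2 := symDeg_le_completeSpan hα n hh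
  clear hf hh
  induction h1 using Submodule.span_induction with
  | mem x hx =>
    obtain ⟨mu, rfl⟩ := hx
    induction h2 using Submodule.span_induction with
    | mem y hy => obtain ⟨nu, rfl⟩ := hy; exact hbase mu nu
    | zero => simp
    | add y z _ _ hy hz => simp only [map_add, hy, hz]
    | smul c y _ hy => simp only [map_smul, hy]
  | zero => simp
  | add y z _ _ hy hz => simp only [map_add, LinearMap.add_apply, hy, hz]
  | smul c y _ hy => simp only [map_smul, LinearMap.smul_apply, hy]

/-! ### Degrees in blocks of variables -/

section BlockDegree

variable {N : ℕ}

/-- Substitution `x_i ↦ x_i z` for `i ∈ I`. The degree in `z` of the result is the degree in the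
variables of the block `I`. -/
noncomputable def blockHom (K : Type*) [Field K] (I : Finset (Fin N)) :
    MvPolynomial (Fin N) K →ₐ[K] Polynomial (MvPolynomial (Fin N) K) :=
  MvPolynomial.aeval fun i => Polynomial.C (MvPolynomial.X i) *
    (if i ∈ I then Polynomial.X else 1)

/-- The degree of a polynomial in the variables of the block `I`. -/
noncomputable def blockDegree (I : Finset (Fin N)) (f : MvPolynomial (Fin N) K) : ℕ :=
  (blockHom K I f).natDegree

theorem blockHom_monomial (I : Finset (Fin N)) (β : Fin N →₀ ℕ) (a : K) :
    blockHom K I (MvPolynomial.monomial β a) =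
      Polynomial.monomial (∑ i ∈ I, β i) (MvPolynomial.monomial β a) := by
  classical
  rw [blockHom, MvPolynomial.aeval_monomial, Finsupp.prod_fintype _ _ (fun i => pow_zero _)]
  simp only [mul_pow, Finset.prod_mul_distrib, ite_pow, one_pow, Finset.prod_ite_mem,
    Finset.univ_inter, Finset.prod_pow_eq_pow_sum]
  rw [← Polynomial.C_mul_X_pow_eq_monomial, ← mul_assoc, MvPolynomial.monomial_eq,
    Finsupp.prod_fintype _ _ (fun i => pow_zero _)]
  simp [IsScalarTower.algebraMap_apply K (MvPolynomial (Fin N) K)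
    (Polynomial (MvPolynomial (Fin N) K))]

theorem coeff_coeff_blockHom (I : Finset (Fin N)) (f : MvPolynomial (Fin N) K)
    (β : Fin N →₀ ℕ) (k : ℕ) :
    MvPolynomial.coeff β ((blockHom K I f).coeff k) =
      if k = ∑ i ∈ I, β i then MvPolynomial.coeff β f else 0 := by
  classical
  induction f using MvPolynomial.induction_on' with
  | monomial γ a =>
    rw [blockHom_monomial, Polynomial.coeff_monomial]
    by_cases h : γ = β
    · subst h
      split_ifs <;> simp_all
    · split_ifs <;> simp [MvPolynomial.coeff_monomial, h]
  | add p q hp hq =>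
    rw [map_add, Polynomial.coeff_add, MvPolynomial.coeff_add, hp, hq]
    split_ifs <;> simp

theorem sum_le_blockDegree (I : Finset (Fin N)) {f : MvPolynomial (Fin N) K} {β : Fin N →₀ ℕ}
    (h : MvPolynomial.coeff β f ≠ 0) : ∑ i ∈ I, β i ≤ blockDegree I f := by
  refine Polynomial.le_natDegree_of_ne_zero fun h0 => h ?_
  have := coeff_coeff_blockHom I f β (∑ i ∈ I, β i)
  rw [h0, if_pos rfl] at this
  simpa using this.symm

theorem blockDegree_le (I : Finset (Fin N)) {f : MvPolynomial (Fin N) K} {d : ℕ}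
    (h : ∀ β, MvPolynomial.coeff β f ≠ 0 → ∑ i ∈ I, β i ≤ d) : blockDegree I f ≤ d := by
  refine Polynomial.natDegree_le_iff_coeff_eq_zero.mpr fun k hk => ?_
  ext β
  rw [coeff_coeff_blockHom]
  split_ifs with hkβ
  · by_contra hne
    have := h β (by simpa using hne)
    omega
  · simp

theorem blockDegree_mul (I : Finset (Fin N)) {f h : MvPolynomial (Fin N) K} (hf : f ≠ 0)
    (hh : h ≠ 0) : blockDegree I (f * h) = blockDegree I f + blockDegree I h := by
  have hne : ∀ p : MvPolynomial (Fin N) K, p ≠ 0 → blockHom K I p ≠ 0 := fun p hp h0 => hp (by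
    ext β
    have := coeff_coeff_blockHom I p β (∑ i ∈ I, β i)
    rw [h0, if_pos rfl] at this
    simpa using this.symm)
  rw [blockDegree, map_mul, Polynomial.natDegree_mul (hne f hf) (hne h hh), blockDegree,
    blockDegree]

end BlockDegree

/-! ### Triangularity -/

section Triangularity

variable {N : ℕ}

theorem staircase_injective : Function.Injective (staircase N) :=
  Fin.val_injective.comp Fin.rev_injective

/-- The alternants of the polynomial ring, with the variables as arguments. -/
noncomputable abbrev altPoly (K : Type*) [Field K] (κ : Fin N → ℕ) : MvPolynomial (Fin N) K :=
  alternant (fun l => (MvPolynomial.X l : MvPolynomial (Fin N) K)) κ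

theorem altPoly_eq_sum (κ : Fin N → ℕ) :
    altPoly K κ = ∑ σ : Equiv.Perm (Fin N),
      MvPolynomial.monomial (expVec fun i => κ (σ i)) ((Equiv.Perm.sign σ : ℤ) : K) := by
  unfold altPoly alternant
  rw [Matrix.det_apply]
  refine Finset.sum_congr rfl fun σ _ => ?_
  rw [Units.smul_def, ← Int.cast_smul_eq_zsmul K, MvPolynomial.monomial_eq,
    Finsupp.prod_fintype _ _ (fun i => pow_zero _), MvPolynomial.smul_eq_C_mul]
  rfl

/-- The initial block of `k` indices. -/
def initBlock (N k : ℕ) : Finset (Fin N) := Finset.univ.filter fun i => (i : ℕ) < k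

theorem sum_initBlock (f : ℕ → ℕ) {k : ℕ} (hk : k ≤ N) :
    ∑ i ∈ initBlock N k, f i = ∑ i ∈ Finset.range k, f i := by
  refine Finset.sum_bij (fun i _ => (i : ℕ)) ?_ ?_ ?_ fun _ _ => rfl
  · intro i hi; simpa [initBlock] using hi
  · intro i _ j _ h; exact Fin.ext h
  · intro i hi
    have hi' := Finset.mem_range.mp hi
    exact ⟨⟨i, by omega⟩, by simpa [initBlock] using hi', rfl⟩

theorem card_initBlock {k : ℕ} (hk : k ≤ N) : (initBlock N k).card = k := by
  rw [Finset.card_eq_sum_ones, sum_initBlock (fun _ => 1) hk]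
  simp

theorem sum_staircase_perm_le (σ : Equiv.Perm (Fin N)) {k : ℕ} (hk : k ≤ N) :
    ∑ i ∈ initBlock N k, staircase N (σ i) ≤ ∑ i ∈ initBlock N k, staircase N i := by
  have hst : ∀ i : Fin N, staircase N i = (fun j : ℕ => N - 1 - j) i := fun i => by
    simp only [staircase, Fin.val_rev]; omega
  have hanti : Antitone fun j : ℕ => N - 1 - j := fun a b hab => by simp only; omega
  have h1 := sum_le_sum_range_of_antitone hanti
    (((initBlock N k).map σ.toEmbedding).map Fin.valEmbedding)
  rw [Finset.card_map, Finset.card_map, card_initBlock hk, Finset.sum_map, Finset.sum_map] at h1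
  simp only [hst]
  rw [sum_initBlock (fun j : ℕ => N - 1 - j) hk]
  simpa using h1

/-- Partial sums over all initial blocks determine a family. -/
theorem eq_of_sum_initBlock_eq {f h : Fin N → ℕ}
    (e : ∀ k ≤ N, ∑ i ∈ initBlock N k, f i = ∑ i ∈ initBlock N k, h i) : f = h := by
  classical
  funext i
  have hins : initBlock N (i + 1) = insert i (initBlock N i) := by
    ext j
    simp only [initBlock, Finset.mem_filter, Finset.mem_univ, true_and, Finset.mem_insert,
      Fin.ext_iff]
    omega
  have hni : i ∉ initBlock N i := by simp [initBlock]
  have h1 := e (i + 1) i.isLt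
  have h2 := e i i.isLt.le
  rw [hins, Finset.sum_insert hni, Finset.sum_insert hni] at h1
  omega

theorem perm_eq_one_of_sum_le {σ : Equiv.Perm (Fin N)}
    (h : ∀ k ≤ N, ∑ i ∈ initBlock N k, staircase N i ≤ ∑ i ∈ initBlock N k, staircase N (σ i)) :
    σ = 1 := by
  have := eq_of_sum_initBlock_eq (f := fun i => staircase N (σ i)) (h := staircase N)
    fun k hk => le_antisymm (sum_staircase_perm_le σ hk) (h k hk)
  exact Equiv.ext fun i => staircase_injective (congrFun this i)

/-- The key combinatorial fact: a bounded exponent shifted by a permuted staircase reaches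
`λ + δ` only for the identity permutation. -/
theorem perm_eq_one_of_add_staircase_eq {n : ℕ} {lam : n.Partition} {β : Fin N → ℕ}
    {σ : Equiv.Perm (Fin N)} (hβ : ∀ I : Finset (Fin N), ∑ i ∈ I, β i ≤ topSum lam I.card)
    (h : ∀ i, β i + staircase N (σ i) = part lam i + staircase N i) : σ = 1 := by
  refine perm_eq_one_of_sum_le fun k hk => ?_
  have h1 : ∑ i ∈ initBlock N k, (β i + staircase N (σ i)) =
      ∑ i ∈ initBlock N k, (part lam i + staircase N i) := Finset.sum_congr rfl fun i _ => h i
  rw [Finset.sum_add_distrib, Finset.sum_add_distrib, sum_initBlock (part lam) hk] at h1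
  have h2 := hβ (initBlock N k)
  rw [card_initBlock hk] at h2
  simp only [topSum] at h2
  omega

theorem coeff_staircase_altPoly :
    MvPolynomial.coeff (expVec (staircase N)) (altPoly K (staircase N)) = 1 := by
  classical
  rw [altPoly_eq_sum, MvPolynomial.coeff_sum, Finset.sum_eq_single 1]
  · simp
  · intro σ _ hσ
    rw [MvPolynomial.coeff_monomial, if_neg]
    intro h
    refine hσ (Equiv.ext fun i => staircase_injective ?_)
    simpa using DFunLike.congr_fun h i
  · simp

theorem altPoly_staircase_ne_zero : altPoly K (staircase N) ≠ 0 := fun h => by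
  have := coeff_staircase_altPoly (K := K) (N := N)
  rw [h] at this
  simp at this

/-- The symmetric functions of degree `n` whose monomial expansion involves only the `m_μ` with
`μ ≤ λ` in the dominance order. -/
noncomputable def belowSubmodule (α : K) {n : ℕ} (lam : n.Partition) : Submodule K (Sym K) :=
  symDeg K n ⊓ ⨅ (mu : n.Partition) (_ : ¬ DomLE mu lam), LinearMap.ker (coeffAt α mu)

theorem mem_belowSubmodule {α : K} {n : ℕ} {lam : n.Partition} {f : Sym K} :
    f ∈ belowSubmodule α lam ↔
      f ∈ symDeg K n ∧ ∀ mu, ¬ DomLE mu lam → coeffAt α mu f = 0 := by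
  simp [belowSubmodule, Submodule.mem_iInf]

theorem sum_le_of_mem_belowSubmodule [CharZero K] {α : K} (hα : α ≠ 0) {n : ℕ}
    {lam : n.Partition} {f : Sym K} (hf : f ∈ belowSubmodule α lam) {γ : Fin N →₀ ℕ}
    (hγ : MvPolynomial.coeff γ (expand N f) ≠ 0) (I : Finset (Fin N)) :
    ∑ i ∈ I, γ i ≤ topSum lam I.card := by
  rw [mem_belowSubmodule] at hf
  by_cases h : ∑ i, γ i = n
  · rw [coeff_expand_ofFamily hα γ h] at hγ
    by_cases hd : DomLE (ofFamily γ h) lam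
    · exact (sum_le_topSum_ofFamily _ h I).trans (hd _)
    · exact absurd (hf.2 _ hd) hγ
  · exact absurd (coeff_expand_eq_zero γ h hf.1) hγ

/-- A symmetric function whose product with the Vandermonde alternant is a combination of
alternants `a_{γ + δ}`, with the exponents `γ` bounded by `λ`, is supported below `λ`. -/
theorem mem_belowSubmodule_of_alternants [CharZero K] {α : K} (hα : α ≠ 0) {n : ℕ}
    {lam : n.Partition} {f : Sym K} (hf : f ∈ symDeg K n) (S : Finset (Fin n →₀ ℕ))
    (d : (Fin n →₀ ℕ) → K)
    (hd : ∀ γ ∈ S, d γ ≠ 0 → ∀ I : Finset (Fin n), ∑ i ∈ I, γ i ≤ topSum lam I.card)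
    (h : expand n f * altPoly K (staircase n) =
      ∑ γ ∈ S, MvPolynomial.C (d γ) * altPoly K fun i => γ i + staircase n i) :
    f ∈ belowSubmodule α lam := by
  classical
  refine mem_belowSubmodule.mpr ⟨hf, fun mu hmu => ?_⟩
  by_contra hne
  refine hmu fun k => ?_
  rcases le_total n k with hk | hk
  · rw [topSum_of_card_le lam ((card_parts_le lam).trans hk)]
    exact topSum_le mu
  rw [← coeff_expand_part hα mu (card_parts_le mu)] at hne
  have h1 := sum_le_blockDegree (initBlock n k) hne
  have h2 := sum_le_blockDegree (initBlock n k)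
    (ne_of_eq_of_ne (coeff_staircase_altPoly (K := K) (N := n)) one_ne_zero)
  have h3 := blockDegree_mul (initBlock n k) (f := expand n f) (fun h0 => hne (by simp [h0]))
    (altPoly_staircase_ne_zero (K := K) (N := n))
  have h4 : blockDegree (initBlock n k) (expand n f * altPoly K (staircase n)) ≤
      topSum lam k + ∑ i ∈ initBlock n k, staircase n i := by
    refine blockDegree_le _ fun β hβ => ?_
    rw [h, MvPolynomial.coeff_sum] at hβ
    obtain ⟨γ, hγ, hγ'⟩ := Finset.exists_ne_zero_of_sum_ne_zero hβ
    rw [MvPolynomial.coeff_C_mul, altPoly_eq_sum, MvPolynomial.coeff_sum] at hγ'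
    obtain ⟨σ, -, hσ⟩ := Finset.exists_ne_zero_of_sum_ne_zero (right_ne_zero_of_mul hγ')
    rw [MvPolynomial.coeff_monomial] at hσ
    have hβ' : (expVec fun i => γ (σ i) + staircase n (σ i)) = β := by
      by_contra hc
      exact hσ (if_neg hc)
    have h5 := hd γ hγ (left_ne_zero_of_mul hγ') ((initBlock n k).map σ.toEmbedding)
    rw [Finset.card_map, card_initBlock hk, Finset.sum_map] at h5
    rw [← hβ']
    simp only [Finsupp.equivFunOnFinite_symm_apply_apply, Finset.sum_add_distrib]
    exact add_le_add (by simpa using h5) (sum_staircase_perm_le σ hk)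
  have h6 : topSum mu k = ∑ i ∈ initBlock n k, part mu i := (sum_initBlock (part mu) hk).symm
  simp only [Finsupp.equivFunOnFinite_symm_apply_apply] at h1 h2
  omega

/-- In the situation of `mem_belowSubmodule_of_alternants`, the coefficient at `λ` can be read off
from the combination of alternants. -/
theorem coeffAt_of_alternants [CharZero K] {α : K} (hα : α ≠ 0) {n : ℕ}
    {lam : n.Partition} {f : Sym K} (hf : f ∈ symDeg K n) (S : Finset (Fin n →₀ ℕ))
    (d : (Fin n →₀ ℕ) → K)
    (hd : ∀ γ ∈ S, d γ ≠ 0 → ∀ I : Finset (Fin n), ∑ i ∈ I, γ i ≤ topSum lam I.card)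
    (hS : expVec (fun i : Fin n => part lam i) ∈ S)
    (h : expand n f * altPoly K (staircase n) =
      ∑ γ ∈ S, MvPolynomial.C (d γ) * altPoly K fun i => γ i + staircase n i) :
    coeffAt α lam f = d (expVec fun i => part lam i) := by
  classical
  have hbelow := mem_belowSubmodule_of_alternants hα hf S d hd h
  have e := congrArg (MvPolynomial.coeff (expVec fun i : Fin n => part lam i + staircase n i)) h
  rw [altPoly_eq_sum, Finset.mul_sum, MvPolynomial.coeff_sum, Finset.sum_eq_single 1,
    MvPolynomial.coeff_sum, Finset.sum_eq_single (expVec fun i : Fin n => part lam i),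
    MvPolynomial.coeff_C_mul, altPoly_eq_sum, MvPolynomial.coeff_sum, Finset.sum_eq_single 1] at e
  · rw [← coeff_expand_part hα lam (card_parts_le lam)]
    have hadd : (expVec fun i : Fin n => part lam i + staircase n i) =
        (expVec fun i : Fin n => part lam i) +
          expVec fun i => staircase n ((1 : Equiv.Perm (Fin n)) i) := by
      ext i; simp
    rw [hadd, MvPolynomial.coeff_mul_monomial] at e
    simp only [MvPolynomial.coeff_monomial, Equiv.Perm.coe_one, id_eq, Equiv.Perm.sign_one,
      Units.val_one, Int.cast_one, mul_one] at e
    rw [if_pos (Finsupp.ext fun i => by simp), mul_one] at e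
    exact e
  · intro σ _ hσ
    rw [MvPolynomial.coeff_monomial, if_neg]
    intro hc
    refine hσ (perm_eq_one_of_add_staircase_eq (lam := lam) (β := fun i => part lam (σ i)) ?_ ?_)
    · intro I
      have := sum_part_le_topSum lam (I.map σ.toEmbedding)
      simpa using this
    · intro i
      simpa using DFunLike.congr_fun hc i
  · simp
  · intro γ hγ hne
    rw [MvPolynomial.coeff_C_mul]
    by_cases hdγ : d γ = 0
    · rw [hdγ, zero_mul]
    rw [altPoly_eq_sum, MvPolynomial.coeff_sum, Finset.sum_eq_zero, mul_zero]
    intro σ _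
    rw [MvPolynomial.coeff_monomial, if_neg]
    intro hc
    have h1 : ∀ i, γ (σ i) + staircase n (σ i) = part lam i + staircase n i := fun i => by
      simpa using DFunLike.congr_fun hc i
    have h2 : σ = 1 := perm_eq_one_of_add_staircase_eq (β := fun i => γ (σ i)) (fun I => by
      have := hd γ hγ hdγ (I.map σ.toEmbedding)
      simpa using this) h1
    subst h2
    exact hne (Finsupp.ext fun i => by simpa using h1 i)
  · exact fun h => absurd hS h
  · intro σ _ hσ
    rw [MvPolynomial.coeff_mul_monomial']
    split_ifs with hle
    · by_contra hc
      refine hσ (perm_eq_one_of_add_staircase_eq (lam := lam)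
        (sum_le_of_mem_belowSubmodule hα hbelow (left_ne_zero_of_mul hc)) fun i => ?_)
      have := hle i
      simp only [Finsupp.equivFunOnFinite_symm_apply_apply] at this
      simp only [Finsupp.tsub_apply, Finsupp.equivFunOnFinite_symm_apply_apply]
      omega
    · rfl
  · simp

end Triangularity

/-! ### Eigenvectors of the Sekiguchi operator -/

theorem coeff_mul_alternant_sekiguchi [CharZero K] {α : K} (hα : α ≠ 0) (u : K) {n : ℕ}
    (f : Sym K) :
    expand n (sekiguchi α u n f) * altPoly K (staircase n) =
      ∑ γ ∈ Finset.finsuppAntidiag (Finset.univ : Finset (Fin n)) n,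
        MvPolynomial.C (sekiguchiEigenvalue α u γ * MvPolynomial.coeff γ (expand n f)) *
          altPoly K fun i => γ i + staircase n i := by
  rw [sekiguchi_apply, map_sum, Finset.sum_mul]
  refine Finset.sum_congr rfl fun γ _ => ?_
  rw [map_smul, ← coeff_expand hα, MvPolynomial.smul_eq_C_mul, mul_assoc]
  exact congrArg _ (evalAt_schurFun_mul_alternant _ _)

/-- The eigenvalue of the Sekiguchi operator attached to a partition. -/
noncomputable def ptnEigenvalue (α u : K) {n : ℕ} (mu : n.Partition) : K :=
  sekiguchiEigenvalue α u fun i : Fin n => part mu i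

theorem expVec_part_mem {n : ℕ} (mu : n.Partition) :
    expVec (fun i : Fin n => part mu i) ∈
      Finset.finsuppAntidiag (Finset.univ : Finset (Fin n)) n := by
  simpa using sum_part_fin mu (card_parts_le mu)

theorem sekiguchi_mem_belowSubmodule [CharZero K] {α : K} (hα : α ≠ 0) (u : K) {n : ℕ}
    {lam : n.Partition} {f : Sym K} (hf : f ∈ belowSubmodule α lam) :
    sekiguchi α u n f ∈ belowSubmodule α lam :=
  mem_belowSubmodule_of_alternants hα (sekiguchi_mem α u f) _
    (fun γ => sekiguchiEigenvalue α u γ * MvPolynomial.coeff γ (expand n f))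
    (fun _ _ hγ => sum_le_of_mem_belowSubmodule hα hf (right_ne_zero_of_mul hγ))
    (coeff_mul_alternant_sekiguchi hα u f)

theorem coeffAt_sekiguchi [CharZero K] {α : K} (hα : α ≠ 0) (u : K) {n : ℕ}
    {lam : n.Partition} {f : Sym K} (hf : f ∈ belowSubmodule α lam) :
    coeffAt α lam (sekiguchi α u n f) = ptnEigenvalue α u lam * coeffAt α lam f := by
  rw [coeffAt_of_alternants hα (sekiguchi_mem α u f) _
    (fun γ => sekiguchiEigenvalue α u γ * MvPolynomial.coeff γ (expand n f))
    (fun _ _ hγ => sum_le_of_mem_belowSubmodule hα hf (right_ne_zero_of_mul hγ))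
    (expVec_part_mem lam) (coeff_mul_alternant_sekiguchi hα u f),
    coeff_expand_part hα lam (card_parts_le lam)]
  rfl

theorem schurFun_part_bialternant [CharZero K] {n : ℕ} (lam : n.Partition) :
    expand n (schurFun K fun i : Fin n => part lam i) * altPoly K (staircase n) =
      ∑ γ ∈ {expVec fun i : Fin n => part lam i}, MvPolynomial.C 1 *
        altPoly K fun i => γ i + staircase n i := by
  rw [Finset.sum_singleton, MvPolynomial.C_1, one_mul]
  exact evalAt_schurFun_mul_alternant _ _

theorem sum_expVec_part_le {n : ℕ} (lam : n.Partition) (γ : Fin n →₀ ℕ)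
    (hγ : γ ∈ ({expVec fun i : Fin n => part lam i} : Finset (Fin n →₀ ℕ)))
    (I : Finset (Fin n)) : ∑ i ∈ I, γ i ≤ topSum lam I.card := by
  rw [Finset.mem_singleton.mp hγ]
  exact sum_part_le_topSum lam I

theorem schurFun_part_mem [CharZero K] {α : K} (hα : α ≠ 0) {n : ℕ} (lam : n.Partition) :
    (schurFun K fun i : Fin n => part lam i) ∈ belowSubmodule α lam :=
  mem_belowSubmodule_of_alternants hα (schurFun_mem _ (sum_part_fin lam (card_parts_le lam))) _
    (fun _ => 1) (fun γ hγ _ => sum_expVec_part_le lam γ hγ) (schurFun_part_bialternant lam)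

theorem coeffAt_schurFun_part [CharZero K] {α : K} (hα : α ≠ 0) {n : ℕ} (lam : n.Partition) :
    coeffAt α lam (schurFun K fun i : Fin n => part lam i) = 1 :=
  coeffAt_of_alternants hα (schurFun_mem _ (sum_part_fin lam (card_parts_le lam))) _
    (fun _ => 1) (fun γ hγ _ => sum_expVec_part_le lam γ hγ) (by simp)
    (schurFun_part_bialternant lam)

theorem belowSubmodule_mono {α : K} {n : ℕ} {mu lam : n.Partition} (h : DomLE mu lam) :
    belowSubmodule α mu ≤ belowSubmodule α lam := by
  intro f hf
  rw [mem_belowSubmodule] at hf ⊢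
  exact ⟨hf.1, fun nu hnu => hf.2 nu fun h' => hnu (h'.trans h)⟩

/-- The eigenvectors of a triangular operator with simple spectrum, built by induction along the
dominance order from the Schur functions. -/
theorem exists_eigenvector [CharZero K] {α : K} (hα : α ≠ 0) (u : K) {n : ℕ}
    (hu : ∀ lam mu : n.Partition, lam ≠ mu → ptnEigenvalue α u lam ≠ ptnEigenvalue α u mu)
    (lam : n.Partition) :
    ∃ P ∈ belowSubmodule α lam, coeffAt α lam P = 1 ∧
      sekiguchi α u n P = ptnEigenvalue α u lam • P := by
  classical
  induction h : height lam using Nat.strong_induction_on generalizing lam with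
  | _ m ih =>
  subst h
  choose! P hP hP1 hPT using fun mu (hmu : height mu < height lam) => ih _ hmu mu rfl
  let J : n.Partition → Sym K := fun mu => if height mu < height lam then P mu else 0
  have hJ : ∀ mu, J mu ∈ belowSubmodule α mu := fun mu => by
    simp only [J]
    split_ifs with hmu
    exacts [hP mu hmu, Submodule.zero_mem _]
  set D := Finset.univ.filter fun mu => DomLE mu lam ∧ mu ≠ lam with hD
  have hmemD : ∀ mu, mu ∈ D ↔ DomLE mu lam ∧ mu ≠ lam := fun mu => by simp [hD]
  have hJD : ∀ mu ∈ D, J mu = P mu := fun mu hmu =>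
    if_pos (((hmemD mu).mp hmu).1.height_lt ((hmemD mu).mp hmu).2)
  set s := schurFun K fun i : Fin n => part lam i with hs
  have hsmem := schurFun_part_mem hα lam
  have hs1 := coeffAt_schurFun_part hα lam
  rw [← hs] at hsmem hs1
  -- The error `T s - e_λ s` lies strictly below `λ`, where the eigenvectors are already available.
  have hr : sekiguchi α u n s - ptnEigenvalue α u lam • s ∈ Submodule.span K (J '' D) := by
    have hmem : sekiguchi α u n s - ptnEigenvalue α u lam • s ∈ belowSubmodule α lam :=
      Submodule.sub_mem _ (sekiguchi_mem_belowSubmodule hα u hsmem) (Submodule.smul_mem _ _ hsmem)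
    refine mem_span_of_triangular hα (fun nu => (mem_belowSubmodule.mp (hJ nu)).1)
      (fun nu => (mem_belowSubmodule.mp (hJ nu)).2) D ?_ ?_ (mem_belowSubmodule.mp hmem).1 ?_
    · intro nu hnu mu hmu
      rw [hmemD] at hnu ⊢
      refine ⟨hmu.trans hnu.1, ?_⟩
      rintro rfl
      exact hnu.2 (eq_of_dominated_of_height_le hnu.1 (height_le_of_dominated hmu))
    · intro nu hnu
      rw [hJD nu hnu, hP1 nu (((hmemD nu).mp hnu).1.height_lt ((hmemD nu).mp hnu).2)]
      exact one_ne_zero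
    · intro mu hmu
      by_cases hle : DomLE mu lam
      · have : mu = lam := by
          by_contra hne
          exact hmu ((hmemD mu).mpr ⟨hle, hne⟩)
        rw [this, map_sub, map_smul, coeffAt_sekiguchi hα u hsmem, smul_eq_mul, sub_self]
      · exact (mem_belowSubmodule.mp hmem).2 mu hle
  have hr' : ∃ c : n.Partition → K, ∑ mu ∈ D, c mu • J mu =
      sekiguchi α u n s - ptnEigenvalue α u lam • s := by
    exact (Submodule.mem_span_image_finset_iff_exists_fun' K).mp hr
  obtain ⟨c, hc⟩ := hr'
  have hlt : ∀ mu ∈ D, height mu < height lam := fun mu hmu =>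
    ((hmemD mu).mp hmu).1.height_lt ((hmemD mu).mp hmu).2
  -- The correction applies `(e_λ - T)⁻¹` to the error, eigenvector by eigenvector.
  refine ⟨s + ∑ mu ∈ D, (c mu / (ptnEigenvalue α u lam - ptnEigenvalue α u mu)) • P mu,
    ?_, ?_, ?_⟩
  · exact Submodule.add_mem _ hsmem (Submodule.sum_mem _ fun mu hmu => Submodule.smul_mem _ _
      (belowSubmodule_mono ((hmemD mu).mp hmu).1 (hP mu (hlt mu hmu))))
  · rw [map_add, hs1, map_sum, Finset.sum_eq_zero, add_zero]
    intro mu hmu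
    rw [map_smul, (mem_belowSubmodule.mp (hP mu (hlt mu hmu))).2 lam, smul_zero]
    exact fun h => (hlt mu hmu).not_ge (height_le_of_dominated h)
  · rw [map_add, map_sum, ← sub_add_cancel (sekiguchi α u n s) (ptnEigenvalue α u lam • s), ← hc,
      smul_add, add_right_comm, add_comm, add_right_inj, Finset.smul_sum,
      ← Finset.sum_add_distrib]
    refine Finset.sum_congr rfl fun mu hmu => ?_
    have hne : ptnEigenvalue α u lam - ptnEigenvalue α u mu ≠ 0 :=
      sub_ne_zero.mpr (hu lam mu ((hmemD mu).mp hmu).2.symm)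
    rw [map_smul, hPT mu (hlt mu hmu), hJD mu hmu, smul_smul, smul_smul, ← add_smul]
    congr 1
    field_simp
    ring

/-- When `α` is irrational, generic parameters `u` separate the eigenvalues. -/
theorem exists_separating_parameter [CharZero K] {α : K}
    (hirr : ∀ a b c d : ℕ, (a : K) + α * b = c + α * d → a = c ∧ b = d) (n : ℕ) :
    ∃ u : K, ∀ lam mu : n.Partition, lam ≠ mu →
      ptnEigenvalue α u lam ≠ ptnEigenvalue α u mu := by
  classical
  let p : n.Partition → Polynomial K := fun lam =>
    ∏ i : Fin n, (Polynomial.X + Polynomial.C ((staircase n i : K) + α * part lam i))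
  have hp : ∀ (lam : n.Partition) (u : K), (p lam).eval u = ptnEigenvalue α u lam := fun lam u => by
    simp [p, Polynomial.eval_prod, ptnEigenvalue, sekiguchiEigenvalue, add_assoc]
  -- The roots of `p λ` determine the pairs `(δ_i, λ_i)`, because `α` is irrational.
  have hinj : ∀ lam mu : n.Partition, lam ≠ mu → p lam - p mu ≠ 0 := by
    intro lam mu hne h0
    refine hne ?_
    have hpart : ∀ i : Fin n, part lam i = part mu i := by
      intro i
      have h1 := congrArg (Polynomial.eval (-((staircase n i : K) + α * part lam i)))
        (sub_eq_zero.mp h0)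
      rw [hp, hp, ptnEigenvalue, sekiguchiEigenvalue,
        Finset.prod_eq_zero (Finset.mem_univ i) (by ring)] at h1
      obtain ⟨j, -, hj⟩ := Finset.prod_eq_zero_iff.mp
        (show ∏ j : Fin n, (-((staircase n i : K) + α * part lam i) + staircase n j +
          α * part mu j) = 0 from h1.symm)
      obtain ⟨h2, h3⟩ := hirr (staircase n j) (part mu j) (staircase n i) (part lam i)
        (by linear_combination hj)
      rw [← h3, staircase_injective h2]
    refine partition_ext_part fun k => ?_
    rcases lt_or_ge k n with hk | hk
    · exact hpart ⟨k, hk⟩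
    · rw [part_eq_zero lam ((card_parts_le lam).trans hk),
        part_eq_zero mu ((card_parts_le mu).trans hk)]
  have hprod : ∏ q ∈ Finset.univ.filter (fun q : n.Partition × n.Partition => q.1 ≠ q.2),
      (p q.1 - p q.2) ≠ 0 :=
    Finset.prod_ne_zero_iff.mpr fun q hq => hinj _ _ (Finset.mem_filter.mp hq).2
  obtain ⟨u, hu⟩ : ∃ u : K, Polynomial.eval u (∏ q ∈ Finset.univ.filter
      (fun q : n.Partition × n.Partition => q.1 ≠ q.2), (p q.1 - p q.2)) ≠ 0 := by
    by_contra! h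
    exact hprod (Polynomial.funext fun u => by rw [h u, Polynomial.eval_zero])
  refine ⟨u, fun lam mu hne h => hu ?_⟩
  rw [Polynomial.eval_prod]
  refine Finset.prod_eq_zero (i := (lam, mu)) (by simpa using hne) ?_
  rw [Polynomial.eval_sub, hp, hp, h, sub_self]

/-- The orthogonal triangular family: the common eigenvectors of the Sekiguchi operators. -/
theorem exists_isOrthogonalTriangular [LinearOrder K] [IsStrictOrderedRing K] {α : K}
    (hα : 0 < α) (hirr : ∀ a b c d : ℕ, (a : K) + α * b = c + α * d → a = c ∧ b = d) (n : ℕ) :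
    ∃ P : n.Partition → Sym K, IsOrthogonalTriangular α P ∧
      (∀ lam, coeffAt α lam (P lam) = 1) ∧
      ∀ u lam, sekiguchi α u n (P lam) = ptnEigenvalue α u lam • P lam := by
  classical
  obtain ⟨u₀, hu₀⟩ := exists_separating_parameter hirr n
  choose P hP hP1 hPT using exists_eigenvector hα.ne' u₀ hu₀
  have hmem : ∀ lam, P lam ∈ symDeg K n := fun lam => (mem_belowSubmodule.mp (hP lam)).1
  have hOT : IsOrthogonalTriangular α P := by
    refine ⟨hmem, fun lam h0 => ?_, fun lam mu hne => ?_,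
      fun lam => (mem_belowSubmodule.mp (hP lam)).2⟩
    · have := hP1 lam
      rw [h0, map_zero] at this
      exact zero_ne_one this
    · have h := sekiguchi_selfAdjoint hα.ne' u₀ (hmem lam) (hmem mu)
      rw [hPT, hPT, map_smul, map_smul, LinearMap.smul_apply, smul_eq_mul, smul_eq_mul,
        ← sub_eq_zero, ← sub_mul] at h
      exact (mul_eq_zero.mp h).resolve_left (sub_ne_zero.mpr (hu₀ lam mu hne))
  -- A function supported below `λ` is orthogonal to every `P_μ` with `μ` not below `λ`.
  have hbelow : ∀ lam mu : n.Partition, ∀ f ∈ belowSubmodule α lam, ¬ DomLE mu lam →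
      hallForm α (P mu) f = 0 := by
    intro lam mu f hf hmu
    have hspan := hOT.mem_span hα (Finset.univ.filter fun nu => DomLE nu lam)
      (fun nu hnu ka hka => by simpa using hka.trans (by simpa using hnu))
      (mem_belowSubmodule.mp hf).1
      fun nu hnu => (mem_belowSubmodule.mp hf).2 nu (by simpa using hnu)
    have hle : Submodule.span K (P '' (Finset.univ.filter fun nu => DomLE nu lam :
        Finset n.Partition)) ≤ LinearMap.ker (hallForm α (P mu)) := by
      rw [Submodule.span_le]
      rintro _ ⟨nu, hnu, rfl⟩
      refine hOT.orth mu nu ?_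
      rintro rfl
      exact hmu (by simpa using hnu)
    exact hle hspan
  refine ⟨P, hOT, hP1, fun u lam => ?_⟩
  have hT := sekiguchi_mem_belowSubmodule hα.ne' u (hP lam)
  have hexp := hOT.expansion hα (sekiguchi_mem α u (P lam))
  rw [Finset.sum_eq_single lam] at hexp
  · have h1 := congrArg (coeffAt α lam) hexp
    rw [map_smul, coeffAt_sekiguchi hα.ne' u (hP lam), hP1, smul_eq_mul, mul_one, mul_one] at h1
    rw [h1]
    exact hexp
  · intro mu _ hne
    have h0 : hallForm α (sekiguchi α u n (P lam)) (P mu) = 0 := by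
      by_cases hle : DomLE mu lam
      · rw [sekiguchi_selfAdjoint hα.ne' u (hmem lam) (hmem mu)]
        refine hbelow mu lam _ (sekiguchi_mem_belowSubmodule hα.ne' u (hP mu)) fun h => hne ?_
        exact eq_of_dominated_of_height_le hle (height_le_of_dominated h)
      · rw [hallForm_comm]
        exact hbelow lam mu _ hT hle
    rw [h0, zero_div, zero_smul]
  · simp

/-! ### The Laplace–Beltrami equation -/

section LaplaceBeltrami

/-- The eigenvalue `∑ (2 δ_i γ_i + α γ_i ^ 2)` of the Laplace–Beltrami operator. -/
noncomputable def laplaceEigenvalue (α : K) {N : ℕ} (γ : Fin N → ℕ) : K :=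
  ∑ i, (2 * staircase N i * γ i + α * (γ i : K) ^ 2)

theorem coeff_prod_one_add {ι : Type*} (s : Finset ι) (v : ι → K) :
    (∏ i ∈ s, (1 + Polynomial.C (v i) * Polynomial.X)).coeff 0 = 1 ∧
    (∏ i ∈ s, (1 + Polynomial.C (v i) * Polynomial.X)).coeff 1 = ∑ i ∈ s, v i ∧
    2 * (∏ i ∈ s, (1 + Polynomial.C (v i) * Polynomial.X)).coeff 2 =
      (∑ i ∈ s, v i) ^ 2 - ∑ i ∈ s, v i ^ 2 := by
  classical
  induction s using Finset.induction_on with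
  | empty => simp [Polynomial.coeff_one]
  | insert a s ha ih =>
    obtain ⟨h0, h1, h2⟩ := ih
    rw [Finset.prod_insert ha, Finset.sum_insert ha, Finset.sum_insert ha]
    simp only [add_mul, one_mul, mul_assoc, Polynomial.coeff_add, Polynomial.coeff_C_mul,
      Polynomial.coeff_X_mul_zero, Polynomial.coeff_X_mul, h0, h1]
    refine ⟨by ring, by ring, ?_⟩
    linear_combination h2

/-- If a linear relation between the Sekiguchi eigenvalues holds for all parameters, then it holds
between the Laplace–Beltrami eigenvalues, by comparison of the coefficients of `u ^ (n - 2)`: the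
coefficient of `u ^ n` in the eigenvalue is `1`, that of `u ^ (n - 1)` depends only on `∑ γ_i`, and
that of `u ^ (n - 2)` is an affine function of the Laplace–Beltrami eigenvalue. -/
theorem laplaceEigenvalue_relation [CharZero K] {α : K} (hα : α ≠ 0) {n : ℕ}
    (S : Finset (Fin n →₀ ℕ)) (hS : ∀ γ ∈ S, ∑ i, γ i = n) (lam : Fin n →₀ ℕ) (hlam : lam ∈ S)
    (A : K) (B : (Fin n →₀ ℕ) → K)
    (h : ∀ u, sekiguchiEigenvalue α u lam * A = ∑ γ ∈ S, sekiguchiEigenvalue α u γ * B γ) :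
    laplaceEigenvalue α lam * A = ∑ γ ∈ S, laplaceEigenvalue α γ * B γ := by
  let v : (Fin n →₀ ℕ) → Fin n → K := fun γ i => staircase n i + α * γ i
  let p : (Fin n →₀ ℕ) → Polynomial K := fun γ =>
    ∏ i, (1 + Polynomial.C (v γ i) * Polynomial.X)
  have hp : ∀ (γ : Fin n →₀ ℕ) (η : K), η ≠ 0 →
      (p γ).eval η = η ^ n * sekiguchiEigenvalue α η⁻¹ γ := by
    intro γ η hη
    rw [sekiguchiEigenvalue, Polynomial.eval_prod]
    have hpow : η ^ n = ∏ _i : Fin n, η := by simp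
    rw [hpow, ← Finset.prod_mul_distrib]
    refine Finset.prod_congr rfl fun i _ => ?_
    simp only [v, Polynomial.eval_add, Polynomial.eval_one, Polynomial.eval_mul,
      Polynomial.eval_C, Polynomial.eval_X]
    field_simp
    ring
  have hpoly : p lam * Polynomial.C A - ∑ γ ∈ S, p γ * Polynomial.C (B γ) = 0 := by
    refine (mul_eq_zero.mp ?_).resolve_left Polynomial.X_ne_zero
    refine Polynomial.funext fun η => ?_
    rw [Polynomial.eval_mul, Polynomial.eval_X, Polynomial.eval_zero]
    rcases eq_or_ne η 0 with rfl | hη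
    · exact zero_mul _
    rw [Polynomial.eval_sub, Polynomial.eval_finsetSum]
    simp only [Polynomial.eval_mul, Polynomial.eval_C, hp _ η hη, mul_assoc]
    rw [← Finset.mul_sum, h, sub_self, mul_zero]
  have hcoeff : ∀ k, (p lam).coeff k * A = ∑ γ ∈ S, (p γ).coeff k * B γ := fun k => by
    have := congrArg (fun q => Polynomial.coeff q k) (sub_eq_zero.mp hpoly)
    simpa [Polynomial.finsetSum_coeff] using this
  have h0 := hcoeff 0
  have h2 := hcoeff 2
  have hp0 : ∀ γ, (p γ).coeff 0 = 1 := fun γ => (coeff_prod_one_add _ _).1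
  set c := ((∑ i, (staircase n i : K)) + α * n) ^ 2 - ∑ i, (staircase n i : K) ^ 2 with hc
  have hp2 : ∀ γ ∈ S, 2 * (p γ).coeff 2 = c - α * laplaceEigenvalue α γ := by
    intro γ hγ
    have hsum : ∑ i, v γ i = (∑ i, (staircase n i : K)) + α * n := by
      have h' : ∑ i, ((γ i : ℕ) : K) = n := by exact_mod_cast hS γ hγ
      simp only [v, Finset.sum_add_distrib, ← Finset.mul_sum]
      rw [h']
    rw [(coeff_prod_one_add _ _).2.2, hsum, hc, sub_sub, laplaceEigenvalue, Finset.mul_sum,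
      ← Finset.sum_add_distrib]
    congr 1
    refine Finset.sum_congr rfl fun i _ => ?_
    simp only [v]
    ring
  simp only [hp0, one_mul] at h0
  have h2' : 2 * (p lam).coeff 2 * A = ∑ γ ∈ S, 2 * (p γ).coeff 2 * B γ := by
    simp only [mul_assoc, ← Finset.mul_sum]
    rw [h2]
  rw [hp2 lam hlam, Finset.sum_congr rfl fun γ hγ => by rw [hp2 γ hγ]] at h2'
  simp only [sub_mul, Finset.sum_sub_distrib, ← Finset.mul_sum, mul_assoc] at h2'
  rw [← h0] at h2'
  exact mul_left_cancel₀ hα (by linear_combination -h2')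

variable {N : ℕ}

/-- The derivation `x_i ∂/∂x_i`. -/
noncomputable def eulerAt (K : Type*) [Field K] (i : Fin N) :
    Derivation K (MvPolynomial (Fin N) K) (MvPolynomial (Fin N) K) :=
  (MvPolynomial.X i : MvPolynomial (Fin N) K) • MvPolynomial.pderiv i

theorem eulerAt_monomial (i : Fin N) (β : Fin N →₀ ℕ) (a : K) :
    eulerAt K i (MvPolynomial.monomial β a) = MvPolynomial.monomial β (a * β i) := by
  rw [eulerAt, Derivation.smul_apply, MvPolynomial.pderiv_monomial, smul_eq_mul, MvPolynomial.X,
    MvPolynomial.monomial_mul, one_mul]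
  rcases Nat.eq_zero_or_pos (β i) with h | h
  · simp [h]
  · congr 2
    exact add_tsub_cancel_of_le (Finsupp.single_le_iff.mpr h)

theorem coeff_eulerAt (i : Fin N) (β : Fin N →₀ ℕ) (f : MvPolynomial (Fin N) K) :
    MvPolynomial.coeff β (eulerAt K i f) = β i * MvPolynomial.coeff β f := by
  classical
  induction f using MvPolynomial.induction_on' with
  | monomial γ a =>
    rw [eulerAt_monomial, MvPolynomial.coeff_monomial, MvPolynomial.coeff_monomial]
    split_ifs with h
    · rw [h, mul_comm]
    · simp
  | add p q hp hq => rw [map_add, MvPolynomial.coeff_add, MvPolynomial.coeff_add, hp, hq, mul_add]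

theorem eulerAt_X (i j : Fin N) :
    eulerAt K i (MvPolynomial.X j) = if j = i then MvPolynomial.X i else 0 := by
  classical
  rw [eulerAt, Derivation.smul_apply, MvPolynomial.pderiv_X]
  by_cases h : j = i
  · subst h; simp
  · simp [h]

/-- The sum of alternants in the Laplace–Beltrami equation, in terms of Euler derivations. -/
theorem sum_laplaceEigenvalue_alternant [CharZero K] (α : K) {n : ℕ} {P : Sym K}
    (hP : P ∈ symDeg K n) :
    ∑ γ ∈ Finset.finsuppAntidiag (Finset.univ : Finset (Fin n)) n,
      MvPolynomial.C (laplaceEigenvalue α γ * MvPolynomial.coeff γ (expand n P)) *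
        (altPoly K fun i => γ i + staircase n i) =
    ∑ i, (MvPolynomial.C 2 * (eulerAt K i (altPoly K (staircase n)) *
        eulerAt K i (expand n P)) +
      MvPolynomial.C α * (altPoly K (staircase n) *
        eulerAt K i (eulerAt K i (expand n P)))) := by
  classical
  set S := Finset.finsuppAntidiag (Finset.univ : Finset (Fin n)) n with hSdef
  have hmemS : ∀ γ : Fin n →₀ ℕ, γ ∈ S ↔ ∑ i, γ i = n := fun γ => by simp [hSdef]
  have hf : expand n P = ∑ γ ∈ S, MvPolynomial.monomial γ (MvPolynomial.coeff γ (expand n P)) := by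
    conv_lhs => rw [(expand n P).as_sum]
    refine Finset.sum_subset (fun γ hγ => ?_) fun γ _ hγ => ?_
    · rw [hmemS]
      by_contra h
      exact MvPolynomial.mem_support_iff.mp hγ (coeff_expand_eq_zero γ h hP)
    · rw [MvPolynomial.notMem_support_iff.mp hγ, map_zero]
  -- Both sides are sums over permutations and exponents of the same monomials.
  have hR : ∀ i, MvPolynomial.C 2 * (eulerAt K i (altPoly K (staircase n)) *
        eulerAt K i (expand n P)) +
      MvPolynomial.C α * (altPoly K (staircase n) *
        eulerAt K i (eulerAt K i (expand n P))) =
      ∑ σ : Equiv.Perm (Fin n), ∑ γ ∈ S,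
        MvPolynomial.monomial ((expVec fun i => staircase n (σ i)) + γ)
          (((Equiv.Perm.sign σ : ℤ) : K) * (MvPolynomial.coeff γ (expand n P)) *
            (2 * staircase n (σ i) * γ i + α * (γ i : K) ^ 2)) := by
    intro i
    rw [hf, altPoly_eq_sum]
    simp only [map_sum, eulerAt_monomial]
    rw [Finset.sum_mul_sum, Finset.sum_mul_sum, Finset.mul_sum, Finset.mul_sum,
      ← Finset.sum_add_distrib]
    refine Finset.sum_congr rfl fun σ _ => ?_
    rw [Finset.mul_sum, Finset.mul_sum, ← Finset.sum_add_distrib]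
    refine Finset.sum_congr rfl fun γ hγ => ?_
    rw [MvPolynomial.monomial_mul, MvPolynomial.monomial_mul, MvPolynomial.C_mul_monomial,
      MvPolynomial.C_mul_monomial, ← map_add, ← hf]
    congr 1
    simp only [Finsupp.equivFunOnFinite_symm_apply_apply]
    ring
  rw [Finset.sum_congr rfl fun i _ => hR i, Finset.sum_comm]
  simp only [altPoly_eq_sum, Finset.mul_sum]
  rw [Finset.sum_comm]
  refine Finset.sum_congr rfl fun σ _ => ?_
  rw [Finset.sum_comm]
  refine Finset.sum_bij' (fun γ _ => expVec fun i => γ (σ i))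
    (fun γ _ => expVec fun i => γ (σ.symm i)) ?_ ?_ ?_ ?_ ?_
  · intro γ hγ
    rw [hmemS] at hγ ⊢
    simpa [Equiv.sum_comp σ γ] using hγ
  · intro γ hγ
    rw [hmemS] at hγ ⊢
    simpa [Equiv.sum_comp σ.symm γ] using hγ
  · intro γ _; ext i; simp
  · intro γ _; ext i; simp
  · intro γ _
    rw [MvPolynomial.C_mul_monomial, ← map_sum, ← Finset.mul_sum]
    have h1 : (expVec fun i => γ (σ i) + staircase n (σ i)) =
        (expVec fun i => staircase n (σ i)) + expVec fun i => γ (σ i) := by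
      ext i; simp [add_comm]
    have h2 : MvPolynomial.coeff (expVec fun i => γ (σ i)) (expand n P) =
        MvPolynomial.coeff γ (expand n P) := by
      rw [coeff_expand_perm (fun i => γ i) σ P]
      congr 1
      ext i; simp
    have h3 : laplaceEigenvalue α γ =
        ∑ i, (2 * staircase n (σ i) * (γ (σ i) : K) + α * (γ (σ i) : K) ^ 2) :=
      (Equiv.sum_comp σ fun i => 2 * staircase n i * (γ i : K) + α * (γ i : K) ^ 2).symm
    rw [h1, h2, h3]
    congr 1
    simp only [Finsupp.equivFunOnFinite_symm_apply_apply]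
    ring

/-- The pairs of indices `(i, j)` with `i < j`. -/
def indexPairs (N : ℕ) : Finset (Fin N × Fin N) := Finset.univ.filter fun p => p.1 < p.2

theorem altPoly_staircase_eq :
    ∃ c : K, altPoly K (staircase N) = MvPolynomial.C c *
      ∏ p ∈ indexPairs N, (MvPolynomial.X p.1 - MvPolynomial.X p.2) := by
  have h : (Matrix.of fun i l => (MvPolynomial.X l : MvPolynomial (Fin N) K) ^ staircase N i) =
      (Matrix.vandermonde fun l => (MvPolynomial.X l : MvPolynomial (Fin N) K)).transpose.submatrix
        Fin.revPerm id := by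
    ext i l
    simp [staircase, Matrix.vandermonde_apply]
  have h2 : ∏ i : Fin N, ∏ j ∈ Finset.Ioi i,
      ((MvPolynomial.X j : MvPolynomial (Fin N) K) - MvPolynomial.X i) =
      (-1) ^ (indexPairs N).card *
        ∏ p ∈ indexPairs N, (MvPolynomial.X p.1 - MvPolynomial.X p.2) := by
    rw [← Finset.prod_finset_product' (indexPairs N) Finset.univ (fun i => Finset.Ioi i)
      (by simp [indexPairs]) (f := fun i j => (MvPolynomial.X j : MvPolynomial (Fin N) K) -
        MvPolynomial.X i), ← Finset.prod_const, ← Finset.prod_mul_distrib]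
    exact Finset.prod_congr rfl fun p _ => by ring
  refine ⟨((Equiv.Perm.sign (Fin.revPerm (n := N)) : ℤ) : K) * (-1) ^ (indexPairs N).card, ?_⟩
  unfold altPoly alternant
  rw [h, Matrix.det_permute, Matrix.det_transpose, Matrix.det_vandermonde, h2]
  simp [mul_assoc]

theorem rename_expand (σ : Equiv.Perm (Fin N)) (f : Sym K) :
    MvPolynomial.rename σ (expand N f) = expand N f := by
  have : (MvPolynomial.rename σ).comp (expand (K := K) N) = expand N :=
    MvPolynomial.algHom_ext fun k => by
      simp only [AlgHom.comp_apply, expand, MvPolynomial.aeval_X]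
      exact MvPolynomial.psum_isSymmetric (Fin N) K k σ
  exact DFunLike.congr_fun this f

/-- The divided difference `(x_i θ_i - x_j θ_j) f / (x_i - x_j)` of a symmetric polynomial is a
polynomial. -/
theorem exists_dividedDifference (i j : Fin N) (P : Sym K) :
    ∃ w : MvPolynomial (Fin N) K, (MvPolynomial.X i - MvPolynomial.X j) * w =
      MvPolynomial.X i * eulerAt K i (expand N P) -
        MvPolynomial.X j * eulerAt K j (expand N P) := by
  classical
  set I : Ideal (MvPolynomial (Fin N) K) := Ideal.span {MvPolynomial.X i - MvPolynomial.X j} with hI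
  have hquot : (Ideal.Quotient.mkₐ K I).comp (MvPolynomial.rename (Equiv.swap i j)) =
      Ideal.Quotient.mkₐ K I := by
    refine MvPolynomial.algHom_ext fun k => ?_
    rw [AlgHom.comp_apply, MvPolynomial.rename_X]
    have hij : Ideal.Quotient.mkₐ K I (MvPolynomial.X i) =
        Ideal.Quotient.mkₐ K I (MvPolynomial.X j) :=
      Ideal.Quotient.eq.mpr (Ideal.subset_span rfl)
    rcases eq_or_ne k i with rfl | hki
    · rw [Equiv.swap_apply_left, hij]
    rcases eq_or_ne k j with rfl | hkj
    · rw [Equiv.swap_apply_right, hij]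
    rw [Equiv.swap_apply_of_ne_of_ne hki hkj]
  have hswap : MvPolynomial.rename (Equiv.swap i j) (MvPolynomial.X i * eulerAt K i (expand N P)) =
      MvPolynomial.X j * eulerAt K j (expand N P) := by
    simp only [eulerAt, Derivation.smul_apply, smul_eq_mul, map_mul, MvPolynomial.rename_X,
      Equiv.swap_apply_left]
    rw [← MvPolynomial.pderiv_rename (Equiv.swap i j).injective, rename_expand,
      Equiv.swap_apply_left]
  have hmem : MvPolynomial.X i * eulerAt K i (expand N P) -
      MvPolynomial.X j * eulerAt K j (expand N P) ∈ I := by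
    rw [← hswap, ← Ideal.Quotient.eq]
    exact (DFunLike.congr_fun hquot _).symm
  obtain ⟨w, hw⟩ := Ideal.mem_span_singleton.mp hmem
  exact ⟨w, hw.symm⟩

/-- The Laplace–Beltrami equation for a common eigenvector of the Sekiguchi operators. -/
theorem laplaceBeltrami_equation [CharZero K] {α : K} (hα : α ≠ 0) {n : ℕ} {lam : n.Partition}
    {P : Sym K} (hP : P ∈ symDeg K n)
    (hT : ∀ u, sekiguchi α u n P = ptnEigenvalue α u lam • P)
    (w : Fin n × Fin n → MvPolynomial (Fin n) K)
    (hw : ∀ p, (MvPolynomial.X p.1 - MvPolynomial.X p.2) * w p =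
      MvPolynomial.X p.1 * eulerAt K p.1 (expand n P) -
        MvPolynomial.X p.2 * eulerAt K p.2 (expand n P)) :
    MvPolynomial.C (laplaceEigenvalue α fun i : Fin n => part lam i) * expand n P =
      MvPolynomial.C 2 * ∑ p ∈ indexPairs n, w p +
        MvPolynomial.C α * ∑ i, eulerAt K i (eulerAt K i (expand n P)) := by
  classical
  refine mul_left_cancel₀ (altPoly_staircase_ne_zero (K := K) (N := n)) ?_
  have h1 : altPoly K (staircase n) * (MvPolynomial.C
      (laplaceEigenvalue α fun i : Fin n => part lam i) * expand n P) =
      ∑ γ ∈ Finset.finsuppAntidiag (Finset.univ : Finset (Fin n)) n,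
        MvPolynomial.C (laplaceEigenvalue α γ * MvPolynomial.coeff γ (expand n P)) *
          (altPoly K fun i => γ i + staircase n i) := by
    ext κ
    rw [mul_left_comm, MvPolynomial.coeff_C_mul, MvPolynomial.coeff_sum]
    simp only [MvPolynomial.coeff_C_mul, mul_assoc]
    refine laplaceEigenvalue_relation hα _ (fun γ hγ => by simpa using hγ)
      (expVec fun i : Fin n => part lam i) (expVec_part_mem lam) _
      (fun γ => MvPolynomial.coeff γ (expand n P) *
        MvPolynomial.coeff κ (altPoly K fun i => γ i + staircase n i)) fun u => ?_
    have h2 := coeff_mul_alternant_sekiguchi hα u P (n := n)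
    rw [hT, map_smul, smul_mul_assoc] at h2
    have h3 := congrArg (MvPolynomial.coeff κ) h2
    rw [MvPolynomial.coeff_smul, MvPolynomial.coeff_sum, smul_eq_mul, mul_comm (expand n P)] at h3
    simp only [MvPolynomial.coeff_C_mul, mul_assoc] at h3
    exact h3
  rw [h1, sum_laplaceEigenvalue_alternant α hP]
  obtain ⟨c, hV⟩ := altPoly_staircase_eq (K := K) (N := n)
  have h4 : ∑ i, eulerAt K i (altPoly K (staircase n)) * eulerAt K i (expand n P) =
      altPoly K (staircase n) * ∑ p ∈ indexPairs n, w p := by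
    rw [hV, ← MvPolynomial.smul_eq_C_mul]
    simp only [Derivation.map_smul, smul_mul_assoc]
    rw [← Finset.smul_sum]
    congr 1
    simp only [derivation_prod, Finset.sum_mul]
    rw [Finset.sum_comm, Finset.mul_sum]
    refine Finset.sum_congr rfl fun p hp => ?_
    simp only [mul_assoc]
    rw [← Finset.mul_sum, ← Finset.prod_erase_mul _ _ hp, mul_assoc, hw p]
    congr 1
    simp only [map_sub, eulerAt_X, sub_mul, ite_mul, zero_mul, Finset.sum_sub_distrib,
      Finset.sum_ite_eq, Finset.mem_univ, if_true]
  rw [Finset.sum_add_distrib, ← Finset.mul_sum, ← Finset.mul_sum, ← Finset.mul_sum, h4]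
  ring

end LaplaceBeltrami

/-! ### Positivity of the monomial coefficients -/

section Positivity

/-- Summation by parts for a decreasing weight. -/
theorem sum_mul_le_sum_mul_of_antitone {a b c : ℕ → ℕ} (ha : Antitone a)
    (h : ∀ k, ∑ j ∈ Finset.range k, b j ≤ ∑ j ∈ Finset.range k, c j) (m : ℕ) :
    ∑ j ∈ Finset.range m, a j * b j ≤ ∑ j ∈ Finset.range m, a j * c j := by
  have key : ∑ j ∈ Finset.range m, a j * b j + a m * ∑ j ∈ Finset.range m, c j ≤
      ∑ j ∈ Finset.range m, a j * c j + a m * ∑ j ∈ Finset.range m, b j := by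
    induction m with
    | zero => simp
    | succ m ih =>
      obtain ⟨x, hx⟩ := Nat.exists_eq_add_of_le (ha (Nat.le_succ m))
      obtain ⟨y, hy⟩ := Nat.exists_eq_add_of_le (h (m + 1))
      simp only [Nat.succ_eq_add_one] at hx
      have hy' := hy
      rw [Finset.sum_range_succ, Finset.sum_range_succ] at hy'
      rw [hy, Finset.sum_range_succ, Finset.sum_range_succ (fun j => a j * c j)]
      rw [hx] at ih ⊢
      nlinarith [Nat.zero_le (x * y)]
  have := Nat.mul_le_mul_left (a m) (h m)
  omega

theorem sum_sum_range (f : ℕ → ℕ) (m : ℕ) :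
    ∑ k ∈ Finset.range m, ∑ j ∈ Finset.range k, f j = ∑ j ∈ Finset.range m, (m - 1 - j) * f j := by
  induction m with
  | zero => simp
  | succ m ih =>
    rw [Finset.sum_range_succ, ih, ← Finset.sum_add_distrib, Finset.sum_range_succ]
    simp only [add_tsub_cancel_right, tsub_self, zero_mul, add_zero]
    refine Finset.sum_congr rfl fun j hj => ?_
    have hj' := Finset.mem_range.mp hj
    rw [← Nat.succ_mul]
    congr 1
    omega

/-- The linear part of the Laplace–Beltrami eigenvalue is the `height`, up to a constant. -/
theorem sum_staircase_mul_part_add {n : ℕ} (mu : n.Partition) :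
    ∑ i : Fin n, staircase n i * part mu i + n = height mu := by
  have h1 : ∑ i : Fin n, staircase n i * part mu i =
      ∑ j ∈ Finset.range n, (n - 1 - j) * part mu j := by
    rw [Finset.sum_range]
    refine Finset.sum_congr rfl fun i _ => ?_
    congr 1
    simp only [staircase, Fin.val_rev]
    omega
  rw [h1, ← sum_sum_range, height, Finset.sum_range_succ, topSum_of_card_le mu (card_parts_le mu)]
  rfl

theorem DomLE.sum_sq_le {n : ℕ} {mu lam : n.Partition} (h : DomLE mu lam) :
    ∑ i : Fin n, part mu i ^ 2 ≤ ∑ i : Fin n, part lam i ^ 2 := by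
  rw [← Finset.sum_range fun j => part mu j ^ 2, ← Finset.sum_range fun j => part lam j ^ 2]
  simp only [sq]
  refine (sum_mul_le_sum_mul_of_antitone (part_antitone mu) h n).trans ?_
  refine le_of_eq_of_le (Finset.sum_congr rfl fun j _ => mul_comm _ _) ?_
  exact sum_mul_le_sum_mul_of_antitone (part_antitone lam) h n

variable [LinearOrder K] [IsStrictOrderedRing K]

/-- The Laplace–Beltrami eigenvalue is strictly monotone for the dominance order. -/
theorem DomLE.laplaceEigenvalue_lt {α : K} (hα : 0 < α) {n : ℕ} {mu lam : n.Partition}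
    (h : DomLE mu lam) (hne : mu ≠ lam) :
    laplaceEigenvalue α (fun i : Fin n => part mu i) <
      laplaceEigenvalue α (fun i : Fin n => part lam i) := by
  have hform : ∀ nu : n.Partition, laplaceEigenvalue α (fun i : Fin n => part nu i) =
      2 * ((∑ i : Fin n, staircase n i * part nu i : ℕ) : K) +
        α * ((∑ i : Fin n, part nu i ^ 2 : ℕ) : K) := fun nu => by
    rw [laplaceEigenvalue, Finset.sum_add_distrib]
    push_cast
    rw [Finset.mul_sum, Finset.mul_sum]
    simp only [mul_assoc]
  have h1 := sum_staircase_mul_part_add mu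
  have h2 := sum_staircase_mul_part_add lam
  have h3 := h.height_lt hne
  have h4 : ∑ i : Fin n, staircase n i * part mu i < ∑ i : Fin n, staircase n i * part lam i := by
    omega
  rw [hform, hform]
  refine add_lt_add_of_lt_of_le ?_ ?_
  · exact mul_lt_mul_of_pos_left (Nat.cast_lt.mpr h4) two_pos
  · exact mul_le_mul_of_nonneg_left (Nat.cast_le.mpr h.sum_sq_le) hα.le

variable {N : ℕ}

/-- The sum of the squares of the exponents. -/
def sqSum (β : Fin N →₀ ℕ) : ℕ := ∑ i, β i ^ 2

theorem sqSum_add_single (β : Fin N →₀ ℕ) (i : Fin N) :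
    sqSum (β + Finsupp.single i 1) = sqSum β + 2 * β i + 1 := by
  classical
  have : ∀ k, (β + Finsupp.single i 1 : Fin N →₀ ℕ) k ^ 2 =
      β k ^ 2 + if i = k then 2 * β i + 1 else 0 := by
    intro k
    rw [Finsupp.add_apply, Finsupp.single_apply]
    split_ifs with h
    · subst h; ring
    · ring
  simp only [sqSum, this, Finset.sum_add_distrib, Finset.sum_ite_eq, Finset.mem_univ, if_true]
  ring

theorem sqSum_lt {i j : Fin N} (hij : i ≠ j) {μ μ' : Fin N →₀ ℕ}
    (h : μ' + Finsupp.single j 1 = μ + Finsupp.single i 1) (hle : μ j ≤ μ i) :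
    sqSum μ < sqSum μ' := by
  have h1 := congrArg sqSum h
  rw [sqSum_add_single, sqSum_add_single] at h1
  have h2 := DFunLike.congr_fun h j
  simp [hij] at h2
  omega

/-- Lower bounds for the coefficients of a divided difference `w`: moving one box from the smaller
exponent `μ_j` to the larger exponent `μ_i` gives a recursion for the coefficients of `w`. -/
theorem le_coeff_dividedDifference {i j : Fin N} (hij : i ≠ j) {f w : MvPolynomial (Fin N) K}
    (hw : (MvPolynomial.X i - MvPolynomial.X j) * w =
      MvPolynomial.X i * eulerAt K i f - MvPolynomial.X j * eulerAt K j f)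
    (μ : Fin N →₀ ℕ) (hle : μ j ≤ μ i) (hf : ∀ β, sqSum μ < sqSum β → 0 ≤ MvPolynomial.coeff β f) :
    μ i * MvPolynomial.coeff μ f ≤ MvPolynomial.coeff μ w ∧
    ∀ μ', μ' + Finsupp.single j 1 = μ + Finsupp.single i 1 →
      μ i * MvPolynomial.coeff μ f + 2 * MvPolynomial.coeff μ' f ≤ MvPolynomial.coeff μ w := by
  classical
  have hcoef := congrArg (MvPolynomial.coeff (μ + Finsupp.single i 1)) hw
  rw [sub_mul, MvPolynomial.coeff_sub, MvPolynomial.coeff_sub, add_comm μ,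
    MvPolynomial.coeff_X_mul, MvPolynomial.coeff_X_mul, coeff_eulerAt, add_comm _ μ] at hcoef
  induction hk : μ j generalizing μ with
  | zero =>
    have hnot : j ∉ (μ + Finsupp.single i 1).support := by
      simp [hk, hij]
    rw [MvPolynomial.coeff_X_mul', MvPolynomial.coeff_X_mul', if_neg hnot, if_neg hnot, sub_zero,
      sub_zero] at hcoef
    refine ⟨hcoef.ge, fun μ' h => ?_⟩
    have := DFunLike.congr_fun h j
    simp [hk, hij] at this
  | succ k ih =>
    have hex : ∃ μ', μ' + Finsupp.single j 1 = μ + Finsupp.single i 1 := by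
      refine ⟨μ + Finsupp.single i 1 - Finsupp.single j 1, ?_⟩
      refine tsub_add_cancel_of_le (Finsupp.single_le_iff.mpr ?_)
      rw [Finsupp.add_apply, hk]
      omega
    suffices H : ∀ μ', μ' + Finsupp.single j 1 = μ + Finsupp.single i 1 →
        0 ≤ MvPolynomial.coeff μ' f ∧
        μ i * MvPolynomial.coeff μ f + 2 * MvPolynomial.coeff μ' f ≤ MvPolynomial.coeff μ w by
      refine ⟨?_, fun μ' h => (H μ' h).2⟩
      obtain ⟨μ', h⟩ := hex
      obtain ⟨h1, h2⟩ := H μ' h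
      linarith
    intro μ' h
    have hlt := sqSum_lt hij h hle
    have hj := DFunLike.congr_fun h j
    have hi := DFunLike.congr_fun h i
    simp [hij, hij.symm] at hi hj
    have hcoef' := congrArg (MvPolynomial.coeff (μ' + Finsupp.single i 1)) hw
    rw [sub_mul, MvPolynomial.coeff_sub, MvPolynomial.coeff_sub, add_comm μ',
      MvPolynomial.coeff_X_mul, MvPolynomial.coeff_X_mul, coeff_eulerAt, add_comm _ μ'] at hcoef'
    have hrec := (ih μ' (by omega) (fun β hβ => hf β (hlt.trans hβ)) hcoef' (by omega)).1
    rw [← h, add_comm μ', MvPolynomial.coeff_X_mul, MvPolynomial.coeff_X_mul, coeff_eulerAt]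
      at hcoef
    have hnonneg := hf μ' hlt
    refine ⟨hnonneg, ?_⟩
    have hcast : (μ' j : K) + 2 ≤ μ' i := by exact_mod_cast (by omega : μ' j + 2 ≤ μ' i)
    nlinarith [mul_le_mul_of_nonneg_right hcast hnonneg]

theorem sum_indexPairs_fst (f : Fin N → ℕ) :
    ∑ p ∈ indexPairs N, f p.1 = ∑ i, staircase N i * f i := by
  rw [Finset.sum_finset_product' (indexPairs N) Finset.univ (fun i => Finset.Ioi i)
    (by simp [indexPairs]) (f := fun i _ => f i)]
  refine Finset.sum_congr rfl fun i _ => ?_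
  rw [Finset.sum_const, Fin.card_Ioi, smul_eq_mul, staircase, Fin.val_rev]
  congr 1
  omega

/-- The coefficient of the Laplace–Beltrami equation at an exponent `ν`, with each divided
difference oriented by `o` from the larger to the smaller exponent: the contribution of a pair
exceeds `ν_i f_ν`, where `ν_i` is the larger exponent, by a remainder `R`. -/
theorem exists_laplaceBeltrami_remainder {α : K} (hα : 0 < α) {n : ℕ} {lam : n.Partition}
    {P : Sym K} (hP : P ∈ symDeg K n)
    (hT : ∀ u, sekiguchi α u n P = ptnEigenvalue α u lam • P) (ν : Fin n →₀ ℕ)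
    (hf : ∀ β, sqSum ν < sqSum β → 0 ≤ MvPolynomial.coeff β (expand n P))
    (o : Fin n × Fin n → Fin n × Fin n) (ho : ∀ p, o p = p ∨ o p = p.swap)
    (hν : ∀ p ∈ indexPairs n, ν (o p).2 ≤ ν (o p).1) :
    ∃ R : Fin n × Fin n → K,
      (laplaceEigenvalue α fun i : Fin n => part lam i) * MvPolynomial.coeff ν (expand n P) =
        (2 * ((∑ p ∈ indexPairs n, ν (o p).1 : ℕ) : K) + α * ∑ i, (ν i : K) ^ 2) *
          MvPolynomial.coeff ν (expand n P) + 2 * ∑ p ∈ indexPairs n, R p ∧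
      (∀ p ∈ indexPairs n, 0 ≤ R p) ∧
      ∀ p ∈ indexPairs n, ∀ γ, γ + Finsupp.single (o p).2 1 = ν + Finsupp.single (o p).1 1 →
        2 * MvPolynomial.coeff γ (expand n P) ≤ R p := by
  choose w hw using fun p : Fin n × Fin n => exists_dividedDifference (o p).1 (o p).2 P
  have hw' : ∀ p : Fin n × Fin n, (MvPolynomial.X p.1 - MvPolynomial.X p.2) * w p =
      MvPolynomial.X p.1 * eulerAt K p.1 (expand n P) -
        MvPolynomial.X p.2 * eulerAt K p.2 (expand n P) := by
    intro p
    have h := hw p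
    rcases ho p with h' | h' <;> rw [h'] at h
    · exact h
    · simp only [Prod.fst_swap, Prod.snd_swap] at h
      linear_combination -h
  have hne : ∀ p ∈ indexPairs n, (o p).1 ≠ (o p).2 := by
    intro p hp
    have hlt : p.1 < p.2 := by simpa [indexPairs] using hp
    rcases ho p with h' | h' <;> rw [h']
    · exact hlt.ne
    · exact hlt.ne'
  have hbound := fun p (hp : p ∈ indexPairs n) =>
    le_coeff_dividedDifference (hne p hp) (hw p) ν (hν p hp) hf
  have heq := congrArg (MvPolynomial.coeff ν) (laplaceBeltrami_equation hα.ne' hP hT w hw')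
  rw [MvPolynomial.coeff_C_mul, MvPolynomial.coeff_add, MvPolynomial.coeff_C_mul,
    MvPolynomial.coeff_C_mul, MvPolynomial.coeff_sum, MvPolynomial.coeff_sum] at heq
  simp only [coeff_eulerAt] at heq
  refine ⟨fun p => MvPolynomial.coeff ν (w p) - ν (o p).1 * MvPolynomial.coeff ν (expand n P),
    ?_, fun p hp => sub_nonneg.mpr (hbound p hp).1, fun p hp γ hγ => ?_⟩
  · rw [heq, Finset.sum_sub_distrib, ← Finset.sum_mul, ← Nat.cast_sum]
    simp only [← mul_assoc, ← Finset.sum_mul, ← sq]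
    ring
  · have := (hbound p hp).2 γ hγ
    linarith

/-- The coefficients of a triangular eigenvector with leading coefficient `1` are nonnegative: this
follows from the coefficients of the Laplace–Beltrami equation, by downward induction on the sum of
the squares of the exponents. -/
theorem coeff_expand_nonneg {α : K} (hα : 0 < α) {n : ℕ} {lam : n.Partition} {P : Sym K}
    (hP : P ∈ symDeg K n) (hT : ∀ u, sekiguchi α u n P = ptnEigenvalue α u lam • P)
    (htri : ∀ mu, ¬ DomLE mu lam → coeffAt α mu P = 0) (hlead : coeffAt α lam P = 1)
    (β : Fin n →₀ ℕ) : 0 ≤ MvPolynomial.coeff β (expand n P) := by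
  by_cases hβ : ∑ i, β i = n
  swap
  · rw [coeff_expand_eq_zero β hβ hP]
  have hle : ∀ γ : Fin n →₀ ℕ, ∑ i, γ i = n → sqSum γ ≤ n ^ 2 := by
    intro γ hγ
    refine le_of_le_of_eq ?_ (congrArg (· ^ 2) hγ)
    exact Finset.sum_sq_le_sq_sum_of_nonneg fun i _ => Nat.zero_le _
  induction hd : n ^ 2 - sqSum β using Nat.strong_induction_on generalizing β with
  | _ d ih =>
    have hf : ∀ γ : Fin n →₀ ℕ, sqSum β < sqSum γ → 0 ≤ MvPolynomial.coeff γ (expand n P) := by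
      intro γ hγ
      by_cases hγn : ∑ i, γ i = n
      · have := hle γ hγn
        exact ih _ (by omega) γ hγn rfl
      · rw [coeff_expand_eq_zero γ hγn hP]
    -- By symmetry the exponent may be replaced by the partition obtained by sorting it.
    set mu := ofFamily β hβ with hmu
    obtain ⟨σ, hσ⟩ := exists_perm_part β hβ
    rw [coeff_expand_ofFamily hα.ne' β hβ, ← hmu]
    by_cases hdom : DomLE mu lam
    swap
    · rw [htri mu hdom]
    rcases eq_or_ne mu lam with heq | hne
    · rw [heq, hlead]; exact zero_le_one
    have hsq : sqSum (expVec fun i : Fin n => part mu i) = sqSum β := by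
      simp only [sqSum, Finsupp.equivFunOnFinite_symm_apply_apply,
        ← Equiv.sum_comp σ fun i => β i ^ 2, hσ, hmu]
    obtain ⟨R, hR, hR0, -⟩ := exists_laplaceBeltrami_remainder hα hP hT
      (expVec fun i : Fin n => part mu i) (by rwa [hsq]) id (fun p => Or.inl rfl) (fun p hp => by
        have hlt : p.1 < p.2 := by simpa [indexPairs] using hp
        exact part_antitone mu hlt.le)
    have hev : 2 * ((∑ p ∈ indexPairs n, (expVec fun i : Fin n => part mu i) (id p).1 : ℕ) : K) +
        α * ∑ i, ((expVec fun i : Fin n => part mu i) i : K) ^ 2 =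
        laplaceEigenvalue α fun i : Fin n => part mu i := by
      have := sum_indexPairs_fst (fun i : Fin n => part mu i)
      simp only [id, Finsupp.equivFunOnFinite_symm_apply_apply]
      rw [this, laplaceEigenvalue, Finset.sum_add_distrib]
      push_cast
      rw [Finset.mul_sum, Finset.mul_sum]
      simp only [mul_assoc]
    rw [hev, coeff_expand_part hα.ne' mu (card_parts_le mu)] at hR
    have hgap := hdom.laplaceEigenvalue_lt hα hne
    have hsum := Finset.sum_nonneg hR0
    by_contra hneg
    nlinarith [mul_pos_of_neg_of_neg (sub_neg.mpr hgap) (not_le.mp hneg)]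

/-- An exponent vector of size `n` in `n` variables is constant, or has an entry at least `2` and a
vanishing entry. -/
theorem eq_one_or_exists_two_le {n : ℕ} (γ : Fin n → ℕ) (h : ∑ i, γ i = n) :
    (∀ i, γ i = 1) ∨ ∃ a b, 2 ≤ γ a ∧ γ b = 0 := by
  by_contra! hcon
  obtain ⟨⟨i, hi⟩, h2⟩ := hcon
  have hsum : ∑ i : Fin n, 1 = n := by simp
  by_cases h0 : ∃ b, γ b = 0
  · obtain ⟨b, hb⟩ := h0
    have hlt : ∑ i, γ i < ∑ i : Fin n, 1 := by
      refine Finset.sum_lt_sum (fun a _ => ?_) ⟨b, Finset.mem_univ b, by omega⟩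
      by_contra ha
      exact h2 a b (by omega) hb
    omega
  · push Not at h0
    have hlt : ∑ i : Fin n, 1 < ∑ i, γ i := by
      refine Finset.sum_lt_sum (fun a _ => ?_) ⟨i, Finset.mem_univ i, ?_⟩
      · have := h0 a; omega
      · have := h0 i; omega
    omega

theorem ofFamily_eq_ones {n : ℕ} {γ : Fin n → ℕ} (h : ∑ i, γ i = n) (h1 : ∀ i, γ i = 1) :
    ofFamily γ h = ones n := by
  obtain rfl : γ = fun _ => 1 := funext h1
  refine Nat.Partition.ext ?_
  simp only [ofFamily, Nat.Partition.ofSums, ones, Multiset.map_const', Finset.card_val,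
    Finset.card_univ, Fintype.card_fin]
  exact Multiset.filter_eq_self.mpr fun a ha => by simp [Multiset.eq_of_mem_replicate ha]

/-- The coefficient at `1^n` does not vanish. Otherwise let `γ` be an exponent with nonvanishing
coefficient and least sum of squares; moving a box to a vanishing entry gives an exponent `ν` with
vanishing coefficient, but the Laplace–Beltrami equation at `ν` has a positive contribution of
`γ`. -/
theorem coeffAt_ones_ne_zero {α : K} (hα : 0 < α) {n : ℕ} {lam : n.Partition} {P : Sym K}
    (hP : P ∈ symDeg K n) (hT : ∀ u, sekiguchi α u n P = ptnEigenvalue α u lam • P)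
    (htri : ∀ mu, ¬ DomLE mu lam → coeffAt α mu P = 0) (hlead : coeffAt α lam P = 1) :
    coeffAt α (ones n) P ≠ 0 := by
  classical
  have hpos := coeff_expand_nonneg hα hP hT htri hlead
  have hex : (expand n P).support.Nonempty := by
    refine ⟨expVec fun i : Fin n => part lam i, MvPolynomial.mem_support_iff.mpr ?_⟩
    rw [coeff_expand_part hα.ne' lam (card_parts_le lam), hlead]
    exact one_ne_zero
  obtain ⟨γ, hγ, hmin⟩ := Finset.exists_min_image _ sqSum hex
  have hγ0 := MvPolynomial.mem_support_iff.mp hγ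
  have hγn : ∑ i, γ i = n := by
    by_contra h
    exact hγ0 (coeff_expand_eq_zero γ h hP)
  rcases eq_one_or_exists_two_le γ hγn with h1 | ⟨a, b, ha, hb⟩
  · rwa [coeff_expand_ofFamily hα.ne' γ hγn, ofFamily_eq_ones hγn h1] at hγ0
  exfalso
  have hab : a ≠ b := by rintro rfl; omega
  obtain ⟨ν, hν⟩ : ∃ ν : Fin n →₀ ℕ, γ + Finsupp.single b 1 = ν + Finsupp.single a 1 := by
    refine ⟨γ + Finsupp.single b 1 - Finsupp.single a 1, (tsub_add_cancel_of_le ?_).symm⟩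
    rw [Finsupp.single_le_iff, Finsupp.add_apply]
    omega
  have hνa := DFunLike.congr_fun hν a
  have hνb := DFunLike.congr_fun hν b
  simp [hab, hab.symm, hb] at hνa hνb
  have hlt := sqSum_lt hab hν (by omega)
  have hν0 : MvPolynomial.coeff ν (expand n P) = 0 := by
    by_contra h
    exact absurd (hmin ν (MvPolynomial.mem_support_iff.mpr h)) (not_le.mpr hlt)
  -- Orient the pairs from the larger to the smaller exponent, and `{a, b}` from `a` to `b`.
  let o : Fin n × Fin n → Fin n × Fin n := fun p =>
    if p = (b, a) ∨ (p ≠ (a, b) ∧ ν p.1 < ν p.2) then p.swap else p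
  have ho : ∀ p, o p = p ∨ o p = p.swap := fun p => by
    simp only [o]
    split_ifs
    · exact Or.inr rfl
    · exact Or.inl rfl
  have hνo : ∀ p, ν (o p).2 ≤ ν (o p).1 := fun p => by
    simp only [o]
    split_ifs with h
    · rcases h with rfl | h
      · simp only [Prod.fst_swap, Prod.snd_swap]; omega
      · exact h.2.le
    · rw [not_or, not_and_or, not_not, not_lt] at h
      rcases h.2 with rfl | h'
      · simp only; omega
      · exact h'
  obtain ⟨R, hR, hR0, hRγ⟩ := exists_laplaceBeltrami_remainder hα hP hT ν
    (fun β _ => hpos β) o ho fun p _ => hνo p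
  obtain ⟨p, hp, hop⟩ : ∃ p ∈ indexPairs n, o p = (a, b) := by
    rcases lt_or_gt_of_ne hab with h | h
    · exact ⟨(a, b), by simpa [indexPairs] using h, by simp [o, hab]⟩
    · exact ⟨(b, a), by simpa [indexPairs] using h, by simp [o]⟩
  have hRp := hRγ p hp γ (by rw [hop]; exact hν)
  have hle := Finset.single_le_sum hR0 hp
  have hγpos := lt_of_le_of_ne (hpos γ) hγ0.symm
  rw [hν0, mul_zero, mul_zero, zero_add] at hR
  linarith

end Positivity

/-! ### Existence of the Jack functions -/

theorem exists_isJackFamily [LinearOrder K] [IsStrictOrderedRing K] {α : K} (hα : 0 < α)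
    (hirr : ∀ a b c d : ℕ, (a : K) + α * b = c + α * d → a = c ∧ b = d) :
    ∃ J, IsJackFamily α J := by
  choose P hOT hlead hT using exists_isOrthogonalTriangular hα hirr
  have hones : ∀ n (lam : n.Partition), coeffAt α (ones n) (P n lam) ≠ 0 := fun n lam =>
    coeffAt_ones_ne_zero hα ((hOT n).mem lam) (fun u => hT n u lam) ((hOT n).tri lam) (hlead n lam)
  refine ⟨fun lam => ((lam.1.factorial : K) / coeffAt α (ones lam.1) (P lam.1 lam.2)) •
    P lam.1 lam.2, ?_, ?_, ?_⟩
  · rintro ⟨n, lam⟩ ⟨m, mu⟩ hne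
    change hallForm α _ _ = 0
    rw [map_smul, map_smul, LinearMap.smul_apply]
    by_cases hnm : n = m
    · subst hnm
      rw [(hOT n).orth lam mu fun h => hne (by rw [h]), smul_zero, smul_zero]
    · rw [hallForm_eq_zero_of_degree_ne α hnm ((hOT n).mem lam) ((hOT m).mem mu), smul_zero,
        smul_zero]
  · rintro ⟨n, lam⟩ ⟨m, mu⟩ hdom
    rw [monomialCoeff_eq_hallForm hα.ne', map_smul]
    by_cases hnm : n = m
    · subst hnm
      rw [dominated_iff] at hdom
      rw [show hallForm α (completePtn α mu) (P n lam) = 0 from (hOT n).tri lam mu hdom, smul_zero]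
    · rw [hallForm_eq_zero_of_degree_ne α (Ne.symm hnm) (completePtn_mem α mu) ((hOT n).mem lam),
        smul_zero]
  · rintro ⟨n, lam⟩
    rw [monomialCoeff_eq_hallForm hα.ne', map_smul, smul_eq_mul]
    exact div_mul_cancel₀ _ (hones n lam)

/-- The field `ℚ(α)` embeds into `ℝ`, with `α` going to a positive transcendental number. -/
theorem exists_ratFunc_embedding : ∃ φ : RatFunc ℚ →+* ℝ, 0 < φ RatFunc.X := by
  set x : ℝ := liouvilleNumber (2 : ℕ)
  have hx : Transcendental ℚ x := fun h =>
    transcendental_liouvilleNumber le_rfl ((IsFractionRing.isAlgebraic_iff ℤ ℚ ℝ).mpr h)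
  -- The square of `x` is transcendental and positive.
  have hinj := transcendental_iff_injective.mp (hx.pow two_pos)
  have hle : nonZeroDivisors (Polynomial ℚ) ≤
      (nonZeroDivisors ℝ).comap (Polynomial.aeval (R := ℚ) (x ^ 2)).toRingHom :=
    nonZeroDivisors_le_comap_nonZeroDivisors_of_injective _ hinj
  refine ⟨RatFunc.liftRingHom _ hle, ?_⟩
  rw [RatFunc.liftRingHom_X]
  change 0 < Polynomial.aeval (R := ℚ) (x ^ 2) Polynomial.X
  rw [Polynomial.aeval_X]
  exact sq_pos_of_ne_zero fun h0 => hx (h0 ▸ isAlgebraic_zero)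

theorem natCast_add_X_mul_injective (a b c d : ℕ)
    (h : (a : RatFunc ℚ) + RatFunc.X * (b : RatFunc ℚ) =
      (c : RatFunc ℚ) + RatFunc.X * (d : RatFunc ℚ)) : a = c ∧ b = d := by
  have h1 : algebraMap (Polynomial ℚ) (RatFunc ℚ)
        ((a : Polynomial ℚ) + Polynomial.X * (b : Polynomial ℚ)) =
      algebraMap (Polynomial ℚ) (RatFunc ℚ)
        ((c : Polynomial ℚ) + Polynomial.X * (d : Polynomial ℚ)) := by
    simpa [RatFunc.algebraMap_X] using h
  have h2 := RatFunc.algebraMap_injective ℚ h1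
  have h3 := congrArg (Polynomial.eval 0) h2
  have h4 := congrArg (Polynomial.eval 1) h2
  simp at h3 h4
  subst h3
  exact ⟨rfl, by simpa using h4⟩

/-- The rectangle identity over an ordered field. As a family with the properties of the Jack
functions exists, the chosen family `jack α` has these properties. -/
theorem jack_rectangle [LinearOrder K] [IsStrictOrderedRing K] {α : K} (hα : 0 < α)
    (hirr : ∀ a b c d : ℕ, (a : K) + α * b = c + α * d → a = c ∧ b = d) {q r n : ℕ} (hr : 1 ≤ r)
    (lam : n.Partition) (hlam : lam.parts = Multiset.replicate q r) :
    jack α ⟨n, lam⟩ = PowerSeries.coeff n (tauNegSpecialized α (q : K) (-(r : K) * α)) := by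
  have hJ : IsJackFamily α (jack α) := Classical.epsilon_spec (exists_isJackFamily hα hirr)
  rw [coeff_tauNegSpecialized]
  exact (hJ.isOrthogonalTriangular hα n).rectangle hα hr lam hlam

end JackPoly

theorem mainTheorem10 (q r n : ℕ) (hq : 1 ≤ q) (hr : 1 ≤ r) (lam : n.Partition)
    (hlam : lam.parts = Multiset.replicate q r) :
    JackPoly.jack (RatFunc.X : RatFunc ℚ) ⟨n, lam⟩ =
      PowerSeries.coeff n
        (JackPoly.tauNegSpecialized (RatFunc.X : RatFunc ℚ) (q : RatFunc ℚ)
          (-(r : RatFunc ℚ) * RatFunc.X)) := by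
  obtain ⟨φ, hφ⟩ := JackPoly.exists_ratFunc_embedding
  -- Order `ℚ(α)` by its embedding into `ℝ`.
  let _ : LinearOrder (RatFunc ℚ) := LinearOrder.lift' φ φ.injective
  have : IsStrictOrderedRing (RatFunc ℚ) :=
    Function.Injective.isStrictOrderedRing φ (map_zero φ) (map_one φ) (map_add φ) (map_mul φ)
      Iff.rfl Iff.rfl
  refine JackPoly.jack_rectangle ?_ JackPoly.natCast_add_X_mul_injective hr lam hlam
  change φ 0 < φ RatFunc.X
  rwa [map_zero]
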